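/- Let $G=(A\cup B,E)$ be a finite bipartite graph whose vertices in $A$ are called men and those in $B$ women, where the adjacency list of each vertex is a linearly ordered list of disjoint nonempty ties. Write $y\succ_x z$ if $x$ strictly prefers $y$ to $z$, $y=_x z$ if $x$ is indifferent between them, and $y\succeq_x z$ if one of the two holds. An edge $(x,y)\in E\setminus M$ blocks a matching $M$ if one of its endpoints is unmatched or strictly prefers the other endpoint to its partner in $M$, and the other endpoint is unmatched or weakly prefers the first to its partner in $M$. A matching of $G$ is strongly stable if no edge blocks it; $\mathcal M_G$ is the set of strongly stable matchings of $G$, and $\mathcal M_G(m,w)$ the set of those that contain $(m,w)$. A member $M$ of a set $\mathcal S$ of matchings is man-optimal in $\mathcal S$ if, for every $N\in\mathcal S$, every man matched in $N$ is matched in $M$ and weakly prefers his partner in $M$ to his partner in $N$. For $(m,w)\in E$ let $G_{(m,w)}$ be the graph obtained from $G$, with inherited preferences, by deleting the following edges of $E$: the edge $(m,w)$; every edge $(m',w)$ and every edge $(m,w')$ with $m'\ne m$, $w'\ne w$; for each man $m'\neq m$ with $(m',w)\in E$, all edges $(m',w')$ with $w\succ_{m'}w'$ if $m'=_w m$, and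 all edges $(m',w')$ with $w\succeq_{m'}w'$ if $m'\succ_w m$; and for each woman $w'\ne w$ with $(m,w')\in E$, all edges $(m',w')$ with $m\succ_{w'}m'$ if $w'=_m w$, and all edges $(m',w')$ with $m\succeq_{w'}m'$ if $w'\succ_m w$. **Theorem.** (1) Let $(m,w)\in E$. If $M\in\mathcal M_G(m,w)$, then $M\setminus\{(m,w)\}\in\mathcal M_{G_{(m,w)}}$. Moreover, $N\cup\{(m,w)\}\in\mathcal M_G$ for every $N\in\mathcal M_{G_{(m,w)}}$, or $\mathcal M_G(m,w)=\emptyset$. If $N$ is man-optimal in $\mathcal M_{G_{(m,w)}}$ and $N\cup\{(m,w)\}\in\mathcal M_G$, then $N\cup\{(m,w)\}$ is man-optimal in $\mathcal M_G(m,w)$. (2) There is an algorithm that, given the preference lists of $G$ and an edge $(m,w)\in E$, decides whether $\mathcal M_G(m,w)$ is empty and, if it is not, computes a matching that is man-optimal in $\mathcal M_G(m,w)$. It runs in time $O(|V|\cdot|E|)$, $V=A\cup B$, on a random access machine whose operations (addition, truncated subtraction, indirect memory access, test for zero) have unit cost, on words of $O(\log|V|)$ bits, with one fixed program for all inputs.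 -/

import Mathlib

namespace StrongStable

/-! ### Instances, strongly stable matchings -/

/-- A bipartite graph on men `A` and women `B`, with a weak order of the neighbours at every vertex
(that is, a linearly ordered list of ties). `rankA a b < rankA a b'` means that `a` strictly prefers
`b` to `b'`, and equality means that `a` is indifferent between them; likewise for `rankB`. Only the
ranks of pairs in `E` matter. -/
structure Market (A B : Type*) where
  E : Set (A × B)
  rankA : A → B → ℕ
  rankB : B → A → ℕ

namespace Market

variable {A B : Type*}

/-- `M` is a set of edges of `G`, no two of which share an endpoint. -/
def IsMatching (G : Market A B) (M : Set (A × B)) : Prop :=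
  M ⊆ G.E ∧ ∀ e ∈ M, ∀ f ∈ M, e.1 = f.1 ∨ e.2 = f.2 → e = f

/-- `a` is unmatched in `M` or strictly prefers `b` to its partner in `M`. -/
def ManStrict (G : Market A B) (M : Set (A × B)) (a : A) (b : B) : Prop :=
  ∀ b', (a, b') ∈ M → G.rankA a b < G.rankA a b'

/-- `a` is unmatched in `M` or weakly prefers `b` to its partner in `M`. -/
def ManWeak (G : Market A B) (M : Set (A × B)) (a : A) (b : B) : Prop :=
  ∀ b', (a, b') ∈ M → G.rankA a b ≤ G.rankA a b'

/-- `b` is unmatched in `M` or strictly prefers `a` to its partner in `M`. -/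
def WomanStrict (G : Market A B) (M : Set (A × B)) (b : B) (a : A) : Prop :=
  ∀ a', (a', b) ∈ M → G.rankB b a < G.rankB b a'

/-- `b` is unmatched in `M` or weakly prefers `a` to its partner in `M`. -/
def WomanWeak (G : Market A B) (M : Set (A × B)) (b : B) (a : A) : Prop :=
  ∀ a', (a', b) ∈ M → G.rankB b a ≤ G.rankB b a'

/-- `(a, b)` is a blocking edge: one endpoint (either of the two) is unmatched or would become
strictly better off, the other one is unmatched or would not become worse off. -/
def Blocks (G : Market A B) (M : Set (A × B)) (a : A) (b : B) : Prop :=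
  (a, b) ∈ G.E ∧ (a, b) ∉ M ∧
    ((G.ManStrict M a b ∧ G.WomanWeak M b a) ∨ (G.WomanStrict M b a ∧ G.ManWeak M a b))

/-- The set of strongly stable matchings of `G`. -/
def stableSet (G : Market A B) : Set (Set (A × B)) :=
  {M | G.IsMatching M ∧ ∀ a b, ¬ G.Blocks M a b}

/-- The set of strongly stable matchings of `G` that contain the edge `(m, w)`. -/
def stableSetWith (G : Market A B) (m : A) (w : B) : Set (Set (A × B)) :=
  {M | M ∈ G.stableSet ∧ (m, w) ∈ M}

/-- Every man is in `M` at least as well off as in `N` (in particular, a man matched in `N` is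
matched in `M`). -/
def Dominates (G : Market A B) (M N : Set (A × B)) : Prop :=
  ∀ a b', (a, b') ∈ N → ∃ b, (a, b) ∈ M ∧ G.rankA a b ≤ G.rankA a b'

/-- `M` is a man-optimal member of the set `S` of matchings. -/
def IsManOptimal (G : Market A B) (S : Set (Set (A × B))) (M : Set (A × B)) : Prop :=
  M ∈ S ∧ ∀ N ∈ S, G.Dominates M N

/-- The edges `(x, y)` of `G` that are deleted in the construction of the pruned graph of
`(m, w)`. -/
def Deleted (G : Market A B) (m : A) (w : B) (x : A) (y : B) : Prop :=
  (x = m ∧ y = w)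
  -- `x` is a neighbour of `w` to which `w` strictly prefers `m`
  ∨ (G.rankB w m < G.rankB w x ∧ y = w)
  -- `x` is a neighbour of `w`, and `w` is indifferent between `m` and `x`
  ∨ ((x, w) ∈ G.E ∧ G.rankB w m = G.rankB w x ∧ (y = w ∨ G.rankA x w < G.rankA x y))
  -- `x` is a neighbour of `w` whom `w` strictly prefers to `m`
  ∨ ((x, w) ∈ G.E ∧ G.rankB w x < G.rankB w m ∧ (y = w ∨ G.rankA x w ≤ G.rankA x y))
  -- `y` is a neighbour of `m` to whom `m` strictly prefers `w`
  ∨ (G.rankA m w < G.rankA m y ∧ x = m)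
  -- `y` is a neighbour of `m`, and `m` is indifferent between `w` and `y`
  ∨ ((m, y) ∈ G.E ∧ G.rankA m w = G.rankA m y ∧ (x = m ∨ G.rankB y m < G.rankB y x))
  -- `y` is a neighbour of `m` whom `m` strictly prefers to `w`
  ∨ ((m, y) ∈ G.E ∧ G.rankA m y < G.rankA m w ∧ (x = m ∨ G.rankB y m ≤ G.rankB y x))

/-- The pruned subgraph of `G` for the edge `(m, w)`, with the inherited preferences. -/
def pruned (G : Market A B) (m : A) (w : B) : Market A B where
  E := {e | e ∈ G.E ∧ ¬ G.Deleted m w e.1 e.2}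
  rankA := G.rankA
  rankB := G.rankB

end Market

/-! ### Preference lists as data -/

/-- An instance given by its preference lists: the adjacency list of every vertex is a list of
nonempty disjoint ties, the most preferred tie first. -/
structure PrefLists (nA nB : ℕ) where
  men : Fin nA → List (List (Fin nB))
  women : Fin nB → List (List (Fin nA))
  men_nodup : ∀ a, (men a).flatten.Nodup
  women_nodup : ∀ b, (women b).flatten.Nodup
  men_nonempty : ∀ a, [] ∉ men a
  women_nonempty : ∀ b, [] ∉ women b
  symm : ∀ a b, b ∈ (men a).flatten ↔ a ∈ (women b).flatten

/-- The graph with preferences that is described by the lists: the rank of a neighbour is the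
position of its tie. -/
def PrefLists.toMarket {nA nB : ℕ} (P : PrefLists nA nB) : Market (Fin nA) (Fin nB) where
  E := {e | e.2 ∈ (P.men e.1).flatten}
  rankA a b := (P.men a).findIdx (fun T => decide (b ∈ T))
  rankB b a := (P.women b).findIdx (fun T => decide (a ∈ T))

/-! ### A random access machine with a structured program -/

/-- Memory: scalar registers, and finitely many (as many as the program mentions) arrays of
registers, accessed by computed indices. -/
structure Store where
  var : ℕ → ℕ
  arr : ℕ → ℕ → ℕ

/-- Expressions: constants, registers, array cells, sum, truncated difference. -/
inductive Expr where
  | const (c : ℕ)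
  | var (x : ℕ)
  | load (r : ℕ) (i : Expr)
  | add (e f : Expr)
  | sub (e f : Expr)

namespace Expr

def eval (s : Store) : Expr → ℕ
  | const c => c
  | var x => s.var x
  | load r i => s.arr r (i.eval s)
  | add e f => e.eval s + f.eval s
  | sub e f => e.eval s - f.eval s

/-- The number of unit-cost operations performed in an evaluation. -/
def cost : Expr → ℕ
  | const _ => 1
  | var _ => 1
  | load _ i => i.cost + 1
  | add e f => e.cost + f.cost + 1
  | sub e f => e.cost + f.cost + 1

/-- The largest number that occurs in an evaluation, including array indices and intermediate
results. -/
def peak (s : Store) : Expr → ℕ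
  | const c => c
  | var x => s.var x
  | load r i => max (i.peak s) (s.arr r (i.eval s))
  | add e f => max (max (e.peak s) (f.peak s)) (e.eval s + f.eval s)
  | sub e f => max (e.peak s) (f.peak s)

end Expr

/-- Programs. A test is an expression; it succeeds if its value is not zero. -/
inductive Prog where
  | skip
  | assign (x : ℕ) (e : Expr)
  | store (r : ℕ) (i e : Expr)
  | seq (p q : Prog)
  | cond (e : Expr) (p q : Prog)
  | loop (e : Expr) (p : Prog)

/-- `Exec W p s t s'`: started in `s`, the program `p` halts in `s'` after exactly `t` steps, and
no number that it handles exceeds `W`. -/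
inductive Exec (W : ℕ) : Prog → Store → ℕ → Store → Prop where
  | skip (s : Store) : Exec W Prog.skip s 1 s
  | assign (s : Store) (x : ℕ) (e : Expr) (he : e.peak s ≤ W) :
      Exec W (Prog.assign x e) s (e.cost + 1)
        { s with var := Function.update s.var x (e.eval s) }
  | store (s : Store) (r : ℕ) (i e : Expr) (hi : i.peak s ≤ W) (he : e.peak s ≤ W) :
      Exec W (Prog.store r i e) s (i.cost + e.cost + 1)
        { s with
          arr := Function.update s.arr r (Function.update (s.arr r) (i.eval s) (e.eval s)) }
  | seq {p q : Prog} {s s' s'' : Store} {t t' : ℕ} (hp : Exec W p s t s')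
      (hq : Exec W q s' t' s'') : Exec W (Prog.seq p q) s (t + t') s''
  | cond_true {e : Expr} {p q : Prog} {s s' : Store} {t : ℕ} (he : e.peak s ≤ W)
      (h : e.eval s ≠ 0) (hp : Exec W p s t s') :
      Exec W (Prog.cond e p q) s (e.cost + 1 + t) s'
  | cond_false {e : Expr} {p q : Prog} {s s' : Store} {t : ℕ} (he : e.peak s ≤ W)
      (h : e.eval s = 0) (hq : Exec W q s t s') :
      Exec W (Prog.cond e p q) s (e.cost + 1 + t) s'
  | loop_stop {e : Expr} {p : Prog} {s : Store} (he : e.peak s ≤ W) (h : e.eval s = 0) :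
      Exec W (Prog.loop e p) s (e.cost + 1) s
  | loop_step {e : Expr} {p : Prog} {s s' s'' : Store} {t t' : ℕ} (he : e.peak s ≤ W)
      (h : e.eval s ≠ 0) (hp : Exec W p s t s') (hl : Exec W (Prog.loop e p) s' t' s'') :
      Exec W (Prog.loop e p) s (e.cost + 1 + t + t') s''

/-! ### Input and output -/

/-- All adjacency lists, written one after the other. -/
def neighbours {k l : ℕ} (L : Fin k → List (List (Fin l))) : List ℕ :=
  (List.finRange k).flatMap fun v => (L v).flatten.map Fin.val

/-- For every entry of `neighbours L`, the number (counted from 1) of its tie in the adjacency list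
to which the entry belongs. -/
def tieNumbers {k l : ℕ} (L : Fin k → List (List (Fin l))) : List ℕ :=
  (List.finRange k).flatMap fun v => (L v).zipIdx.flatMap fun T => T.1.map fun _ => T.2 + 1

/-- `offset L i` is the position in `neighbours L` at which the list of vertex `i` begins;
`offset L k` is the total length. -/
def offset {k l : ℕ} (L : Fin k → List (List (Fin l))) (i : ℕ) : ℕ :=
  (((List.finRange k).take i).flatMap fun v => (L v).flatten).length

/-- The initial memory: registers 0 to 3 hold the numbers of men and women and the query `(m, w)`;
arrays 0 to 2 hold the preference lists of the men, arrays 3 to 5 those of the women; everything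
else is zero (except that the offset arrays 0 and 3 keep their last value from then on). Vertices are
numbered from 0. -/
def initial {nA nB : ℕ} (P : PrefLists nA nB) (m : Fin nA) (w : Fin nB) : Store where
  var
    | 0 => nA
    | 1 => nB
    | 2 => m
    | 3 => w
    | _ => 0
  arr
    | 0 => offset P.men
    | 1 => fun p => (neighbours P.men).getD p 0
    | 2 => fun p => (tieNumbers P.men).getD p 0
    | 3 => offset P.women
    | 4 => fun p => (neighbours P.women).getD p 0
    | 5 => fun p => (tieNumbers P.women).getD p 0
    | _ => fun _ => 0

/-- In memory `s`, array 6 holds the matching `M`: its cell `a` is `b + 1` if the man `a` is matched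
to `b`, and `0` if `a` is unmatched. -/
def HoldsMatching {nA nB : ℕ} (s : Store) (M : Set (Fin nA × Fin nB)) : Prop :=
  ∀ a : Fin nA, (∀ b : Fin nB, (a, b) ∈ M ↔ s.arr 6 a = b + 1) ∧
    ((∀ b : Fin nB, (a, b) ∉ M) → s.arr 6 a = 0)

/-- A correct final memory for the query `(m, w)` in `G`: register 4 is `0` if no strongly stable
matching of `G` contains `(m, w)`; otherwise it is `1` and array 6 holds a man-optimal one among the
strongly stable matchings of `G` that contain `(m, w)`. -/
def CorrectOutput {nA nB : ℕ} (G : Market (Fin nA) (Fin nB)) (m : Fin nA) (w : Fin nB)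
    (s : Store) : Prop :=
  (G.stableSetWith m w = ∅ ∧ s.var 4 = 0) ∨
    (G.stableSetWith m w ≠ ∅ ∧ s.var 4 = 1 ∧
      ∃ M, G.IsManOptimal (G.stableSetWith m w) M ∧ HoldsMatching s M)

end StrongStable

/-! Part (1). An edge of `M` that is deleted on behalf of `(m, w)` would leave a vertex that blocks
`M` together with `w` or with `m`; this gives `diff_mem_pruned`. For the converse, the same people
are matched in all strongly stable matchings of one graph (`man_matched`, `woman_matched`). Hence,
if some `M` contains `(m, w)`, every strongly stable `N` of the pruned graph matches each neighbour
of `w` whom she likes at least as much as `m`, and by an undeleted edge, that is, well enough to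
keep him from blocking with `w`; the neighbours of `m` are symmetric (`union_mem_stableSet`).
Man-optimality is transferred by removing `(m, w)`.

Part (2). It suffices to compute a matching of the pruned graph that is strongly stable and
man-optimal there provided any strongly stable matching exists, to add `(m, w)`, and to test the
result for blocking edges of `G`. By part (1) a failed test means that no strongly stable matching
contains `(m, w)`.

The men propose tie by tie. Each woman has a cap, the worst rank that she still accepts. Edges of a
current tie whose rank equals the cap are live, and the free men must be matched along live edges.
This is done by an auction. A free man in sweep `l` of his tie takes a woman of price `l`, raises
her price to `l + 1` and frees her former partner. Prices do not exceed `nB + 1`.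

A free man who meets a live woman in sweep `nB + 1` proves that her cap is too generous. If some
strongly stable matching `M` gave her a partner of exactly that rank, then a walk that alternates
between edges of `M` and engagements would start at this man and visit women whose prices drop by at
most one per step; it would meet `nB + 1` different women (`valid_strip`). So her cap is lowered by
one. A man whose last sweep is over has only dead edges in his tie and goes on to the next one.

Thus no edge of any strongly stable matching is ever discarded. At the end a counting argument shows
that every woman with a lowered cap is engaged (`exists_engaged_woman`), so the engagements are
strongly stable (`engaged_stable`) and best possible for the men (`engaged_dominates`). A tie is
swept at most `nB + 2` times, so the cursors make `O(nB * |E|)` movements. Time and word length of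
the program are obtained from weakest preconditions of loop-free bodies and decreasing measures for
the loops. -/

namespace StrongStable

/-! ### Strongly stable matchings of a graph and of its pruned graph -/

namespace Market

variable {A B : Type*}

/-- The same graph with the roles of men and women exchanged. -/
def swap (G : Market A B) : Market B A where
  E := {e | (e.2, e.1) ∈ G.E}
  rankA := G.rankB
  rankB := G.rankA

theorem swap_mem_stableSet {G : Market A B} {M : Set (A × B)} (hM : M ∈ G.stableSet) :
    {e : B × A | (e.2, e.1) ∈ M} ∈ G.swap.stableSet := by
  refine ⟨⟨fun e he => hM.1.1 he, ?_⟩, ?_⟩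
  · rintro ⟨b, a⟩ he ⟨b', a'⟩ hf h
    have := hM.1.2 (a, b) he (a', b') hf h.symm
    simp only [Prod.mk.injEq] at this ⊢
    exact this.symm
  · rintro b a ⟨h1, h2, h3⟩
    exact hM.2 a b ⟨h1, h2, h3.symm⟩

/-- A man who is matched in one strongly stable matching is matched in all of them. -/
theorem man_matched [Finite A] {G : Market A B} {M N : Set (A × B)} (hM : M ∈ G.stableSet)
    (hN : N ∈ G.stableSet) {a : A} {b : B} (hab : (a, b) ∈ M) : ∃ b', (a, b') ∈ N := by
  by_contra hno
  push Not at hno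
  -- The men who are strictly better off in `M` than in `N`. If such a man has the partner `b` in
  -- `M`, stability of `N` makes `b` strictly better off in `N`, and then stability of `M` puts her
  -- partner in `N` into `S` as well. The resulting injection of the finite set `S` into itself is
  -- onto; so `a`, who lies in `S` if he is unmatched in `N`, would be matched in `N`.
  let S := {a : A // ∃ b, (a, b) ∈ M ∧ G.ManStrict N a b}
  have key : ∀ x : S, ∃ y : S, ∃ b, (x.1, b) ∈ M ∧ (y.1, b) ∈ N := by
    rintro ⟨x, b, hxb, hs⟩
    have hxN : (x, b) ∉ N := fun h => lt_irrefl _ (hs b h)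
    have h1 : ¬ G.WomanWeak N b x := fun h =>
      hN.2 x b ⟨hM.1.1 hxb, hxN, Or.inl ⟨hs, h⟩⟩
    simp only [WomanWeak, not_forall, not_le] at h1
    obtain ⟨y, hy, hlt⟩ := h1
    have hMb : ∀ z, (z, b) ∈ M → z = x := fun z hz =>
      congrArg Prod.fst (hM.1.2 (z, b) hz (x, b) hxb (Or.inr rfl))
    have hyM : (y, b) ∉ M := fun h => by
      rw [hMb y h] at hlt; exact lt_irrefl _ hlt
    have h2 : ¬ G.ManWeak M y b := fun h =>
      hM.2 y b ⟨hN.1.1 hy, hyM, Or.inr ⟨fun z hz => by rw [hMb z hz]; exact hlt, h⟩⟩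
    simp only [ManWeak, not_forall, not_le] at h2
    obtain ⟨b2, hb2, hlt2⟩ := h2
    refine ⟨⟨y, b2, hb2, fun b3 hb3 => ?_⟩, b, hxb, hy⟩
    have : b3 = b := congrArg Prod.snd (hN.1.2 (y, b3) hb3 (y, b) hy (Or.inl rfl))
    rw [this]; exact hlt2
  choose f hf using key
  have hinj : Function.Injective f := by
    intro x y hxy
    obtain ⟨b1, h1, h2⟩ := hf x
    obtain ⟨b2, h3, h4⟩ := hf y
    rw [hxy] at h2
    have : b1 = b2 := congrArg Prod.snd (hN.1.2 _ h2 _ h4 (Or.inl rfl))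
    subst this
    exact Subtype.ext (congrArg Prod.fst (hM.1.2 _ h1 _ h3 (Or.inr rfl)))
  have hsurj : Function.Surjective f := Finite.surjective_of_injective hinj
  obtain ⟨x, hx⟩ := hsurj ⟨a, b, hab, fun b' h => (hno b' h).elim⟩
  obtain ⟨b', -, h⟩ := hf x
  rw [hx] at h
  exact hno b' h

theorem woman_matched [Finite B] {G : Market A B} {M N : Set (A × B)} (hM : M ∈ G.stableSet)
    (hN : N ∈ G.stableSet) {a : A} {b : B} (hab : (a, b) ∈ M) : ∃ a', (a', b) ∈ N :=
  man_matched (swap_mem_stableSet hM) (swap_mem_stableSet hN) (a := b) (b := a) hab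

/-- The clauses for men whom `w` finds worse than, equal to or better than `m` together delete all
edges at `w`, and likewise at `m`: both become isolated. -/
theorem pruned_ne {G : Market A B} {m x : A} {w y : B} (h : (x, y) ∈ (G.pruned m w).E) :
    x ≠ m ∧ y ≠ w := by
  obtain ⟨hE, hD⟩ := h
  constructor
  · rintro rfl
    apply hD
    rcases lt_trichotomy (G.rankA x w) (G.rankA x y) with h | h | h <;> simp_all [Deleted]
  · rintro rfl
    apply hD
    rcases lt_trichotomy (G.rankB y m) (G.rankB y x) with h | h | h <;> simp_all [Deleted]

/-- If `(x, y) ∈ M` with `x ≠ m`, `y ≠ w` is deleted because of `w`, then `x` weakly prefers `w` to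
`y` and `w` weakly prefers `x` to `m`, one of the two strictly, so `(x, w)` blocks `M`. Edges of the
pruned graph avoid `m` and `w`, and their endpoints do not notice the removal of `(m, w)`. -/
theorem diff_mem_pruned {G : Market A B} {m : A} {w : B} {M : Set (A × B)}
    (hM : M ∈ G.stableSetWith m w) : M \ {(m, w)} ∈ (G.pruned m w).stableSet := by
  obtain ⟨⟨⟨hE, hmat⟩, hst⟩, hmw⟩ := hM
  have hw : ∀ z, (z, w) ∈ M → z = m := fun z hz =>
    congrArg Prod.fst (hmat (z, w) hz (m, w) hmw (Or.inr rfl))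
  have hm : ∀ z, (m, z) ∈ M → z = w := fun z hz =>
    congrArg Prod.snd (hmat (m, z) hz (m, w) hmw (Or.inl rfl))
  refine ⟨⟨?_, fun e he f hf => hmat e he.1 f hf.1⟩, ?_⟩
  · rintro ⟨x, y⟩ ⟨hxy, hne⟩
    have hxm : x ≠ m := by rintro rfl; exact hne (by rw [hm y hxy]; rfl)
    have hyw : y ≠ w := by rintro rfl; exact hne (by rw [hw x hxy]; rfl)
    have hx : ∀ z, (x, z) ∈ M → z = y := fun z hz =>
      congrArg Prod.snd (hmat (x, z) hz (x, y) hxy (Or.inl rfl))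
    have hy : ∀ z, (z, y) ∈ M → z = x := fun z hz =>
      congrArg Prod.fst (hmat (z, y) hz (x, y) hxy (Or.inr rfl))
    have hxw : (x, w) ∉ M := fun h => hxm (hw x h)
    have hmy : (m, y) ∉ M := fun h => hyw (hm y h)
    refine ⟨hE hxy, ?_⟩
    rintro (⟨rfl, rfl⟩ | ⟨-, h⟩ | ⟨h1, h2, h | h⟩ | ⟨h1, h2, h | h⟩ | ⟨-, h⟩ | ⟨h1, h2, h | h⟩ |
      ⟨h1, h2, h | h⟩)
    · exact hxm rfl
    · exact hyw h
    · exact hyw h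
    · refine hst x w ⟨h1, hxw, Or.inl ⟨fun z hz => ?_, fun z hz => ?_⟩⟩
      · rw [hx z hz]; exact h
      · rw [hw z hz]; exact h2.ge
    · exact hyw h
    · refine hst x w ⟨h1, hxw, Or.inr ⟨fun z hz => ?_, fun z hz => ?_⟩⟩
      · rw [hw z hz]; exact h2
      · rw [hx z hz]; exact h
    · exact hxm h
    · exact hxm h
    · refine hst m y ⟨h1, hmy, Or.inr ⟨fun z hz => ?_, fun z hz => ?_⟩⟩
      · rw [hy z hz]; exact h
      · rw [hm z hz]; exact h2.ge
    · exact hxm h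
    · refine hst m y ⟨h1, hmy, Or.inl ⟨fun z hz => ?_, fun z hz => ?_⟩⟩
      · rw [hm z hz]; exact h2
      · rw [hy z hz]; exact h
  · rintro a b ⟨h1, h2, h3⟩
    obtain ⟨ha, hb⟩ := pruned_ne h1
    have e1 : ∀ z, (a, z) ∈ M ↔ (a, z) ∈ M \ {(m, w)} := fun z => by simp [ha]
    have e2 : ∀ z, (z, b) ∈ M ↔ (z, b) ∈ M \ {(m, w)} := fun z => by simp [hb]
    refine hst a b ⟨h1.1, fun h => h2 ((e1 b).1 h), ?_⟩
    simpa only [ManStrict, ManWeak, WomanStrict, WomanWeak, e1, e2, pruned] using h3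

/-- The matching `M` guarantees that vertices able to tempt `w` or `m` are matched in `M \ {(m,
w)}`, hence in `N`; that their partners in `N` are good enough is what the deletions enforce. -/
theorem union_mem_stableSet [Finite A] [Finite B] {G : Market A B} {m : A} {w : B}
    {M N : Set (A × B)} (hM : M ∈ G.stableSetWith m w)
    (hN : N ∈ (G.pruned m w).stableSet) : N ∪ {(m, w)} ∈ G.stableSet := by
  have hM' := diff_mem_pruned hM
  obtain ⟨⟨⟨hE, hmat⟩, hst⟩, hmw⟩ := hM
  have hNE : ∀ {x y}, (x, y) ∈ N → x ≠ m ∧ y ≠ w := fun h => pruned_ne (hN.1.1 h)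
  have hw : ∀ z, (z, w) ∈ M → z = m := fun z hz =>
    congrArg Prod.fst (hmat (z, w) hz (m, w) hmw (Or.inr rfl))
  have hm : ∀ z, (m, z) ∈ M → z = w := fun z hz =>
    congrArg Prod.snd (hmat (m, z) hz (m, w) hmw (Or.inl rfl))
  -- a neighbour of `w` or `m` that is at least as good as the partner is matched in `N`
  have manN : ∀ x, x ≠ m → (x, w) ∈ G.E → G.rankB w x ≤ G.rankB w m → ∃ y, (x, y) ∈ N := by
    intro x hx hxw hr
    by_contra hno
    have hfree : ∀ y, (x, y) ∉ M := by
      intro y hy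
      exact hno (man_matched hM' hN (a := x) (b := y) ⟨hy, by simp [hx]⟩)
    refine hst x w ⟨hxw, hfree w, Or.inl ⟨fun z hz => (hfree z hz).elim, fun z hz => ?_⟩⟩
    rw [hw z hz]; exact hr
  have womanN : ∀ y, y ≠ w → (m, y) ∈ G.E → G.rankA m y ≤ G.rankA m w → ∃ x, (x, y) ∈ N := by
    intro y hy hmy hr
    by_contra hno
    have hfree : ∀ x, (x, y) ∉ M := by
      intro x hx
      exact hno (woman_matched hM' hN (a := x) (b := y) ⟨hx, by simp [hy]⟩)
    refine hst m y ⟨hmy, hfree m, Or.inr ⟨fun z hz => (hfree z hz).elim, fun z hz => ?_⟩⟩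
    rw [hm z hz]; exact hr
  -- such a vertex is matched to somebody it likes enough
  have manGood : ∀ x, x ≠ m → (x, w) ∈ G.E → G.rankB w x ≤ G.rankB w m →
      ∃ y, (x, y) ∈ N ∧ G.rankA x y ≤ G.rankA x w ∧
        (G.rankB w x < G.rankB w m → G.rankA x y < G.rankA x w) := by
    intro x hx hxw hr
    obtain ⟨y, hy⟩ := manN x hx hxw hr
    have hD := (hN.1.1 hy).2
    simp only [Deleted] at hD
    refine ⟨y, hy, ?_, ?_⟩
    · rcases hr.lt_or_eq with h | h
      · by_contra hc
        exact hD (by right; right; right; left; exact ⟨hxw, h, Or.inr (not_le.1 hc).le⟩)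
      · by_contra hc
        exact hD (by right; right; left; exact ⟨hxw, h.symm, Or.inr (not_le.1 hc)⟩)
    · intro h
      by_contra hc
      exact hD (by right; right; right; left; exact ⟨hxw, h, Or.inr (not_lt.1 hc)⟩)
  have womanGood : ∀ y, y ≠ w → (m, y) ∈ G.E → G.rankA m y ≤ G.rankA m w →
      ∃ x, (x, y) ∈ N ∧ G.rankB y x ≤ G.rankB y m ∧
        (G.rankA m y < G.rankA m w → G.rankB y x < G.rankB y m) := by
    intro y hy hmy hr
    obtain ⟨x, hx⟩ := womanN y hy hmy hr
    have hD := (hN.1.1 hx).2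
    simp only [Deleted] at hD
    refine ⟨x, hx, ?_, ?_⟩
    · rcases hr.lt_or_eq with h | h
      · by_contra hc
        exact hD (by iterate 6 right
                     exact ⟨hmy, h, Or.inr (not_le.1 hc).le⟩)
      · by_contra hc
        exact hD (by iterate 5 right
                     left; exact ⟨hmy, h.symm, Or.inr (not_le.1 hc)⟩)
    · intro h
      by_contra hc
      exact hD (by iterate 6 right
                   exact ⟨hmy, h, Or.inr (not_lt.1 hc)⟩)
  refine ⟨⟨?_, ?_⟩, ?_⟩
  · rintro e (he | he)
    · exact (hN.1.1 he).1
    · rw [Set.mem_singleton_iff.1 he]; exact hE hmw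
  · rintro ⟨x, y⟩ (he | he) ⟨x', y'⟩ (hf | hf) h
    · exact hN.1.2 _ he _ hf h
    · simp only [Set.mem_singleton_iff, Prod.mk.injEq] at hf
      obtain ⟨rfl, rfl⟩ := hf
      rcases h with h | h
      · exact ((hNE he).1 h).elim
      · exact ((hNE he).2 h).elim
    · simp only [Set.mem_singleton_iff, Prod.mk.injEq] at he
      obtain ⟨rfl, rfl⟩ := he
      rcases h with h | h
      · exact ((hNE hf).1 h.symm).elim
      · exact ((hNE hf).2 h.symm).elim
    · rw [Set.mem_singleton_iff.1 he, Set.mem_singleton_iff.1 hf]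
  -- A blocking edge at `m` or `w`, or a deleted one, contradicts `manGood` or `womanGood`; any
  -- other one would already block `N` in the pruned graph.
  · rintro a b ⟨h1, h2, h3⟩
    have hmwU : (m, w) ∈ N ∪ {(m, w)} := Or.inr rfl
    by_cases ha : a = m
    · subst ha
      have hb : b ≠ w := by rintro rfl; exact h2 hmwU
      rcases h3 with ⟨hs, hwk⟩ | ⟨hs, hwk⟩
      · have hlt := hs w hmwU
        obtain ⟨x, hx, -, h⟩ := womanGood b hb h1 hlt.le
        exact absurd (hwk x (Or.inl hx)) (not_le.2 (h hlt))
      · obtain ⟨x, hx, h, -⟩ := womanGood b hb h1 (hwk w hmwU)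
        exact absurd (hs x (Or.inl hx)) (not_lt.2 h)
    by_cases hb : b = w
    · subst hb
      rcases h3 with ⟨hs, hwk⟩ | ⟨hs, hwk⟩
      · obtain ⟨y, hy, h, -⟩ := manGood a ha h1 (hwk m hmwU)
        exact absurd (hs y (Or.inl hy)) (not_lt.2 h)
      · have hlt := hs m hmwU
        obtain ⟨y, hy, -, h⟩ := manGood a ha h1 hlt.le
        exact absurd (hwk y (Or.inl hy)) (not_le.2 (h hlt))
    have mw : G.ManWeak N a b := by
      rcases h3 with ⟨hs, -⟩ | ⟨-, hs⟩
      · exact fun z hz => (hs z (Or.inl hz)).le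
      · exact fun z hz => hs z (Or.inl hz)
    have ww : G.WomanWeak N b a := by
      rcases h3 with ⟨-, hs⟩ | ⟨hs, -⟩
      · exact fun z hz => hs z (Or.inl hz)
      · exact fun z hz => (hs z (Or.inl hz)).le
    by_cases hD : G.Deleted m w a b
    · rcases hD with ⟨rfl, rfl⟩ | ⟨-, h⟩ | ⟨h1, h2, h | h⟩ | ⟨h1, h2, h | h⟩ | ⟨-, h⟩ |
        ⟨h1, h2, h | h⟩ | ⟨h1, h2, h | h⟩
      · exact ha rfl
      · exact hb h
      · exact hb h
      · obtain ⟨y, hy, h3, -⟩ := manGood a ha h1 h2.ge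
        exact absurd (mw y hy) (not_le.2 (h3.trans_lt h))
      · exact hb h
      · obtain ⟨y, hy, -, h3⟩ := manGood a ha h1 h2.le
        exact absurd (mw y hy) (not_le.2 ((h3 h2).trans_le h))
      · exact ha h
      · exact ha h
      · obtain ⟨y, hy, h3, -⟩ := womanGood b hb h1 h2.ge
        exact absurd (ww y hy) (not_le.2 (h3.trans_lt h))
      · exact ha h
      · obtain ⟨y, hy, -, h3⟩ := womanGood b hb h1 h2.le
        exact absurd (ww y hy) (not_le.2 ((h3 h2).trans_le h))
    · refine hN.2 a b ⟨⟨h1, hD⟩, fun h => h2 (Or.inl h), ?_⟩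
      rcases h3 with ⟨hs, -⟩ | ⟨hs, -⟩
      · exact Or.inl ⟨fun z hz => hs z (Or.inl hz), ww⟩
      · exact Or.inr ⟨fun z hz => hs z (Or.inl hz), mw⟩

theorem isManOptimal_union {G : Market A B} {m : A} {w : B} {N : Set (A × B)}
    (hN : (G.pruned m w).IsManOptimal (G.pruned m w).stableSet N)
    (hU : N ∪ {(m, w)} ∈ G.stableSet) :
    G.IsManOptimal (G.stableSetWith m w) (N ∪ {(m, w)}) := by
  refine ⟨⟨hU, Or.inr rfl⟩, fun M hM a b hab => ?_⟩
  by_cases h : (a, b) = (m, w)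
  · exact ⟨b, Or.inr h, le_rfl⟩
  · obtain ⟨b', h1, h2⟩ := hN.2 _ (diff_mem_pruned hM) a b ⟨hab, h⟩
    exact ⟨b', Or.inl h1, h2⟩

end Market

end StrongStable

/-! ### The auction on positions: instance, state and invariant -/

namespace StrongStable

/-- Edges as positions: the adjacency lists of the men are written one after the other; `own`, `nb`,
`tn`, `R` give the man, the woman, the rank for the man and the rank for the woman of an edge, and
`te` the end of its tie. An edge with `R e = nA + 2` is absent. -/
structure EdgeList where
  nA : ℕ
  nB : ℕ
  mm : ℕ
  off : ℕ → ℕ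
  nb : ℕ → ℕ
  tn : ℕ → ℕ
  own : ℕ → ℕ
  R : ℕ → ℕ
  te : ℕ → ℕ
  off_last : off nA = mm
  off_le : ∀ a < nA, off a ≤ off (a + 1)
  own_lt : ∀ e < mm, own e < nA
  own_eq : ∀ a < nA, ∀ e, off a ≤ e → e < off (a + 1) → e < mm ∧ own e = a
  own_seg : ∀ e < mm, off (own e) ≤ e ∧ e < off (own e + 1)
  nb_lt : ∀ e < mm, nb e < nB
  -- Caps are at most `nA + 1`, so an absent edge lies above every cap; and `nA + 1`, the initial
  -- cap, is the rank of no edge, so an edge whose rank equals a cap is present.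
  R_spec : ∀ e < mm, (1 ≤ R e ∧ R e ≤ nA) ∨ R e = nA + 2
  te_gt : ∀ e < mm, e < te e ∧ te e ≤ off (own e + 1)
  te_spec : ∀ e < mm, ∀ f, e ≤ f → f < off (own e + 1) → (tn f = tn e ↔ f < te e)
  tn_mono : ∀ e f, e ≤ f → f < mm → own e = own f → tn e ≤ tn f

namespace EdgeList

/-- A strongly stable matching, as a set of positions. -/
structure Stable (I : EdgeList) (M : Set ℕ) : Prop where
  lt : ∀ e ∈ M, e < I.mm
  present : ∀ e ∈ M, I.R e ≤ I.nA
  own_inj : ∀ e ∈ M, ∀ f ∈ M, I.own e = I.own f → e = f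
  nb_inj : ∀ e ∈ M, ∀ f ∈ M, I.nb e = I.nb f → e = f
  man : ∀ e < I.mm, I.R e ≤ I.nA → e ∉ M → (∀ f ∈ M, I.own f = I.own e → I.tn e < I.tn f) →
    ∃ f ∈ M, I.nb f = I.nb e ∧ I.R f < I.R e
  woman : ∀ e < I.mm, I.R e ≤ I.nA → e ∉ M → (∀ f ∈ M, I.nb f = I.nb e → I.R e < I.R f) →
    ∃ f ∈ M, I.own f = I.own e ∧ I.tn f < I.tn e

/-- The state of the algorithm. A woman `b` accepts proposals of rank at most `c b`; `q b` is her
price, `N b - 1` the edge by which she is engaged (`N b = 0`: free). A man `a` works on the tie that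
begins at `s a`, in sweep `l a`, at position `i a`. The free men are `st 0, …, st (sp - 1)`. -/
structure State where
  c : ℕ → ℕ
  q : ℕ → ℕ
  N : ℕ → ℕ
  st : ℕ → ℕ
  s : ℕ → ℕ
  l : ℕ → ℕ
  i : ℕ → ℕ
  sp : ℕ

/-- The edge belongs to the tie on which its owner works. -/
def Current (I : EdgeList) (σ : State) (e : ℕ) : Prop :=
  σ.s (I.own e) ≤ e ∧ e < I.te (σ.s (I.own e))

/-- An edge is live if it is current and its rank equals the cap of its woman. `dead` and `passed`
say that edges behind the tie lie above the cap, and that edges of the tie inspected at least once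
are not below it. `price` is the auction condition: no live woman costs less than the level of her
suitor, and those already inspected in this sweep cost more. `mate` ties the price of an engaged
woman to the level of her partner, whose cursor stands just behind the engaging edge. `valid_s` and
`valid_c` say that no strongly stable matching has been lost: it uses no tie given up by a man and
gives no woman less than her cap promises. -/
structure Inv (I : EdgeList) (σ : State) : Prop where
  s_rng : ∀ a < I.nA, I.off a ≤ σ.s a ∧ σ.s a ≤ I.off (a + 1)
  i_rng : ∀ a < I.nA, σ.s a < I.off (a + 1) →
    σ.s a ≤ σ.i a ∧ σ.i a ≤ I.te (σ.s a) ∧ σ.l a ≤ I.nB + 1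
  exhausted : ∀ a < I.nA, σ.s a = I.off (a + 1) → σ.l a = 0 ∧ σ.i a = σ.s a
  c_le : ∀ b < I.nB, σ.c b ≤ I.nA + 1
  q_rng : ∀ b < I.nB, 1 ≤ σ.q b ∧ σ.q b ≤ I.nB + 1
  dead : ∀ e < I.mm, e < σ.s (I.own e) → σ.c (I.nb e) < I.R e
  passed : ∀ e < I.mm, I.Current σ e → (1 ≤ σ.l (I.own e) ∨ e < σ.i (I.own e)) →
    σ.c (I.nb e) ≤ I.R e
  price : ∀ e < I.mm, I.Current σ e → I.R e = σ.c (I.nb e) →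
    σ.l (I.own e) ≤ σ.q (I.nb e) ∧ (e < σ.i (I.own e) → σ.l (I.own e) + 1 ≤ σ.q (I.nb e))
  mate : ∀ b < I.nB, ∀ e, σ.N b = e + 1 → e < I.mm ∧ I.nb e = b ∧ I.Current σ e ∧
    I.R e = σ.c b ∧ σ.q b = σ.l (I.own e) + 1 ∧ σ.i (I.own e) = e + 1 ∧ 1 ≤ σ.l (I.own e)
  priced : ∀ b < I.nB, 2 ≤ σ.q b → σ.N b ≠ 0
  st_lt : ∀ k < σ.sp, σ.st k < I.nA
  st_inj : ∀ j < σ.sp, ∀ k < σ.sp, σ.st j = σ.st k → j = k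
  st_free : ∀ k < σ.sp, ∀ b < I.nB, ∀ e, σ.N b = e + 1 → I.own e ≠ σ.st k
  cover : ∀ a < I.nA, (∃ k < σ.sp, σ.st k = a) ∨ (∃ b < I.nB, ∃ e, σ.N b = e + 1 ∧ I.own e = a) ∨
    σ.s a = I.off (a + 1)
  valid_s : ∀ M, I.Stable M → ∀ e ∈ M, σ.s (I.own e) ≤ e
  valid_c : ∀ M, I.Stable M → ∀ b < I.nB, σ.c b ≤ I.nA → ∃ e ∈ M, I.nb e = b ∧ I.R e ≤ σ.c b

variable {I : EdgeList} {σ : State}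

theorem Stable.le_cap {M : Set ℕ} (hM : I.Stable M) (h : I.Inv σ) {e : ℕ} (he : e ∈ M) :
    I.R e ≤ σ.c (I.nb e) := by
  by_cases hc : σ.c (I.nb e) ≤ I.nA
  · obtain ⟨f, hf, h1, h2⟩ := h.valid_c M hM _ (I.nb_lt e (hM.lt e he)) hc
    rwa [hM.nb_inj f hf e he h1] at h2
  · have := hM.present e he; omega

theorem current_iff (h : I.Inv σ) {a e : ℕ} (ha : a < I.nA) (hs : σ.s a < I.off (a + 1)) :
    (e < I.mm ∧ I.own e = a ∧ I.Current σ e) ↔ σ.s a ≤ e ∧ e < I.te (σ.s a) := by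
  obtain ⟨h1, h2⟩ := h.s_rng a ha
  obtain ⟨h3, h4⟩ := I.own_eq a ha _ h1 hs
  obtain ⟨h5, h6⟩ := I.te_gt _ h3
  rw [h4] at h6
  constructor
  · rintro ⟨-, rfl, h⟩; exact h
  · intro h7
    obtain ⟨h8, h9⟩ := I.own_eq a ha e (by omega) (by omega)
    refine ⟨h8, h9, ?_⟩
    rw [Current, h9]; exact h7

/-! ### Preservation of the invariant by the moves -/

theorem inv_pop (h : I.Inv σ) (hsp : 0 < σ.sp)
    (hs : σ.s (σ.st (σ.sp - 1)) = I.off (σ.st (σ.sp - 1) + 1)) :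
    I.Inv { σ with sp := σ.sp - 1 } := by
  obtain ⟨h1, h2, h3, h4, h5, h6, h7, h8, h9, h10, h11, h12, h13, h14, h15, h16⟩ := h
  refine ⟨h1, h2, h3, h4, h5, h6, h7, h8, h9, h10, ?_, ?_, ?_, ?_, h15, h16⟩
  · intro k hk; exact h11 k (by simp only at hk; omega)
  · intro j hj k hk; exact h12 j (by simp only at hj; omega) k (by simp only at hk; omega)
  · intro k hk; exact h13 k (by simp only at hk; omega)
  · intro a ha
    rcases h14 a ha with ⟨k, hk, hka⟩ | h | h
    · by_cases hk' : k = σ.sp - 1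
      · right; right; subst hk'; rw [← hka]; exact hs
      · exact Or.inl ⟨k, by simp only; omega, hka⟩
    · exact Or.inr (Or.inl h)
    · exact Or.inr (Or.inr h)

/-- The cursor passes an edge without further action; `hc` and `hq` are what `passed` and `price`
demand of an inspected edge. -/
theorem inv_move (h : I.Inv σ) (hsp : 0 < σ.sp) {a : ℕ} (ha : a = σ.st (σ.sp - 1))
    (hs : σ.s a < I.off (a + 1)) (hi : σ.i a < I.te (σ.s a))
    (hc : σ.c (I.nb (σ.i a)) ≤ I.R (σ.i a))
    (hq : I.R (σ.i a) = σ.c (I.nb (σ.i a)) → σ.l a + 1 ≤ σ.q (I.nb (σ.i a))) :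
    I.Inv { σ with i := Function.update σ.i a (σ.i a + 1) } := by
  have haA : a < I.nA := ha ▸ h.st_lt _ (by omega)
  have hfree := h.st_free (σ.sp - 1) (by omega)
  rw [← ha] at hfree
  refine ⟨h.s_rng, ?_, ?_, h.c_le, h.q_rng, h.dead, ?_, ?_, ?_, h.priced, h.st_lt, h.st_inj,
    h.st_free, h.cover, h.valid_s, h.valid_c⟩
  all_goals simp only [Current, Function.update_apply]
  · have := h.i_rng
    grind
  · have := h.exhausted
    grind
  · have := h.passed
    simp only [Current] at this
    grind
  · have := h.price
    simp only [Current] at this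
    grind
  · intro b hb e he
    simp only [if_neg (hfree b hb e he)]
    exact h.mate b hb e he

/-- When sweep `l` is over, all live women of the tie cost at least `l + 1`, which is what sweep `l
+ 1` presupposes. -/
theorem inv_sweep (h : I.Inv σ) (hsp : 0 < σ.sp) {a : ℕ} (ha : a = σ.st (σ.sp - 1))
    (hs : σ.s a < I.off (a + 1)) (hi : σ.i a = I.te (σ.s a)) (hl : σ.l a ≤ I.nB) :
    I.Inv { σ with l := Function.update σ.l a (σ.l a + 1)
                   i := Function.update σ.i a (σ.s a) } := by
  have haA : a < I.nA := ha ▸ h.st_lt _ (by omega)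
  have hfree := h.st_free (σ.sp - 1) (by omega)
  rw [← ha] at hfree
  have hte : σ.s a ≤ I.te (σ.s a) := by
    obtain ⟨h1, h2⟩ := h.s_rng a haA
    exact (I.te_gt _ (I.own_eq a haA _ h1 hs).1).1.le
  refine ⟨h.s_rng, ?_, ?_, h.c_le, h.q_rng, h.dead, ?_, ?_, ?_, h.priced, h.st_lt, h.st_inj,
    h.st_free, h.cover, h.valid_s, h.valid_c⟩
  all_goals simp only [Current, Function.update_apply]
  · have := h.i_rng
    grind
  · have := h.exhausted
    grind
  · have := h.passed
    simp only [Current] at this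
    grind
  · have := h.price
    simp only [Current] at this
    grind
  · intro b hb e he
    simp only [if_neg (hfree b hb e he)]
    exact h.mate b hb e he

/-- After sweep `nB + 1` a live woman of the tie would cost at least `nB + 2`, more than any price.
So the whole tie lies above the caps, and by `Stable.le_cap` no strongly stable matching uses it. -/
theorem inv_tie (h : I.Inv σ) (hsp : 0 < σ.sp) {a : ℕ} (ha : a = σ.st (σ.sp - 1))
    (hs : σ.s a < I.off (a + 1)) (hi : σ.i a = I.te (σ.s a)) (hl : σ.l a = I.nB + 1) :
    I.Inv { σ with s := Function.update σ.s a (σ.i a)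
                   l := Function.update σ.l a 0 } := by
  have haA : a < I.nA := ha ▸ h.st_lt _ (by omega)
  have hfree := h.st_free (σ.sp - 1) (by omega)
  rw [← ha] at hfree
  obtain ⟨hs1, hs2⟩ := h.s_rng a haA
  obtain ⟨hs3, hs4⟩ := I.own_eq a haA _ hs1 hs
  obtain ⟨hte, hte2⟩ := I.te_gt _ hs3
  rw [hs4] at hte2
  have hdead : ∀ e < I.mm, I.own e = a → e < σ.i a → σ.c (I.nb e) < I.R e := by
    intro e he hea hei
    by_cases hse : e < σ.s a
    · exact h.dead e he (by rw [hea]; exact hse)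
    · have hcur : I.Current σ e := by rw [Current, hea]; omega
      have h1 := h.passed e he hcur (Or.inr (by rw [hea]; exact hei))
      refine lt_of_le_of_ne h1 fun heq => ?_
      have h2 := (h.price e he hcur heq.symm).2 (by rw [hea]; exact hei)
      have h3 := h.q_rng _ (I.nb_lt e he)
      rw [hea] at h2
      omega
  have hval : ∀ M, I.Stable M → ∀ e ∈ M, I.own e = a → σ.i a ≤ e := by
    intro M hM e he hea
    by_contra hlt
    have h1 := hdead e (hM.lt e he) hea (by omega)
    have h2 := hM.le_cap h he
    omega
  have hnext : I.te (σ.s a) < I.off (a + 1) →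
      I.te (σ.s a) ≤ I.te (I.te (σ.s a)) := by
    intro hlt
    exact (I.te_gt _ (I.own_eq a haA _ (by omega) hlt).1).1.le
  refine ⟨?_, ?_, ?_, h.c_le, h.q_rng, ?_, ?_, ?_, ?_, h.priced, h.st_lt, h.st_inj,
    h.st_free, ?_, ?_, h.valid_c⟩
  all_goals simp only [Current, Function.update_apply]
  · have := h.s_rng
    grind
  · have := h.i_rng
    grind
  · have := h.exhausted
    grind
  · have := h.dead
    grind
  · have := h.passed
    simp only [Current] at this
    grind
  · have := h.price
    simp only [Current] at this
    grind
  · intro b hb e he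
    simp only [if_neg (hfree b hb e he)]
    exact h.mate b hb e he
  · intro a' ha'
    rcases eq_or_ne a' a with rfl | hne
    · exact Or.inl ⟨σ.sp - 1, by omega, ha.symm⟩
    · simpa only [if_neg hne] using h.cover a' ha'
  · intro M hM e he
    split_ifs with hea
    · exact hval M hM e he hea
    · exact h.valid_s M hM e he

/-- The engaging edge is determined by the cursor of its owner. -/
theorem mate_own_inj (h : I.Inv σ) {b b' e e' : ℕ} (hb : b < I.nB) (hb' : b' < I.nB)
    (he : σ.N b = e + 1) (he' : σ.N b' = e' + 1) (ho : I.own e = I.own e') : b = b' := by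
  obtain ⟨-, h1, -, -, -, h2, -⟩ := h.mate b hb e he
  obtain ⟨-, h3, -, -, -, h4, -⟩ := h.mate b' hb' e' he'
  rw [ho] at h2
  have : e = e' := by omega
  rw [← h1, ← h3, this]

/-- The price may fall back to 1: an edge of rank `v` lay below the old cap, so by `passed` it has
not been inspected and its owner is in sweep 0. The only one inspected now is the edge at the
cursor, for which 1 is `l + 1`. The man `a` stays on the stack; the released partner is pushed above
him. -/
theorem inv_drop (h : I.Inv σ) (hsp : 0 < σ.sp) {a b v : ℕ} (ha : a = σ.st (σ.sp - 1))
    (hs : σ.s a < I.off (a + 1)) (hi : σ.i a < I.te (σ.s a)) (hb : b = I.nb (σ.i a))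
    (hv : v < σ.c b) (hR : v ≤ I.R (σ.i a))
    (hval : ∀ M, I.Stable M → v ≤ I.nA → ∃ e ∈ M, I.nb e = b ∧ I.R e ≤ v) :
    I.Inv { σ with
      c := Function.update σ.c b v
      q := Function.update σ.q b 1
      N := Function.update σ.N b 0
      i := Function.update σ.i a (σ.i a + 1)
      st := if σ.N b = 0 then σ.st else Function.update σ.st σ.sp (I.own (σ.N b - 1))
      sp := if σ.N b = 0 then σ.sp else σ.sp + 1 } := by
  have haA : a < I.nA := ha ▸ h.st_lt _ (by omega)
  have hfree := h.st_free (σ.sp - 1) (by omega)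
  rw [← ha] at hfree
  have hcur := (current_iff h (e := σ.i a) haA hs).2 ⟨(h.i_rng a haA hs).1, hi⟩
  have hbB : b < I.nB := hb ▸ I.nb_lt _ hcur.1
  refine ⟨h.s_rng, ?_, ?_, ?_, ?_, ?_, ?_, ?_, ?_, ?_, ?_, ?_, ?_, ?_, h.valid_s, ?_⟩
  · have := h.i_rng
    simp only [Function.update_apply]
    grind
  · have := h.exhausted
    simp only [Function.update_apply]
    grind
  · have := h.c_le
    simp only [Function.update_apply]
    grind
  · have := h.q_rng
    simp only [Function.update_apply]
    grind
  · have := h.dead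
    simp only [Function.update_apply]
    grind
  · intro e he hc hor
    have h1 := h.passed e he hc
    simp only [Function.update_apply] at hor ⊢
    grind
  · intro e he hc hRe
    have h1 := h.passed e he hc
    have h2 := h.price e he hc
    simp only [Function.update_apply] at hRe ⊢
    grind
  · intro b' hb' e he
    simp only [Function.update_apply] at he ⊢
    split_ifs at he with hbb
    have h1 := h.mate b' hb' e he
    simp only [if_neg (hfree b' hb' e he), if_neg hbb]
    exact h1
  · have := h.priced
    simp only [Function.update_apply]
    grind
  · intro k hk
    dsimp only at hk ⊢
    split_ifs at hk ⊢ with h0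
    · exact h.st_lt k hk
    · rw [Function.update_apply]
      split_ifs with hkk
      · exact I.own_lt _ (h.mate b hbB (σ.N b - 1) (by omega)).1
      · exact h.st_lt k (by omega)
  · intro j hj k hk
    dsimp only at hj hk ⊢
    split_ifs at hj hk ⊢ with h0
    · exact h.st_inj j hj k hk
    · have h1 := fun k hk => h.st_free k hk b hbB (σ.N b - 1) (by omega)
      rw [Function.update_apply, Function.update_apply]
      split_ifs with hjj hkk hkk
      · intro _; omega
      · intro h2; exact (h1 k (by omega) h2).elim
      · intro h2; exact (h1 j (by omega) h2.symm).elim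
      · exact h.st_inj j (by omega) k (by omega)
  · intro k hk b' hb' e he
    dsimp only at hk he ⊢
    rw [Function.update_apply] at he
    split_ifs at he with hbb
    split_ifs at hk ⊢ with h0
    · exact h.st_free k hk b' hb' e he
    · rw [Function.update_apply]
      split_ifs with hkk
      · intro ho
        exact hbb (mate_own_inj h hb' hbB he (e' := σ.N b - 1) (by omega) ho)
      · exact h.st_free k (by omega) b' hb' e he
  · intro a' ha'
    rcases h.cover a' ha' with ⟨k, hk, hka⟩ | ⟨b', hb', e, he, hea⟩ | hex
    · refine Or.inl ⟨k, ?_, ?_⟩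
      · dsimp only; split_ifs <;> omega
      · dsimp only; split_ifs
        · exact hka
        · rw [Function.update_of_ne (by omega)]; exact hka
    · by_cases hbb : b' = b
      · subst hbb
        refine Or.inl ⟨σ.sp, ?_, ?_⟩
        · dsimp only; rw [if_neg (by omega)]; omega
        · dsimp only; rw [if_neg (by omega), Function.update_self, he]; exact hea
      · refine Or.inr (Or.inl ⟨b', hb', e, ?_, hea⟩)
        dsimp only; rw [Function.update_of_ne hbb]; exact he
    · exact Or.inr (Or.inr hex)
  · intro M hM b' hb'
    simp only [Function.update_apply]
    split_ifs with hbb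
    · subst hbb; exact hval M hM
    · exact h.valid_c M hM b' hb'

/-- Raising a price cannot violate the lower bounds in `price`. On the stack the displaced partner
takes the place of `a`. -/
theorem inv_bid (h : I.Inv σ) (hsp : 0 < σ.sp) {a b : ℕ} (ha : a = σ.st (σ.sp - 1))
    (hs : σ.s a < I.off (a + 1)) (hi : σ.i a < I.te (σ.s a)) (hb : b = I.nb (σ.i a))
    (hR : I.R (σ.i a) = σ.c b) (hq : σ.q b = σ.l a) (hl : 1 ≤ σ.l a) (hl2 : σ.l a ≤ I.nB) :
    I.Inv { σ with
      q := Function.update σ.q b (σ.l a + 1)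
      N := Function.update σ.N b (σ.i a + 1)
      i := Function.update σ.i a (σ.i a + 1)
      st := if σ.N b = 0 then σ.st else Function.update σ.st (σ.sp - 1) (I.own (σ.N b - 1))
      sp := if σ.N b = 0 then σ.sp - 1 else σ.sp } := by
  have haA : a < I.nA := ha ▸ h.st_lt _ (by omega)
  have hfree := h.st_free (σ.sp - 1) (by omega)
  rw [← ha] at hfree
  have hcur := (current_iff h (e := σ.i a) haA hs).2 ⟨(h.i_rng a haA hs).1, hi⟩
  have hbB : b < I.nB := hb ▸ I.nb_lt _ hcur.1
  have hinj : ∀ k < σ.sp, σ.st k = a → k = σ.sp - 1 := fun k hk hka =>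
    h.st_inj k hk _ (by omega) (hka.trans ha)
  refine ⟨h.s_rng, ?_, ?_, h.c_le, ?_, h.dead, ?_, ?_, ?_, ?_, ?_, ?_, ?_, ?_, h.valid_s,
    h.valid_c⟩
  · have := h.i_rng
    simp only [Function.update_apply]
    grind
  · have := h.exhausted
    simp only [Function.update_apply]
    grind
  · have := h.q_rng
    simp only [Function.update_apply]
    grind
  · intro e he hc hor
    have h1 := h.passed e he hc
    simp only [Function.update_apply] at hor ⊢
    grind
  · intro e he hc hRe
    have h2 := h.price e he hc hRe
    simp only [Function.update_apply]
    grind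
  · intro b' hb' e he
    simp only [Function.update_apply] at he ⊢
    split_ifs at he with hbb
    · have hee : e = σ.i a := by omega
      subst hee
      rw [hcur.2.1, if_pos rfl, if_pos hbb, hbb]
      exact ⟨hcur.1, hb.symm, hcur.2.2, hR, rfl, rfl, hl⟩
    · simp only [if_neg (hfree b' hb' e he), if_neg hbb]
      exact h.mate b' hb' e he
  · have := h.priced
    simp only [Function.update_apply]
    grind
  · intro k hk
    dsimp only at hk ⊢
    split_ifs at hk ⊢ with h0
    · exact h.st_lt k (by omega)
    · rw [Function.update_apply]
      split_ifs with hkk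
      · exact I.own_lt _ (h.mate b hbB (σ.N b - 1) (by omega)).1
      · exact h.st_lt k (by omega)
  · intro j hj k hk
    dsimp only at hj hk ⊢
    split_ifs at hj hk ⊢ with h0
    · exact h.st_inj j (by omega) k (by omega)
    · have h1 := fun k hk => h.st_free k hk b hbB (σ.N b - 1) (by omega)
      rw [Function.update_apply, Function.update_apply]
      split_ifs with hjj hkk hkk
      · intro _; omega
      · intro h2; exact (h1 k (by omega) h2).elim
      · intro h2; exact (h1 j (by omega) h2.symm).elim
      · exact h.st_inj j (by omega) k (by omega)
  · intro k hk b' hb' e he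
    dsimp only at hk he ⊢
    rw [Function.update_apply] at he
    split_ifs at he with hbb
    · have hee : e = σ.i a := by omega
      rw [hee, hcur.2.1]
      split_ifs at hk ⊢ with h0
      · intro h3
        have := hinj k (by omega) h3.symm
        omega
      · rw [Function.update_apply]
        split_ifs with hkk
        · exact (hfree b hbB _ (by omega)).symm
        · intro h3
          exact hkk (hinj k (by omega) h3.symm)
    · split_ifs at hk ⊢ with h0
      · exact h.st_free k (by omega) b' hb' e he
      · rw [Function.update_apply]
        split_ifs with hkk
        · intro ho
          exact hbb (mate_own_inj h hb' hbB he (e' := σ.N b - 1) (by omega) ho)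
        · exact h.st_free k (by omega) b' hb' e he
  · intro a' ha'
    by_cases haa : a' = a
    · refine Or.inr (Or.inl ⟨b, hbB, σ.i a, ?_, ?_⟩)
      · dsimp only; rw [Function.update_self]
      · rw [haa]; exact hcur.2.1
    rcases h.cover a' ha' with ⟨k, hk, hka⟩ | ⟨b', hb', e, he, hea⟩ | hex
    · have hk1 : k ≠ σ.sp - 1 := by
        rintro rfl; exact haa (hka.symm.trans ha.symm)
      refine Or.inl ⟨k, ?_, ?_⟩
      · dsimp only; split_ifs <;> omega
      · dsimp only; split_ifs
        · exact hka
        · rw [Function.update_of_ne (by omega)]; exact hka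
    · by_cases hbb : b' = b
      · subst hbb
        refine Or.inl ⟨σ.sp - 1, ?_, ?_⟩
        · dsimp only; rw [if_neg (by omega)]; omega
        · dsimp only; rw [if_neg (by omega), Function.update_self, he]; exact hea
      · refine Or.inr (Or.inl ⟨b', hb', e, ?_, hea⟩)
        dsimp only; rw [Function.update_of_ne hbb]; exact he
    · exact Or.inr (Or.inr hex)

/-! ### What the moves reveal about all strongly stable matchings -/

/-- A man proposes to a woman who prefers him to what she expects. -/
theorem valid_propose (h : I.Inv σ) {e : ℕ} (he : e < I.mm) (hc : I.Current σ e) {M : Set ℕ}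
    (hM : I.Stable M) (hR : I.R e ≤ I.nA) : ∃ f ∈ M, I.nb f = I.nb e ∧ I.R f ≤ I.R e := by
  by_cases heM : e ∈ M
  · exact ⟨e, heM, rfl, le_rfl⟩
  -- Otherwise the woman strictly prefers the proposer to what she has in `M`, while he, by
  -- `valid_s`, has nothing better there than his present tie: the edge blocks `M`.
  by_contra! hno
  obtain ⟨f, hf, hfo, hft⟩ := hM.woman e he hR heM hno
  have h1 := h.valid_s M hM f hf
  rw [hfo] at h1
  have h2 := I.own_seg e he
  have h3 := h.s_rng _ (I.own_lt e he)
  have h4 := I.own_eq _ (I.own_lt e he) _ h3.1 (by have := hc.1; omega)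
  have h5 := I.tn_mono _ f h1 (hM.lt f hf) (h4.2.trans hfo.symm)
  have h6 := (I.te_spec _ h4.1 e hc.1 (by rw [h4.2]; exact h2.2)).2 hc.2
  omega

/-- The partner in a strongly stable matching of an endpoint of a live edge. -/
theorem exists_current_mate (h : I.Inv σ) {e : ℕ} (he : e < I.mm) (hc : I.Current σ e) {M : Set ℕ}
    (hM : I.Stable M) (hR : I.R e ≤ I.nA) (hRe : ∀ f ∈ M, I.nb f = I.nb e → I.R e ≤ I.R f) :
    ∃ f ∈ M, I.own f = I.own e ∧ I.Current σ f := by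
  by_cases heM : e ∈ M
  · exact ⟨e, heM, rfl, hc⟩
  -- By `valid_s` the owner has nothing better in `M` than his present tie. Without a partner in
  -- that tie he would strictly prefer `e`, and since by `hRe` the woman does not lose, `e` would
  -- block `M`.
  by_contra! hno
  have h2 := I.own_seg e he
  have h3 := h.s_rng _ (I.own_lt e he)
  have h4 := I.own_eq _ (I.own_lt e he) _ h3.1 (by have := hc.1; omega)
  have h6 := (I.te_spec _ h4.1 e hc.1 (by rw [h4.2]; exact h2.2)).2 hc.2
  obtain ⟨g, hg, hgb, hlt⟩ := hM.man e he hR heM (by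
    intro f hf hfo
    have h1 := h.valid_s M hM f hf
    rw [hfo] at h1
    have h7 := I.own_seg f (hM.lt f hf)
    rw [hfo] at h7
    have h5 := I.tn_mono _ f h1 (hM.lt f hf) (h4.2.trans hfo.symm)
    have h8 := hno f hf hfo
    rw [Current, hfo] at h8
    have h9 : ¬ f < I.te (σ.s (I.own e)) := fun h => h8 ⟨h1, h⟩
    rw [← I.te_spec _ h4.1 f h1 (by rw [h4.2]; exact h7.2)] at h9
    omega)
  have := hRe g hg hgb
  omega

end EdgeList
end StrongStable

namespace StrongStable
namespace EdgeList

variable {I : EdgeList} {σ : State}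

/-- A live edge of a strongly stable matching leads, via the engagement of its woman, to another
one. -/
theorem exists_next (h : I.Inv σ) {M : Set ℕ} (hM : I.Stable M) {x : ℕ} (hx : x ∈ M)
    (hRx : I.R x = σ.c (I.nb x)) (hq : 2 ≤ σ.q (I.nb x)) :
    ∃ y ∈ M, I.R y = σ.c (I.nb y) ∧ σ.q (I.nb x) ≤ σ.q (I.nb y) + 1 ∧
      ∃ e, σ.N (I.nb x) = e + 1 ∧ I.own e = I.own y := by
  have hxb := I.nb_lt x (hM.lt x hx)
  -- A price of at least 2 means that the woman is engaged, by an edge `e` of the same rank as `x`.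
  -- So `M` matches the owner of `e` inside his present tie, and his level, one less than her price,
  -- bounds the price of his partner in `M` from below.
  obtain ⟨e, he⟩ := Nat.exists_eq_succ_of_ne_zero (h.priced _ hxb hq)
  obtain ⟨h1, h2, h3, h4, h5, h6, h7⟩ := h.mate _ hxb e he
  obtain ⟨y, hy, hyo, hyc⟩ := exists_current_mate h h1 h3 hM
    (by rw [h4, ← hRx]; exact hM.present x hx) (by
      intro f hf hfb
      rw [hM.nb_inj f hf x hx (hfb.trans h2), h4, hRx])
  have hRy : I.R y = σ.c (I.nb y) :=
    le_antisymm (hM.le_cap h hy)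
      (h.passed y (hM.lt y hy) hyc (Or.inl (by rw [hyo]; exact h7)))
  have hp := (h.price y (hM.lt y hy) hyc hRy).1
  rw [hyo] at hp
  exact ⟨y, hy, hRy, by omega, e, he, hyo.symm⟩

/-- Suppose `M` gives the woman a partner of rank equal to her cap. Then `M` matches the free man of
level `nB + 1` inside his tie, to a live woman of price at least `nB + 1`. Iterating `exists_next`
lowers prices by at most one per step, so the walk can be continued for `nB` steps. It visits `nB +
1` different women, which is too many. -/
theorem valid_strip (h : I.Inv σ) {e : ℕ} (he : e < I.mm) (hc : I.Current σ e)
    (hR : I.R e = σ.c (I.nb e)) (hl : σ.l (I.own e) = I.nB + 1)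
    (hfree : ∀ b < I.nB, ∀ f, σ.N b = f + 1 → I.own f ≠ I.own e) {M : Set ℕ}
    (hM : I.Stable M) : ∃ f ∈ M, I.nb f = I.nb e ∧ I.R f ≤ σ.c (I.nb e) - 1 := by
  have hcA : σ.c (I.nb e) ≤ I.nA := by
    have h1 := h.c_le _ (I.nb_lt e he)
    have h2 := I.R_spec e he
    omega
  obtain ⟨f, hf, hfb, hfR⟩ := h.valid_c M hM _ (I.nb_lt e he) hcA
  by_cases hlt : I.R f < σ.c (I.nb e)
  · exact ⟨f, hf, hfb, by omega⟩
  exfalso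
  obtain ⟨x, hx, hxo, hxc⟩ := exists_current_mate h he hc hM (by omega) (by
    intro g hg hgb
    rw [hM.nb_inj g hg f hf (hgb.trans hfb.symm)]
    omega)
  have hRx : I.R x = σ.c (I.nb x) :=
    le_antisymm (hM.le_cap h hx)
      (h.passed x (hM.lt x hx) hxc (Or.inl (by rw [hxo]; omega)))
  have hqx := (h.price x (hM.lt x hx) hxc hRx).1
  rw [hxo, hl] at hqx
  choose! nx hnx using fun x (hx : x ∈ M ∧ I.R x = σ.c (I.nb x) ∧ 2 ≤ σ.q (I.nb x)) =>
    exists_next h hM hx.1 hx.2.1 hx.2.2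
  let y : ℕ → ℕ := fun k => nx^[k] x
  have hy0 : y 0 = x := rfl
  have hys : ∀ k, y (k + 1) = nx (y k) := fun k => Function.iterate_succ_apply' nx k x
  have hy : ∀ k ≤ I.nB, y k ∈ M ∧ I.R (y k) = σ.c (I.nb (y k)) ∧
      I.nB + 1 ≤ σ.q (I.nb (y k)) + k := by
    intro k
    induction k with
    | zero => intro _; exact ⟨hx, hRx, hqx⟩
    | succ k ih =>
      intro hk
      obtain ⟨h1, h2, h3⟩ := ih (by omega)
      obtain ⟨h4, h5, h6, -⟩ := hnx (y k) ⟨h1, h2, by omega⟩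
      rw [hys]
      exact ⟨h4, h5, by omega⟩
  have hmate : ∀ k < I.nB, ∃ e, σ.N (I.nb (y k)) = e + 1 ∧ I.own e = I.own (y (k + 1)) := by
    intro k hk
    obtain ⟨h1, h2, h3⟩ := hy k hk.le
    obtain ⟨-, -, -, h⟩ := hnx (y k) ⟨h1, h2, by omega⟩
    rw [hys]; exact h
  -- A repeated woman has one partner in `M`, who is engaged to her predecessor in both places, so
  -- the predecessors agree too. Going back to the start, the man of `e` would be engaged, but he is
  -- free.
  have hne : ∀ j k, j < k → k ≤ I.nB → I.nb (y j) ≠ I.nb (y k) := by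
    intro j
    induction j with
    | zero =>
      intro k hk hkB heq
      obtain ⟨k, rfl⟩ := Nat.exists_eq_succ_of_ne_zero hk.ne'
      have h1 := hM.nb_inj _ hx _ (hy _ hkB).1 heq
      obtain ⟨g, hg, hgo⟩ := hmate k (by omega)
      refine hfree _ (I.nb_lt _ (hM.lt _ (hy k (by omega)).1)) g hg ?_
      rw [hgo, ← h1, hxo]
    | succ j ih =>
      intro k hk hkB heq
      obtain ⟨k, rfl⟩ := Nat.exists_eq_succ_of_ne_zero (by omega : k ≠ 0)
      have h1 := hM.nb_inj _ (hy (j + 1) (by omega)).1 _ (hy _ hkB).1 heq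
      obtain ⟨g, hg, hgo⟩ := hmate k (by omega)
      obtain ⟨g', hg', hgo'⟩ := hmate j (by omega)
      refine ih k (by omega) (by omega) ?_
      refine mate_own_inj h (I.nb_lt _ (hM.lt _ (hy j (by omega)).1))
        (I.nb_lt _ (hM.lt _ (hy k (by omega)).1)) hg' hg ?_
      rw [hgo', hgo, h1]
  obtain ⟨j, hj, k, hk, hjk, heq⟩ := Finset.exists_ne_map_eq_of_card_lt_of_maps_to
    (s := Finset.range (I.nB + 1)) (t := Finset.range I.nB) (f := fun k => I.nb (y k)) (by simp)
    (by
      intro k hk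
      simp only [Finset.coe_range, Set.mem_Iio] at hk ⊢
      exact I.nb_lt _ (hM.lt _ (hy k (by omega)).1))
  simp only [Finset.mem_range] at hj hk
  rcases lt_or_gt_of_ne hjk with h1 | h1
  · exact hne j k h1 (by omega) heq
  · exact hne k j h1 (by omega) heq.symm

/-! ### The engagements when no free man is left -/

/-- The edges by which the women are engaged. -/
def engaged (I : EdgeList) (σ : State) : Set ℕ := {e | ∃ b < I.nB, σ.N b = e + 1}

theorem exists_engaged_man (h : I.Inv σ) (hsp : σ.sp = 0) {e : ℕ} (he : e < I.mm)
    (hs : σ.s (I.own e) ≤ e) : ∃ g ∈ I.engaged σ, I.own g = I.own e ∧ I.tn g ≤ I.tn e := by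
  have h1 := I.own_seg e he
  rcases h.cover _ (I.own_lt e he) with ⟨k, hk, -⟩ | ⟨b, hb, g, hg, hgo⟩ | hex
  · omega
  · refine ⟨g, ⟨b, hb, hg⟩, hgo, ?_⟩
    obtain ⟨h2, -, h3, -⟩ := h.mate b hb g hg
    have h4 := (h.s_rng _ (I.own_lt e he)).1
    have h5 := I.own_eq _ (I.own_lt e he) _ h4 (by omega)
    rw [Current, hgo] at h3
    have h6 := I.own_seg g h2
    rw [hgo] at h6
    rw [(I.te_spec _ h5.1 g h3.1 (by rw [h5.2]; exact h6.2)).2 h3.2]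
    exact I.tn_mono _ _ hs he h5.2
  · omega

theorem engaged_spec (h : I.Inv σ) {e : ℕ} (he : e ∈ I.engaged σ) :
    e < I.mm ∧ σ.N (I.nb e) = e + 1 ∧ I.Current σ e ∧ I.R e = σ.c (I.nb e) ∧ I.R e ≤ I.nA ∧
      1 ≤ σ.l (I.own e) := by
  obtain ⟨b, hb, hN⟩ := he
  obtain ⟨h1, rfl, h3, h4, -, -, h7⟩ := h.mate b hb e hN
  have h5 := h.c_le _ hb
  have h6 := I.R_spec e h1
  exact ⟨h1, hN, h3, h4, by omega, h7⟩

/-- Send a woman with a lowered cap to the woman engaged to her partner in `M`. That partner has not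
exhausted his list by `valid_s`, so he is engaged; and a woman who is engaged has a cap of at most
`nA`, since no edge has rank `nA + 1`. This is an injection of a finite set into itself, hence onto.
-/
theorem exists_engaged_woman (h : I.Inv σ) (hsp : σ.sp = 0) {M : Set ℕ} (hM : I.Stable M) {b : ℕ}
    (hb : b < I.nB) (hc : σ.c b ≤ I.nA) : ∃ g ∈ I.engaged σ, I.nb g = b := by
  let T := {b // b < I.nB ∧ σ.c b ≤ I.nA}
  have : Finite T := Finite.of_injective (β := Fin I.nB) (fun t => ⟨t.1, t.2.1⟩)
    fun x y hxy => Subtype.ext (by simpa using hxy)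
  have key : ∀ t : T, ∃ u : T, ∃ e ∈ M, I.nb e = t.1 ∧ ∃ g ∈ I.engaged σ, I.nb g = u.1 ∧
      I.own g = I.own e := by
    rintro ⟨t, ht, hct⟩
    obtain ⟨e, he, heb, -⟩ := h.valid_c M hM t ht hct
    obtain ⟨g, hg, hgo, -⟩ := exists_engaged_man h hsp (hM.lt e he) (h.valid_s M hM e he)
    obtain ⟨h1, h2, h3, h4, h5, -⟩ := engaged_spec h hg
    exact ⟨⟨I.nb g, I.nb_lt g h1, by omega⟩, e, he, heb, g, hg, rfl, hgo⟩
  choose f hf using key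
  have hinj : Function.Injective f := by
    intro t u htu
    obtain ⟨e, he, heb, g, hg, hgb, hgo⟩ := hf t
    obtain ⟨e', he', heb', g', hg', hgb', hgo'⟩ := hf u
    have h1 : g = g' := by
      have h2 := (engaged_spec h hg).2.1
      have h3 := (engaged_spec h hg').2.1
      rw [hgb, htu, ← hgb'] at h2
      omega
    rw [h1, hgo'] at hgo
    apply Subtype.ext
    rw [← heb, ← heb', hM.own_inj e' he' e he hgo]
  obtain ⟨t, ht⟩ := Finite.surjective_of_injective hinj ⟨b, hb, hc⟩
  obtain ⟨-, -, -, g, hg, hgb, -⟩ := hf t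
  exact ⟨g, hg, by rw [hgb, ht]⟩

/-- Existence of some strongly stable matching enters only through `exists_engaged_woman`: a woman
who has rejected somebody holds a partner whose rank is exactly her cap. An edge that its man
strictly prefers has been given up, so it lies above the cap. For an edge that its woman strictly
prefers, the man is engaged in an earlier tie, or else the edge has been inspected and is not below
the cap. -/
theorem engaged_stable (h : I.Inv σ) (hsp : σ.sp = 0) (hex : ∃ M, I.Stable M) :
    I.Stable (I.engaged σ) := by
  obtain ⟨M, hM⟩ := hex
  have hman : ∀ e < I.mm, (∀ f ∈ I.engaged σ, I.own f = I.own e → I.tn e < I.tn f) →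
      e < σ.s (I.own e) := by
    intro e he hf
    by_contra hs
    obtain ⟨g, hg, hgo, hgt⟩ := exists_engaged_man h hsp he (by omega)
    have := hf g hg hgo
    omega
  have hwoman : ∀ e < I.mm, I.R e ≤ I.nA → σ.c (I.nb e) ≤ I.R e →
      ∃ g ∈ I.engaged σ, I.nb g = I.nb e ∧ I.R g = σ.c (I.nb e) := by
    intro e he hR hc
    obtain ⟨g, hg, hgb⟩ := exists_engaged_woman h hsp hM (I.nb_lt e he) (hc.trans hR)
    exact ⟨g, hg, hgb, by rw [← hgb]; exact (engaged_spec h hg).2.2.2.1⟩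
  refine ⟨fun e he => (engaged_spec h he).1, fun e he => (engaged_spec h he).2.2.2.2.1, ?_, ?_, ?_,
    ?_⟩
  · rintro e ⟨b, hb, he⟩ f ⟨b', hb', hf⟩ ho
    have := mate_own_inj h hb hb' he hf ho
    subst this
    omega
  · intro e he f hf hef
    have h1 := (engaged_spec h he).2.1
    have h2 := (engaged_spec h hf).2.1
    rw [hef] at h1
    omega
  · intro e he hR heN hf
    have h1 := h.dead e he (hman e he hf)
    obtain ⟨g, hg, hgb, hgR⟩ := hwoman e he hR h1.le
    exact ⟨g, hg, hgb, by omega⟩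
  · intro e he hR heN hf
    have hs : σ.s (I.own e) ≤ e := by
      by_contra hs
      have h1 := h.dead e he (by omega)
      obtain ⟨g, hg, hgb, hgR⟩ := hwoman e he hR h1.le
      have := hf g hg hgb
      omega
    obtain ⟨g, hg, hgo, hgt⟩ := exists_engaged_man h hsp he hs
    refine ⟨g, hg, hgo, lt_of_le_of_ne hgt fun heq => ?_⟩
    obtain ⟨h1, h2, h3, h4, h5, h6⟩ := engaged_spec h hg
    rw [hgo] at h6
    have h7 := I.own_seg e he
    have h8 := (h.s_rng _ (I.own_lt e he)).1
    have h9 := I.own_eq _ (I.own_lt e he) _ h8 (by omega)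
    rw [Current, hgo] at h3
    have h10 := I.own_seg g h1
    rw [hgo] at h10
    have h11 := (I.te_spec _ h9.1 g h3.1 (by rw [h9.2]; exact h10.2)).2 h3.2
    have hcur : I.Current σ e :=
      ⟨hs, (I.te_spec _ h9.1 e hs (by rw [h9.2]; exact h7.2)).1 (by omega)⟩
    -- An engaged man has left sweep 0, so his whole tie counts as inspected.
    have h12 := h.passed e he hcur (Or.inl h6)
    obtain ⟨g', hg', hgb', hgR'⟩ := hwoman e he hR h12
    have := hf g' hg' hgb'
    omega

/-- The source of man-optimality: by `valid_s` no man has moved beyond the tie of an edge of `M`. -/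
theorem engaged_dominates (h : I.Inv σ) (hsp : σ.sp = 0) {M : Set ℕ} (hM : I.Stable M) {e : ℕ}
    (he : e ∈ M) : ∃ g ∈ I.engaged σ, I.own g = I.own e ∧ I.tn g ≤ I.tn e :=
  exists_engaged_man h hsp (hM.lt e he) (h.valid_s M hM e he)

/-! ### Termination of the auction -/

/-- An upper bound for the number of cursor movements that the man `a` still can make. -/
def work (I : EdgeList) (σ : State) (a : ℕ) : ℕ :=
  -- A tie of length `d` takes at most `nB + 2` sweeps of `d` inspections and one turn each, and `d
  -- + 1 ≤ 2 * d`; whence `2 * (nB + 2)` per position.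
  2 * (I.nB + 2) * (I.off (a + 1) - σ.s a) -
    (σ.l a * (I.te (σ.s a) - σ.s a + 1) + (σ.i a - σ.s a))

/-- The factor 2 pays for the one man whom a cursor movement can push on the stack; a pop lowers
only the second summand. -/
def measure (I : EdgeList) (σ : State) : ℕ :=
  2 * ∑ a ∈ Finset.range I.nA, I.work σ a + σ.sp

theorem measure_lt {σ' : State} {a : ℕ} (ha : a < I.nA) (hs : ∀ x ≠ a, σ'.s x = σ.s x)
    (hl : ∀ x ≠ a, σ'.l x = σ.l x) (hi : ∀ x ≠ a, σ'.i x = σ.i x) (hw : I.work σ' a < I.work σ a)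
    (hsp : σ'.sp ≤ σ.sp + 1) : I.measure σ' < I.measure σ := by
  have : ∑ x ∈ Finset.range I.nA, I.work σ' x < ∑ x ∈ Finset.range I.nA, I.work σ x := by
    refine Finset.sum_lt_sum (fun x hx => ?_) ⟨a, Finset.mem_range.2 ha, hw⟩
    rcases eq_or_ne x a with rfl | hne
    · exact hw.le
    · rw [work, work, hs x hne, hl x hne, hi x hne]
  rw [measure, measure]
  omega

/-- The part of the budget that the present tie of `a` cannot exhaust. -/
theorem tie_budget (h : I.Inv σ) {a : ℕ} (ha : a < I.nA) (hs : σ.s a < I.off (a + 1)) :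
    ∃ d D, I.te (σ.s a) = σ.s a + d ∧ 2 * (I.nB + 2) * (I.off (a + 1) - σ.s a) =
      2 * ((I.nB + 2) * d) + D ∧ D = 2 * (I.nB + 2) * (I.off (a + 1) - I.te (σ.s a)) ∧
      (I.nB + 2) * (d + 1) ≤ 2 * ((I.nB + 2) * d) := by
  obtain ⟨h1, h2⟩ := h.s_rng a ha
  obtain ⟨h3, h4⟩ := I.own_eq a ha _ h1 hs
  obtain ⟨h5, h6⟩ := I.te_gt _ h3
  rw [h4] at h6
  refine ⟨I.te (σ.s a) - σ.s a, _, by omega, ?_, rfl, ?_⟩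
  · rw [← mul_assoc, ← mul_add]
    congr 1
    omega
  · have : I.te (σ.s a) - σ.s a + 1 ≤ 2 * (I.te (σ.s a) - σ.s a) := by omega
    calc _ ≤ (I.nB + 2) * (2 * (I.te (σ.s a) - σ.s a)) := Nat.mul_le_mul_left _ this
      _ = _ := by ring

theorem work_move (h : I.Inv σ) {σ' : State} {a : ℕ} (ha : a < I.nA)
    (hs : σ.s a < I.off (a + 1)) (hi : σ.i a < I.te (σ.s a)) (hs' : σ'.s a = σ.s a)
    (hl' : σ'.l a = σ.l a) (hi' : σ'.i a = σ.i a + 1) : I.work σ' a < I.work σ a := by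
  obtain ⟨d, D, h1, h2, -, h3⟩ := tie_budget h ha hs
  obtain ⟨h4, h5, h6⟩ := h.i_rng a ha hs
  rw [work, work, hs', hl', hi', h2, h1, Nat.add_sub_cancel_left]
  have h7 : σ.l a * (d + 1) ≤ (I.nB + 1) * (d + 1) := Nat.mul_le_mul_right _ h6
  have h8 : (I.nB + 2) * (d + 1) = (I.nB + 1) * (d + 1) + (d + 1) := by ring
  omega

theorem work_sweep (h : I.Inv σ) {σ' : State} {a : ℕ} (ha : a < I.nA)
    (hs : σ.s a < I.off (a + 1)) (hi : σ.i a = I.te (σ.s a)) (hl : σ.l a ≤ I.nB)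
    (hs' : σ'.s a = σ.s a) (hl' : σ'.l a = σ.l a + 1) (hi' : σ'.i a = σ.s a) :
    I.work σ' a < I.work σ a := by
  obtain ⟨d, D, h1, h2, -, h3⟩ := tie_budget h ha hs
  rw [work, work, hs', hl', hi', h2, hi, h1, Nat.add_sub_cancel_left]
  have h7 : σ.l a * (d + 1) ≤ I.nB * (d + 1) := Nat.mul_le_mul_right _ hl
  have h8 : (I.nB + 2) * (d + 1) = I.nB * (d + 1) + 2 * (d + 1) := by ring
  have h9 : (σ.l a + 1) * (d + 1) = σ.l a * (d + 1) + (d + 1) := by ring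
  omega

theorem work_tie (h : I.Inv σ) {σ' : State} {a : ℕ} (ha : a < I.nA)
    (hs : σ.s a < I.off (a + 1)) (hi : σ.i a = I.te (σ.s a)) (hl : σ.l a = I.nB + 1)
    (hs' : σ'.s a = σ.i a) (hl' : σ'.l a = 0) :
    I.work σ' a < I.work σ a := by
  obtain ⟨d, D, h1, h2, h4, h3⟩ := tie_budget h ha hs
  rw [work, work, hs', hl', h2, hl, hi, ← h4, h1, Nat.add_sub_cancel_left]
  have h8 : (I.nB + 2) * (d + 1) = (I.nB + 1) * (d + 1) + (d + 1) := by ring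
  omega

end EdgeList
end StrongStable

namespace StrongStable

/-! ### Program logic -/

/-- All registers hold at most `V`. -/
def Store.Bdd (V : ℕ) (s : Store) : Prop := (∀ x, s.var x ≤ V) ∧ ∀ r i, s.arr r i ≤ V

def Store.setVar (s : Store) (x v : ℕ) : Store := { s with var := Function.update s.var x v }

def Store.setArr (s : Store) (r i v : ℕ) : Store :=
  { s with arr := Function.update s.arr r (Function.update (s.arr r) i v) }

theorem Store.Bdd.setVar {V : ℕ} {s : Store} (h : s.Bdd V) {x v : ℕ} (hv : v ≤ V) :
    (s.setVar x v).Bdd V := by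
  refine ⟨fun y => ?_, h.2⟩
  simp only [Store.setVar, Function.update_apply]
  split_ifs
  · exact hv
  · exact h.1 y

theorem Store.Bdd.setArr {V : ℕ} {s : Store} (h : s.Bdd V) {r i v : ℕ} (hv : v ≤ V) :
    (s.setArr r i v).Bdd V := by
  refine ⟨h.1, fun r' j => ?_⟩
  simp only [Store.setArr, Function.update_apply]
  split_ifs with h1
  · rw [Function.update_apply]
    split_ifs
    · exact hv
    · exact h.2 _ _
  · exact h.2 _ _

@[simp] theorem Store.var_setVar (s : Store) (x v y : ℕ) :
    (s.setVar x v).var y = if y = x then v else s.var y := by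
  simp [Store.setVar, Function.update_apply]

@[simp] theorem Store.arr_setVar (s : Store) (x v : ℕ) : (s.setVar x v).arr = s.arr := rfl

@[simp] theorem Store.var_setArr (s : Store) (r i v : ℕ) : (s.setArr r i v).var = s.var := rfl

@[simp] theorem Store.arr_setArr (s : Store) (r i v r' : ℕ) :
    (s.setArr r i v).arr r' = if r' = r then Function.update (s.arr r) i v else s.arr r' := by
  simp only [Store.setArr, Function.update_apply]

/-- Evaluating `e` in a store bounded by `V ≥ 1` produces no number above `e.weight * V`. -/
def Expr.weight : Expr → ℕ
  | const c => c
  | var _ => 1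
  | load _ i => i.weight + 1
  | add e f => e.weight + f.weight
  | sub e f => e.weight + f.weight

theorem Expr.eval_le {V : ℕ} (hV : 1 ≤ V) {s : Store} (h : s.Bdd V) (e : Expr) :
    e.eval s ≤ e.weight * V := by
  induction e with
  | const c => simpa [Expr.eval, Expr.weight] using Nat.le_mul_of_pos_right c hV
  | var x => simpa [Expr.eval, Expr.weight] using h.1 x
  | load r i ih =>
    simp only [Expr.eval, Expr.weight, add_mul, one_mul]
    exact (h.2 _ _).trans (Nat.le_add_left _ _)
  | add e f he hf => simp only [Expr.eval, Expr.weight, add_mul]; omega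
  | sub e f he hf => simp only [Expr.eval, Expr.weight, add_mul]; omega

theorem Expr.peak_le {V : ℕ} (hV : 1 ≤ V) {s : Store} (h : s.Bdd V) (e : Expr) :
    e.peak s ≤ e.weight * V := by
  induction e with
  | const c => simpa [Expr.peak, Expr.weight] using Nat.le_mul_of_pos_right c hV
  | var x => simpa [Expr.peak, Expr.weight] using h.1 x
  | load r i ih =>
    simp only [Expr.peak, Expr.weight, add_mul, one_mul]
    exact max_le (by omega) ((h.2 _ _).trans (Nat.le_add_left _ _))
  | add e f he hf =>
    have h1 := e.eval_le hV h
    have h2 := f.eval_le hV h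
    simp only [Expr.peak, Expr.weight, add_mul]
    omega
  | sub e f he hf => simp only [Expr.peak, Expr.weight, add_mul]; omega

/-- All expressions of the program have weight at most `k`. -/
def Prog.Light (k : ℕ) : Prog → Bool
  | skip => true
  | assign _ e => e.weight ≤ k
  | store _ i e => i.weight ≤ k && e.weight ≤ k
  | seq p q => p.Light k && q.Light k
  | cond e p q => e.weight ≤ k && p.Light k && q.Light k
  | loop e p => e.weight ≤ k && p.Light k

/-- The cost of a program, every loop counted for one test and no iteration. -/
def Prog.flatCost : Prog → ℕ
  | skip => 1
  | assign _ e => e.cost + 1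
  | store _ i e => i.cost + e.cost + 1
  | seq p q => p.flatCost + q.flatCost
  | cond e p q => e.cost + 1 + max p.flatCost q.flatCost
  | loop e _ => e.cost + 1

/-- The weakest precondition of a program without loops, all stored numbers being at most `V`. -/
def Prog.wp (V : ℕ) : Prog → (Store → Prop) → Store → Prop
  | skip, Q, s => Q s
  | assign x e, Q, s => e.eval s ≤ V ∧ Q (s.setVar x (e.eval s))
  | store r i e, Q, s => e.eval s ≤ V ∧ Q (s.setArr r (i.eval s) (e.eval s))
  | seq p q, Q, s => p.wp V (q.wp V Q) s
  | cond e p q, Q, s => (e.eval s ≠ 0 → p.wp V Q s) ∧ (e.eval s = 0 → q.wp V Q s)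
  | loop _ _, _, _ => False

theorem Prog.wp_mono {V : ℕ} {p : Prog} {Q Q' : Store → Prop} {s : Store} (h : ∀ s, Q s → Q' s)
    (hp : p.wp V Q s) : p.wp V Q' s := by
  induction p generalizing Q Q' s with
  | skip => exact h s hp
  | assign x e => exact hp.imp_right (h _)
  | store r i e => exact hp.imp_right (h _)
  | seq p q ihp ihq => exact ihp (fun s' => ihq h) hp
  | cond e p q ihp ihq => exact ⟨fun he => ihp h (hp.1 he), fun he => ihq h (hp.2 he)⟩
  | loop => exact hp

/-- Started in `s`, the program halts within `T` steps in a state with `Q`, handling no number above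
`k * V` and storing no number above `V`. -/
def Runs (k V : ℕ) (p : Prog) (s : Store) (T : ℕ) (Q : Store → Prop) : Prop :=
  ∃ t s', Exec (k * V) p s t s' ∧ t ≤ T ∧ s'.Bdd V ∧ Q s'

theorem Runs.of_wp {k V : ℕ} (hV : 1 ≤ V) {p : Prog} (hp : p.Light k = true) {s : Store}
    (hs : s.Bdd V) {Q : Store → Prop} (h : p.wp V Q s) : Runs k V p s p.flatCost Q := by
  have hk : ∀ {e : Expr} {s : Store}, s.Bdd V → e.weight ≤ k → e.peak s ≤ k * V := fun hs he =>
    (Expr.peak_le hV hs _).trans (Nat.mul_le_mul_right V he)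
  induction p generalizing s Q with
  | skip => exact ⟨1, s, Exec.skip s, le_rfl, hs, h⟩
  | assign x e =>
    simp only [Prog.Light, decide_eq_true_eq] at hp
    exact ⟨_, _, Exec.assign s x e (hk hs hp), le_rfl, hs.setVar h.1, h.2⟩
  | store r i e =>
    simp only [Prog.Light, Bool.and_eq_true, decide_eq_true_eq] at hp
    exact ⟨_, _, Exec.store s r i e (hk hs hp.1) (hk hs hp.2), le_rfl, hs.setArr h.1, h.2⟩
  | seq p q ihp ihq =>
    simp only [Prog.Light, Bool.and_eq_true] at hp
    obtain ⟨t, s', h1, h2, h3, h4⟩ := ihp hp.1 hs h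
    obtain ⟨t', s'', h5, h6, h7, h8⟩ := ihq hp.2 h3 h4
    exact ⟨_, _, Exec.seq h1 h5, Nat.add_le_add h2 h6, h7, h8⟩
  | cond e p q ihp ihq =>
    simp only [Prog.Light, Bool.and_eq_true, decide_eq_true_eq] at hp
    by_cases he : e.eval s = 0
    · obtain ⟨t, s', h1, h2, h3, h4⟩ := ihq hp.2 hs (h.2 he)
      refine ⟨_, _, Exec.cond_false (hk hs hp.1.1) he h1, ?_, h3, h4⟩
      simp only [Prog.flatCost]
      omega
    · obtain ⟨t, s', h1, h2, h3, h4⟩ := ihp hp.1.2 hs (h.1 he)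
      refine ⟨_, _, Exec.cond_true (hk hs hp.1.1) he h1, ?_, h3, h4⟩
      simp only [Prog.flatCost]
      omega
  | loop e p => exact h.elim

theorem Runs.seq {k V : ℕ} {p q : Prog} {s : Store} {T T' : ℕ} {Q R : Store → Prop}
    (hp : Runs k V p s T Q) (hq : ∀ s', s'.Bdd V → Q s' → Runs k V q s' T' R) :
    Runs k V (Prog.seq p q) s (T + T') R := by
  obtain ⟨t, s', h1, h2, h3, h4⟩ := hp
  obtain ⟨t', s'', h5, h6, h7, h8⟩ := hq s' h3 h4
  exact ⟨_, _, Exec.seq h1 h5, Nat.add_le_add h2 h6, h7, h8⟩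

theorem Runs.mono {k V : ℕ} {p : Prog} {s : Store} {T T' : ℕ} {Q Q' : Store → Prop}
    (h : Runs k V p s T Q) (hT : T ≤ T') (hQ : ∀ s', s'.Bdd V → Q s' → Q' s') :
    Runs k V p s T' Q' := by
  obtain ⟨t, s', h1, h2, h3, h4⟩ := h
  exact ⟨t, s', h1, h2.trans hT, h3, hQ _ h3 h4⟩

/-- A loop whose body has no loops, with an invariant and a decreasing measure. -/
theorem Runs.loop {k V : ℕ} (hV : 1 ≤ V) {e : Expr} {p : Prog} (hp : (Prog.loop e p).Light k = true)
    (J : Store → Prop) (μ : Store → ℕ)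
    (hstep : ∀ s, s.Bdd V → J s → e.eval s ≠ 0 → p.wp V (fun s' => J s' ∧ μ s' < μ s) s)
    {s : Store} (hs : s.Bdd V) (hJ : J s) :
    Runs k V (Prog.loop e p) s ((μ s + 1) * (p.flatCost + e.cost + 1))
      (fun s' => J s' ∧ e.eval s' = 0) := by
  simp only [Prog.Light, Bool.and_eq_true, decide_eq_true_eq] at hp
  induction hn : μ s using Nat.strong_induction_on generalizing s with
  | _ n ih =>
    have hpk : e.peak s ≤ k * V := (Expr.peak_le hV hs _).trans (Nat.mul_le_mul_right V hp.1)
    by_cases he : e.eval s = 0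
    · refine ⟨_, _, Exec.loop_stop hpk he, ?_, hs, hJ, he⟩
      nlinarith
    · obtain ⟨t, s', h1, h2, h3, h4, h5⟩ := Runs.of_wp hV hp.2 hs (hstep s hs hJ he)
      obtain ⟨t', s'', h6, h7, h8, h9⟩ := ih (μ s') (by omega) h3 h4 rfl
      refine ⟨_, _, Exec.loop_step hpk he h1 h6, ?_, h8, h9⟩
      have h10 : (μ s' + 2) * (p.flatCost + e.cost + 1) ≤ (n + 1) * (p.flatCost + e.cost + 1) :=
        Nat.mul_le_mul_right _ (by omega)
      have h11 : (μ s' + 2) * (p.flatCost + e.cost + 1) =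
        (μ s' + 1) * (p.flatCost + e.cost + 1) + (p.flatCost + e.cost + 1) := by ring
      omega

/-! ### Derived expressions -/

namespace Expr

/-- Nonzero iff `e < f`. -/
def lt (e f : Expr) : Expr := sub f e

def not (e : Expr) : Expr := sub (const 1) e

def and (e f : Expr) : Expr := not (add (not e) (not f))

def eq (e f : Expr) : Expr := not (add (sub e f) (sub f e))

def succ (e : Expr) : Expr := add e (const 1)

def pred (e : Expr) : Expr := sub e (const 1)

def le (e f : Expr) : Expr := sub (succ f) e

variable (s : Store) (e f : Expr)

@[simp] theorem eval_const (c : ℕ) : (const c).eval s = c := rfl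
@[simp] theorem eval_var (x : ℕ) : (var x).eval s = s.var x := rfl
@[simp] theorem eval_load (r : ℕ) : (load r e).eval s = s.arr r (e.eval s) := rfl
@[simp] theorem eval_succ : (succ e).eval s = e.eval s + 1 := rfl
@[simp] theorem eval_pred : (pred e).eval s = e.eval s - 1 := rfl

@[simp] theorem eval_add_eq_zero : (add e f).eval s = 0 ↔ e.eval s = 0 ∧ f.eval s = 0 := by
  simp [eval]

@[simp] theorem eval_lt_eq_zero : (lt e f).eval s = 0 ↔ f.eval s ≤ e.eval s := by
  simp [lt, eval, Nat.sub_eq_zero_iff_le]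

@[simp] theorem eval_le_eq_zero : (le e f).eval s = 0 ↔ f.eval s < e.eval s := by
  simp only [le, succ, eval]; omega

@[simp] theorem eval_not_eq_zero : (not e).eval s = 0 ↔ e.eval s ≠ 0 := by
  simp only [not, eval]; omega

@[simp] theorem eval_and_eq_zero : (and e f).eval s = 0 ↔ e.eval s = 0 ∨ f.eval s = 0 := by
  simp only [and, not, eval]; omega

@[simp] theorem eval_eq_eq_zero : (eq e f).eval s = 0 ↔ e.eval s ≠ f.eval s := by
  simp only [eq, not, eval]; omega

end Expr

/-- A loop that counts the register `x` up from `0` to the value of `n`. -/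
def Prog.forLoop (x : ℕ) (n : Expr) (p : Prog) : Prog :=
  .seq (.assign x (.const 0)) (.loop (.lt (.var x) n) (.seq p (.assign x (.succ (.var x)))))

/-- The rule for counting loops: `J j` holds after `j` iterations. -/
theorem Runs.forLoop {k V : ℕ} (hV : 1 ≤ V) {x : ℕ} {n : Expr} {p : Prog}
    (hp : (Prog.forLoop x n p).Light k = true) (N : ℕ) (hN : N ≤ V) (J : ℕ → Store → Prop)
    (hn : ∀ j s, j ≤ N → J j s → s.var x = j → n.eval s = N)
    (hx : ∀ j s v, J j s → J j (s.setVar x v))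
    (hstep : ∀ j s, s.Bdd V → j < N → J j s → s.var x = j →
      p.wp V (fun s' => J (j + 1) s' ∧ s'.var x = j) s)
    {s : Store} (hs : s.Bdd V) (hJ : J 0 s) :
    -- The initial assignment costs 2; each round costs 3 for the test besides `n`, and 4 for the
    -- increment.
    Runs k V (Prog.forLoop x n p) s (2 + (N + 1) * (p.flatCost + n.cost + 7)) (J N) := by
  have hL := hp
  simp only [Prog.forLoop, Prog.Light, Bool.and_eq_true] at hL
  refine (Runs.seq (Runs.of_wp (k := k) (Q := fun s' => J 0 s' ∧ s'.var x = 0) hV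
      (by simpa [Prog.Light] using hL.1) hs ?_)
    fun s' hs' h => ?_).mono (T' := 2 + (N + 1) * (p.flatCost + n.cost + 7)) (Q' := J N)
      (T := 2 + (N + 1) * (p.flatCost + n.cost + 7)) le_rfl fun _ _ h => h
  · refine ⟨by simp, hx _ _ _ hJ, by simp⟩
  · refine (Runs.loop hV (k := k) (by simpa only [Prog.Light, Bool.and_eq_true] using hL.2)
      (fun s => s.var x ≤ N ∧ J (s.var x) s)
      (fun s => N - s.var x) ?_ hs' ⟨by omega, ?_⟩).mono ?_ ?_
    · rintro s hs ⟨h1, h2⟩ h3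
      have h4 := hn _ s h1 h2 rfl
      have h5 : s.var x < N := by
        simp only [ne_eq, Expr.eval_lt_eq_zero, Expr.eval_var, h4] at h3
        omega
      have h6 := hstep _ s hs h5 h2 rfl
      simp only [Prog.wp]
      refine Prog.wp_mono ?_ h6
      rintro s' ⟨h7, h8⟩
      simp only [Expr.eval_succ, Expr.eval_var, Store.var_setVar, if_true, h8]
      refine ⟨by omega, ⟨by omega, hx _ _ _ h7⟩, by omega⟩
    · rw [h.2]; exact h.1
    · rw [h.2]
      simp only [Prog.flatCost, Expr.lt, Expr.cost, Expr.succ, Nat.sub_zero]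
      refine Nat.mul_le_mul_left _ ?_
      omega
    · rintro s hs ⟨⟨h1, h2⟩, h3⟩
      simp only [Expr.eval_lt_eq_zero, Expr.eval_var, hn _ s h1 h2 rfl] at h3
      have : s.var x = N := by omega
      rwa [this] at h2

end StrongStable

namespace StrongStable

/-! ### The main loop

Registers: 5 stack pointer, 6 man, 7 position, 8 woman. Arrays: 9 owners of the positions, 13 ranks for
the women, 14 to 20 the components of the state. -/

open StrongStable.Expr StrongStable.Prog

/-- Woman `b` (register 8) gets the cap `v` and price 1; her partner is pushed on the stack. -/
def dropProg (v : Expr) : Prog :=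
  .seq (.store 14 (var 8) v) <| .seq (.store 15 (var 8) (const 1)) <|
  .seq (.cond (load 16 (var 8))
    (.seq (.store 17 (var 5) (load 9 (pred (load 16 (var 8))))) (.assign 5 (succ (var 5))))
    .skip) <|
  .store 16 (var 8) (const 0)

/-- Man `a` (register 6) is engaged to woman `b` (register 8). -/
def bidProg : Prog :=
  .seq (.store 15 (var 8) (succ (load 19 (var 6)))) <|
  .seq (.cond (load 16 (var 8))
    (.store 17 (pred (var 5)) (load 9 (pred (load 16 (var 8)))))
    (.assign 5 (pred (var 5)))) <|
  .store 16 (var 8) (succ (var 7))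

/-- The man on top of the stack inspects the woman at his cursor. -/
def inspectProg : Prog :=
  .seq (.assign 8 (load 1 (var 7))) <| .seq (.store 20 (var 6) (succ (var 7))) <|
  .cond (load 19 (var 6))
    (.cond (.eq (load 13 (var 7)) (load 14 (var 8)))
      -- The edge is live. Up to level `nB` the man bids if the price equals his level; at level `nB
      -- + 1` the cap is lowered by one.
      (.cond (.le (load 19 (var 6)) (var 1))
        (.cond (.eq (load 15 (var 8)) (load 19 (var 6))) bidProg .skip)
        (dropProg (pred (load 14 (var 8)))))
      .skip)
    -- Sweep 0: a proposal below the cap becomes the new cap.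
    (.cond (.lt (load 13 (var 7)) (load 14 (var 8))) (dropProg (load 13 (var 7))) .skip)

/-- The man on top of the stack has inspected his whole tie. -/
def turnProg : Prog :=
  .cond (.le (load 19 (var 6)) (var 1))
    (.seq (.store 19 (var 6) (succ (load 19 (var 6)))) (.store 20 (var 6) (load 18 (var 6))))
    (.seq (.store 18 (var 6) (var 7)) (.store 19 (var 6) (const 0)))

def stepProg : Prog :=
  .seq (.assign 6 (load 17 (pred (var 5)))) <| .seq (.assign 7 (load 20 (var 6))) <|
  .cond (.eq (load 18 (var 6)) (load 0 (succ (var 6))))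
    (.assign 5 (pred (var 5)))
    -- The program does not store tie ends: a tie is over when the list ends or the tie number
    -- changes.
    (.cond (.and (.lt (var 7) (load 0 (succ (var 6))))
        (.eq (load 2 (var 7)) (load 2 (load 18 (var 6)))))
      inspectProg turnProg)

open EdgeList

def stateOf (s : Store) : State :=
  ⟨s.arr 14, s.arr 15, s.arr 16, s.arr 17, s.arr 18, s.arr 19, s.arr 20, s.var 5⟩

/-- The stack holds different men, so its pointer stays within the word bound. -/
theorem EdgeList.Inv.sp_le {I : EdgeList} {σ : State} (h : I.Inv σ) : σ.sp ≤ I.nA := by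
  have := Finset.card_le_card_of_injOn (s := Finset.range σ.sp) (t := Finset.range I.nA) σ.st
    (fun k hk => by simpa using h.st_lt k (by simpa using hk))
    (fun j hj k hk => h.st_inj j (by simpa using hj) k (by simpa using hk))
  simpa using this

/-- The store contains the data of `I`. -/
structure Holds (I : EdgeList) (s : Store) : Prop where
  nA : s.var 0 = I.nA
  nB : s.var 1 = I.nB
  off : s.arr 0 = I.off
  nb : s.arr 1 = I.nb
  tn : s.arr 2 = I.tn
  own : s.arr 9 = I.own
  R : s.arr 13 = I.R

/-- The memory that the main loop does not change. -/
def SameInput (s s' : Store) : Prop := (∀ x < 5, s'.var x = s.var x) ∧ ∀ r < 14, s'.arr r = s.arr r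

/-- The main loop invariant. -/
def MainInv (I : EdgeList) (s₀ s : Store) : Prop :=
  Holds I s ∧ SameInput s₀ s ∧ I.Inv (stateOf s)

theorem holds_of_same {I : EdgeList} {s s' : Store} (h : Holds I s) (h' : SameInput s s') :
    Holds I s' :=
  ⟨(h'.1 0 (by decide)).trans h.nA, (h'.1 1 (by decide)).trans h.nB,
    (h'.2 0 (by decide)).trans h.off, (h'.2 1 (by decide)).trans h.nb,
    (h'.2 2 (by decide)).trans h.tn, (h'.2 9 (by decide)).trans h.own,
    (h'.2 13 (by decide)).trans h.R⟩

theorem SameInput.trans {s s' s'' : Store} (h : SameInput s s') (h' : SameInput s' s'') :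
    SameInput s s'' :=
  ⟨fun x hx => (h'.1 x hx).trans (h.1 x hx), fun r hr => (h'.2 r hr).trans (h.2 r hr)⟩

theorem SameInput.refl (s : Store) : SameInput s s := ⟨fun _ _ => rfl, fun _ _ => rfl⟩

theorem SameInput.setVar {s s' : Store} (h : SameInput s s') {x v : ℕ} (hx : 5 ≤ x) :
    SameInput s (s'.setVar x v) := by
  refine ⟨fun y hy => ?_, h.2⟩
  rw [Store.var_setVar, if_neg (by omega)]
  exact h.1 y hy

theorem SameInput.setArr {s s' : Store} (h : SameInput s s') {r i v : ℕ} (hr : 14 ≤ r) :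
    SameInput s (s'.setArr r i v) := by
  refine ⟨h.1, fun y hy => ?_⟩
  rw [Store.arr_setArr, if_neg (by omega)]
  exact h.2 y hy

variable {I : EdgeList} {V : ℕ}

/-- What holds when the man in register 6 has reached the position in register 7 of his tie. -/
structure AtTop (I : EdgeList) (s : Store) : Prop where
  holds : Holds I s
  inv : I.Inv (stateOf s)
  sp : 0 < s.var 5
  man : s.var 6 = s.arr 17 (s.var 5 - 1)
  pos : s.var 7 = s.arr 20 (s.var 6)
  lt : s.arr 18 (s.var 6) < I.off (s.var 6 + 1)

theorem step_post {s s' : Store} {σ : State} (hs : SameInput s s') (hσ : stateOf s' = σ)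
    (hI : I.Inv σ) (hμ : I.measure σ < I.measure (stateOf s)) :
    SameInput s s' ∧ I.Inv (stateOf s') ∧ I.measure (stateOf s') < I.measure (stateOf s) := by
  subst hσ
  exact ⟨hs, hI, hμ⟩

theorem wp_turn (hV : I.nA + I.nB + I.mm + 3 ≤ V) {s : Store} (hs : s.Bdd V) (h : AtTop I s)
    (hi : s.var 7 = I.te (s.arr 18 (s.var 6))) :
    turnProg.wp V (fun s' => SameInput s s' ∧ I.Inv (stateOf s') ∧
      I.measure (stateOf s') < I.measure (stateOf s)) s := by
  obtain ⟨hH, hI, hsp, ha, hp, hlt⟩ := h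
  have haA : s.var 6 < I.nA := ha ▸ hI.st_lt (s.var 5 - 1) (Nat.sub_lt hsp one_pos)
  have hi' : (stateOf s).i (s.var 6) = I.te ((stateOf s).s (s.var 6)) := hp.symm.trans hi
  simp only [turnProg, Prog.wp]
  refine ⟨fun hl => ?_, fun hl => ?_⟩
  · replace hl : s.arr 19 (s.var 6) ≤ I.nB := by
      simpa [hH.nB] using hl
    refine ⟨?_, hs.2 _ _, step_post
      (SameInput.refl s |>.setArr (by decide) |>.setArr (by decide)) ?_
      (inv_sweep hI hsp ha hlt hi' hl) (measure_lt haA ?_ ?_ ?_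
        (work_sweep hI haA hlt hi' hl rfl ?_ ?_) (Nat.le_succ _))⟩
    · simp only [eval_succ, eval_load, eval_var]; omega
    · simp [stateOf]
    · intro x hx; rfl
    · intro x hx; simp [hx]
    · intro x hx; simp [hx]
    · simp
    · simp
  · replace hl : s.arr 19 (s.var 6) = I.nB + 1 := by
      have h1 := (hI.i_rng _ haA hlt).2.2
      simp only [stateOf] at h1
      have h2 : I.nB < s.arr 19 (s.var 6) := by simpa [hH.nB] using hl
      omega
    refine ⟨hs.1 _, Nat.zero_le _, step_post
      (SameInput.refl s |>.setArr (by decide) |>.setArr (by decide)) ?_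
      (inv_tie hI hsp ha hlt hi' hl) (measure_lt haA ?_ ?_ ?_
        (work_tie hI haA hlt hi' hl ?_ ?_) (Nat.le_succ _))⟩
    · simp [stateOf, hp]
    · intro x hx; simp [hx]
    · intro x hx; simp [hx]
    · intro x hx; rfl
    · simp
    · simp

/-- The move of the cursor has been made; the woman is in register 8. -/
theorem wp_drop (hV : I.nA + I.nB + I.mm + 3 ≤ V) {s s₁ : Store} (hs : s.Bdd V)
    (h : AtTop I s) (hi : s.var 7 < I.te (s.arr 18 (s.var 6)))
    (hs₁ : s₁ = (s.setVar 8 (I.nb (s.var 7))).setArr 20 (s.var 6) (s.var 7 + 1)) {e : Expr}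
    (hv : e.eval s₁ < s.arr 14 (I.nb (s.var 7))) (hR : e.eval s₁ ≤ I.R (s.var 7))
    (hval : ∀ M, I.Stable M → e.eval s₁ ≤ I.nA →
      ∃ f ∈ M, I.nb f = I.nb (s.var 7) ∧ I.R f ≤ e.eval s₁) :
    (dropProg e).wp V (fun s' => SameInput s s' ∧ I.Inv (stateOf s') ∧
      I.measure (stateOf s') < I.measure (stateOf s)) s₁ := by
  obtain ⟨hH, hI, hsp, ha, hp, hlt⟩ := h
  have haA : s.var 6 < I.nA := ha ▸ hI.st_lt (s.var 5 - 1) (Nat.sub_lt hsp one_pos)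
  have hi' : (stateOf s).i (s.var 6) < I.te ((stateOf s).s (s.var 6)) := by
    simp only [stateOf, ← hp]; exact hi
  have hpos : (stateOf s).i (s.var 6) = s.var 7 := hp.symm
  have hcur := (current_iff hI (e := s.var 7) haA hlt).2 ⟨hp ▸ (hI.i_rng _ haA hlt).1, hi⟩
  have hc := hI.c_le _ (I.nb_lt _ hcur.1)
  have hsame : SameInput s s₁ := by
    subst hs₁
    exact SameInput.refl s |>.setVar (by decide) |>.setArr (by decide)
  have hsple : s.var 5 ≤ I.nA := hI.sp_le
  obtain ⟨v, hve⟩ : ∃ v, e.eval s₁ = v := ⟨_, rfl⟩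
  rw [hve] at hv hR hval
  have hinv := inv_drop hI hsp ha hlt hi' rfl (v := v) (by rw [hpos]; exact hv)
    (by rw [hpos]; exact hR) (by rw [hpos]; exact hval)
  rw [hpos] at hinv
  have hμ : ∀ σ' : State, σ'.s = s.arr 18 → σ'.l = s.arr 19 →
      σ'.i = Function.update (s.arr 20) (s.var 6) (s.var 7 + 1) → σ'.sp ≤ s.var 5 + 1 →
      I.measure σ' < I.measure (stateOf s) := by
    intro σ' h1 h2 h3 h4
    refine measure_lt haA (fun x _ => congrFun h1 x) (fun x _ => congrFun h2 x) (fun x hx => ?_)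
      (work_move hI haA hlt hi' (congrFun h1 _) (congrFun h2 _) ?_) h4
    · rw [h3, Function.update_of_ne hx]; rfl
    · rw [h3, Function.update_self, hpos]
  simp only [dropProg, Prog.wp, hve]
  simp only [stateOf] at hc
  refine ⟨by omega, by simp only [eval_const]; omega, fun hN => ?_, fun hN => ?_⟩
  · replace hN : s.arr 16 (I.nb (s.var 7)) ≠ 0 := by
      simpa [hs₁] using hN
    refine ⟨?_, ?_, Nat.zero_le _, step_post
      (hsame |>.setArr (by decide) |>.setArr (by decide) |>.setArr (by decide)
        |>.setVar (by decide) |>.setArr (by decide)) ?_ hinv (hμ _ rfl rfl rfl ?_)⟩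
    · simp only [hs₁, eval_load, Store.arr_setArr, Store.arr_setVar]
      exact hs.2 9 _
    · simp only [hs₁, eval_succ, eval_var, Store.var_setArr, Store.var_setVar]
      simp
      omega
    · simp [stateOf, hs₁, hN, hH.own]
    · exact (if_neg hN).le
  · replace hN : s.arr 16 (I.nb (s.var 7)) = 0 := by
      simpa [hs₁] using hN
    refine ⟨Nat.zero_le _, step_post
      (hsame |>.setArr (by decide) |>.setArr (by decide) |>.setArr (by decide)) ?_ hinv
        (hμ _ rfl rfl rfl ?_)⟩
    · simp [stateOf, hs₁, hN]
    · exact (if_pos hN).le.trans (Nat.le_succ _)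

theorem wp_bid (hV : I.nA + I.nB + I.mm + 3 ≤ V) {s s₁ : Store} (hs : s.Bdd V)
    (h : AtTop I s) (hi : s.var 7 < I.te (s.arr 18 (s.var 6)))
    (hs₁ : s₁ = (s.setVar 8 (I.nb (s.var 7))).setArr 20 (s.var 6) (s.var 7 + 1))
    (hR : I.R (s.var 7) = s.arr 14 (I.nb (s.var 7)))
    (hq : s.arr 15 (I.nb (s.var 7)) = s.arr 19 (s.var 6)) (hl : 1 ≤ s.arr 19 (s.var 6))
    (hl2 : s.arr 19 (s.var 6) ≤ I.nB) :
    bidProg.wp V (fun s' => SameInput s s' ∧ I.Inv (stateOf s') ∧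
      I.measure (stateOf s') < I.measure (stateOf s)) s₁ := by
  obtain ⟨hH, hI, hsp, ha, hp, hlt⟩ := h
  have haA : s.var 6 < I.nA := ha ▸ hI.st_lt (s.var 5 - 1) (Nat.sub_lt hsp one_pos)
  have hi' : (stateOf s).i (s.var 6) < I.te ((stateOf s).s (s.var 6)) := by
    simp only [stateOf, ← hp]; exact hi
  have hpos : (stateOf s).i (s.var 6) = s.var 7 := hp.symm
  have hcur := (current_iff hI (e := s.var 7) haA hlt).2 ⟨hp ▸ (hI.i_rng _ haA hlt).1, hi⟩
  have hsame : SameInput s s₁ := by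
    subst hs₁
    exact SameInput.refl s |>.setVar (by decide) |>.setArr (by decide)
  have hsple : s.var 5 ≤ I.nA := hI.sp_le
  have hinv := inv_bid hI hsp ha hlt hi' rfl (by rw [hpos]; exact hR) (by rw [hpos]; exact hq)
    hl hl2
  rw [hpos] at hinv
  have hμ : ∀ σ' : State, σ'.s = s.arr 18 → σ'.l = s.arr 19 →
      σ'.i = Function.update (s.arr 20) (s.var 6) (s.var 7 + 1) → σ'.sp ≤ s.var 5 + 1 →
      I.measure σ' < I.measure (stateOf s) := by
    intro σ' h1 h2 h3 h4
    refine measure_lt haA (fun x _ => congrFun h1 x) (fun x _ => congrFun h2 x) (fun x hx => ?_)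
      (work_move hI haA hlt hi' (congrFun h1 _) (congrFun h2 _) ?_) h4
    · rw [h3, Function.update_of_ne hx]; rfl
    · rw [h3, Function.update_self, hpos]
  have hmm := hcur.1
  simp only [bidProg, Prog.wp]
  refine ⟨?_, fun hN => ?_, fun hN => ?_⟩
  · simp [hs₁]
    omega
  · replace hN : s.arr 16 (I.nb (s.var 7)) ≠ 0 := by
      simpa [hs₁] using hN
    refine ⟨?_, ?_, step_post
      (hsame |>.setArr (by decide) |>.setArr (by decide) |>.setArr (by decide)) ?_ hinv
        (hμ _ rfl rfl rfl ?_)⟩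
    · simp only [hs₁, eval_load, Store.arr_setArr, Store.arr_setVar]
      exact hs.2 9 _
    · simp [hs₁]
      omega
    · simp [stateOf, hs₁, hN, hH.own]
    · exact (if_neg hN).le.trans (Nat.le_succ _)
  · replace hN : s.arr 16 (I.nb (s.var 7)) = 0 := by
      simpa [hs₁] using hN
    refine ⟨?_, ?_, step_post
      (hsame |>.setArr (by decide) |>.setVar (by decide) |>.setArr (by decide)) ?_ hinv
        (hμ _ rfl rfl rfl ?_)⟩
    · simp [hs₁]
      omega
    · simp [hs₁]
      omega
    · simp [stateOf, hs₁, hN]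
    · exact (if_pos hN).le.trans ((Nat.sub_le _ _).trans (Nat.le_succ _))

theorem wp_inspect (hV : I.nA + I.nB + I.mm + 3 ≤ V) {s : Store} (hs : s.Bdd V)
    (h : AtTop I s) (hi : s.var 7 < I.te (s.arr 18 (s.var 6))) :
    inspectProg.wp V (fun s' => SameInput s s' ∧ I.Inv (stateOf s') ∧
      I.measure (stateOf s') < I.measure (stateOf s)) s := by
  have hh := h
  obtain ⟨hH, hI, hsp, ha, hp, hlt⟩ := h
  have haA : s.var 6 < I.nA := ha ▸ hI.st_lt (s.var 5 - 1) (Nat.sub_lt hsp one_pos)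
  have hi' : (stateOf s).i (s.var 6) < I.te ((stateOf s).s (s.var 6)) := by
    simp only [stateOf, ← hp]; exact hi
  have hpos : (stateOf s).i (s.var 6) = s.var 7 := hp.symm
  obtain ⟨hcur1, hcur2, hcur3⟩ :=
    (current_iff hI (e := s.var 7) haA hlt).2 ⟨hp ▸ (hI.i_rng _ haA hlt).1, hi⟩
  have hcB := I.nb_lt _ hcur1
  have hl := (hI.i_rng _ haA hlt).2.2
  have hq := hI.q_rng _ hcB
  have hpassed := hI.passed _ hcur1 hcur3
  have hprice := hI.price _ hcur1 hcur3
  have hRs := I.R_spec _ hcur1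
  have hc := hI.c_le _ hcB
  rw [hcur2] at hpassed hprice
  have hval := fun (M : Set ℕ) (hM : I.Stable M) => valid_propose hI hcur1 hcur3 hM
  have hstrip := fun (h1 : s.arr 13 (s.var 7) = s.arr 14 (I.nb (s.var 7)))
    (h2 : s.arr 19 (s.var 6) = I.nB + 1) (M : Set ℕ) (hM : I.Stable M) =>
    valid_strip hI hcur1 hcur3 (hH.R ▸ h1) (hcur2.symm ▸ h2) (by
      intro b hb f hf
      rw [hcur2, ha]
      exact hI.st_free _ (Nat.sub_lt hsp one_pos) b hb f hf) hM
  have hmove := inv_move hI hsp ha hlt hi'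
  rw [hpos] at hmove
  simp only [stateOf] at hl hq hpassed hprice hc hstrip hmove
  have hsame : SameInput s ((s.setVar 8 (I.nb (s.var 7))).setArr 20 (s.var 6) (s.var 7 + 1)) :=
    SameInput.refl s |>.setVar (by decide) |>.setArr (by decide)
  -- The common end of the three branches in which only the cursor moves.
  have hskip : s.arr 14 (I.nb (s.var 7)) ≤ I.R (s.var 7) →
      (I.R (s.var 7) = s.arr 14 (I.nb (s.var 7)) →
        s.arr 19 (s.var 6) + 1 ≤ s.arr 15 (I.nb (s.var 7))) →
      SameInput s ((s.setVar 8 (I.nb (s.var 7))).setArr 20 (s.var 6) (s.var 7 + 1)) ∧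
      I.Inv (stateOf ((s.setVar 8 (I.nb (s.var 7))).setArr 20 (s.var 6) (s.var 7 + 1))) ∧
      I.measure (stateOf ((s.setVar 8 (I.nb (s.var 7))).setArr 20 (s.var 6) (s.var 7 + 1))) <
        I.measure (stateOf s) := by
    intro h1 h2
    refine step_post hsame ?_ (hmove h1 h2) (measure_lt haA ?_ ?_ ?_
        (work_move hI haA hlt hi' rfl rfl ?_) (Nat.le_succ _))
    · simp [stateOf]
    · intro x hx; rfl
    · intro x hx; rfl
    · intro x hx; simp [stateOf, hx]
    · simp [stateOf, hp]
  simp only [inspectProg, Prog.wp]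
  have e1 : (load 1 (var 7)).eval s = I.nb (s.var 7) := by simp [hH.nb]
  have e2 : (var 6).eval (s.setVar 8 (I.nb (s.var 7))) = s.var 6 := by simp
  have e3 : (succ (var 7)).eval (s.setVar 8 (I.nb (s.var 7))) = s.var 7 + 1 := by simp
  rw [e1, e2, e3]
  refine ⟨by omega, by omega, fun h1 => ⟨fun h2 => ⟨fun h3 => ⟨fun h4 => ?_, fun h4 => ?_⟩,
    fun h3 => ?_⟩, fun h2 => ?_⟩, fun h1 => ⟨fun h2 => ?_, fun h2 => ?_⟩⟩
  all_goals simp [hH.nB, hH.R] at h1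
  all_goals simp [hH.nB, hH.R] at h2
  all_goals try simp [hH.nB, hH.R] at h3
  all_goals try simp [hH.nB, hH.R] at h4
  · exact wp_bid hV hs hh hi rfl h2 h4 (by omega) h3
  -- The price is at least the level by `price` and differs from it by `h4`.
  · refine hskip (by omega) fun h5 => ?_
    have := (hprice h5).1
    omega
  · have e4 : (pred (load 14 (var 8))).eval
        ((s.setVar 8 (I.nb (s.var 7))).setArr 20 (s.var 6) (s.var 7 + 1)) =
        s.arr 14 (I.nb (s.var 7)) - 1 := by simp
    refine wp_drop hV hs hh hi rfl ?_ ?_ ?_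
    · rw [e4]; omega
    · rw [e4]; omega
    · rw [e4]; exact fun M hM _ => hstrip (by rw [hH.R]; exact h2) (by omega) M hM
  · refine hskip ?_ fun h5 => absurd h5 h2
    exact hpassed (Or.inl (by omega))
  · have e4 : (load 13 (var 7)).eval
        ((s.setVar 8 (I.nb (s.var 7))).setArr 20 (s.var 6) (s.var 7 + 1)) =
        I.R (s.var 7) := by simp [hH.R]
    refine wp_drop hV hs hh hi rfl ?_ ?_ ?_
    · rw [e4]; exact h2
    · rw [e4]
    · rw [e4]; exact hval
  · refine hskip h2 fun h5 => ?_
    omega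

theorem wp_step (hV : I.nA + I.nB + I.mm + 3 ≤ V) {s₀ s : Store} (hs : s.Bdd V)
    (h : MainInv I s₀ s) (hsp : s.var 5 ≠ 0) :
    stepProg.wp V (fun s' => MainInv I s₀ s' ∧
      I.measure (stateOf s') < I.measure (stateOf s)) s := by
  obtain ⟨hH, hsame, hI⟩ := h
  have haA : s.arr 17 (s.var 5 - 1) < I.nA := hI.st_lt (s.var 5 - 1) (by simp [stateOf]; omega)
  simp only [stepProg, Prog.wp]
  have e1 : (load 17 (pred (var 5))).eval s = s.arr 17 (s.var 5 - 1) := by simp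
  rw [e1]
  generalize hgen : s.arr 17 (s.var 5 - 1) = a at *
  have e2 : (load 20 (var 6)).eval (s.setVar 6 a) = s.arr 20 a := by simp
  rw [e2]
  generalize hs₁ : (s.setVar 6 a).setVar 7 (s.arr 20 a) = s₁
  have hst : stateOf s₁ = stateOf s := by rw [← hs₁]; simp [stateOf]
  have hsame₁ : SameInput s s₁ := by
    rw [← hs₁]; exact SameInput.refl s |>.setVar (by decide) |>.setVar (by decide)
  have hs₁B : s₁.Bdd V := by
    rw [← hs₁]
    exact (hs.setVar (by omega)).setVar (hs.2 _ _)
  have v6 : s₁.var 6 = a := by rw [← hs₁]; simp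
  have v5 : s₁.var 5 = s.var 5 := by rw [← hs₁]; simp
  have v7 : s₁.var 7 = s.arr 20 a := by rw [← hs₁]; simp
  have harr : s₁.arr = s.arr := by rw [← hs₁]; simp
  have hrng := hI.s_rng a haA
  simp only [stateOf] at hrng
  refine ⟨by omega, hs.2 _ _, fun h1 => ?_, fun h1 => ⟨fun h2 => ?_, fun h2 => ?_⟩⟩
  all_goals simp [v6, v7, harr, hH.off, hH.tn] at h1
  · refine ⟨(Nat.sub_le _ _).trans (hs₁B.1 5), ?_⟩
    have h3 := inv_pop hI (Nat.pos_of_ne_zero hsp) (by simp only [stateOf, hgen]; exact h1)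
    have h4 : stateOf (s₁.setVar 5 ((pred (var 5)).eval s₁)) =
        { stateOf s with sp := (stateOf s).sp - 1 } := by
      rw [← hs₁]; simp [stateOf]
    have h5 := hsame₁.setVar (x := 5) (v := (pred (var 5)).eval s₁) (by decide)
    refine ⟨⟨holds_of_same hH h5, hsame.trans h5, by rw [h4]; exact h3⟩, ?_⟩
    rw [h4]
    have : (stateOf s).sp ≠ 0 := hsp
    simp only [EdgeList.measure]
    change 2 * ∑ a ∈ Finset.range I.nA, I.work (stateOf s) a + ((stateOf s).sp - 1) < _
    omega
  all_goals
    have hlt : s.arr 18 a < I.off (a + 1) := lt_of_le_of_ne hrng.2 h1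
    have htop : AtTop I s₁ := ⟨holds_of_same hH hsame₁, hst ▸ hI, by omega,
      by rw [v6, harr, v5]; exact hgen.symm, by rw [v7, harr, v6],
      by rw [harr, v6]; exact hlt⟩
    have hir := hI.i_rng a haA hlt
    have hoe := I.own_eq a haA _ hrng.1 hlt
    have hte := I.te_spec _ hoe.1 (s.arr 20 a) hir.1
    rw [hoe.2] at hte
    have hte2 := (I.te_gt _ hoe.1).2
    rw [hoe.2] at hte2
    simp only [stateOf] at hir
    simp [v6, v7, harr, hH.off, hH.tn] at h2
    have hpost : ∀ s', (SameInput s₁ s' ∧ I.Inv (stateOf s') ∧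
        I.measure (stateOf s') < I.measure (stateOf s₁)) → MainInv I s₀ s' ∧
        I.measure (stateOf s') < I.measure (stateOf s) := fun s' h =>
      ⟨⟨holds_of_same hH (hsame₁.trans h.1), hsame.trans (hsame₁.trans h.1), h.2.1⟩,
        hst ▸ h.2.2⟩
  · refine Prog.wp_mono hpost (wp_inspect hV hs₁B htop ?_)
    rw [v7, harr, v6]
    exact (hte h2.1).1 h2.2
  · refine Prog.wp_mono hpost (wp_turn hV hs₁B htop ?_)
    rw [v7, harr, v6]
    by_contra hne
    have h3 : s.arr 20 a < I.te (s.arr 18 a) := lt_of_le_of_ne hir.2.1 hne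
    exact h2.elim (fun h => by omega) fun h => h ((hte (by omega)).2 h3)

end StrongStable

namespace StrongStable

open StrongStable.Expr StrongStable.Prog

/-! ### Preprocessing -/

/-- The stores agree except on the registers in `X` and the arrays in `R`. -/
def Same (X R : List ℕ) (s s' : Store) : Prop :=
  (∀ x, x ∉ X → s'.var x = s.var x) ∧ ∀ r, r ∉ R → s'.arr r = s.arr r

namespace Same

variable {X R X' R' : List ℕ} {s s' s'' : Store}

theorem refl (X R : List ℕ) (s : Store) : Same X R s s := ⟨fun _ _ => rfl, fun _ _ => rfl⟩

theorem trans (h : Same X R s s') (h' : Same X' R' s' s'') : Same (X ++ X') (R ++ R') s s'' := by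
  refine ⟨fun x hx => ?_, fun r hr => ?_⟩
  · simp only [List.mem_append, not_or] at hx
    exact (h'.1 x hx.2).trans (h.1 x hx.1)
  · simp only [List.mem_append, not_or] at hr
    exact (h'.2 r hr.2).trans (h.2 r hr.1)

theorem setVar (h : Same X R s s') {x v : ℕ} (hx : x ∈ X) : Same X R s (s'.setVar x v) := by
  refine ⟨fun y hy => ?_, h.2⟩
  rw [Store.var_setVar, if_neg (by rintro rfl; exact hy hx)]
  exact h.1 y hy

theorem setArr (h : Same X R s s') {r i v : ℕ} (hr : r ∈ R) : Same X R s (s'.setArr r i v) := by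
  refine ⟨h.1, fun y hy => ?_⟩
  rw [Store.arr_setArr, if_neg (by rintro rfl; exact hy hr)]
  exact h.2 y hy

end Same

variable {V : ℕ}

/-- Array `own` gets the owners of the positions, array `off` being the table of offsets and
register `n` the number of vertices. Register 6 is the vertex, register 10 the position. -/
def ownProg (off own n : ℕ) : Prog :=
  .seq (.assign 6 (const 0)) <| .seq (.assign 10 (const 0)) <|
  .loop (.lt (var 10) (load off (var n))) <|
  .cond (.lt (var 10) (load off (succ (var 6))))
    (.seq (.store own (var 10) (var 6)) (.assign 10 (succ (var 10))))
    (.assign 6 (succ (var 6)))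

theorem runs_own {off own n : ℕ} (hoo : own ≠ off) (hn6 : n ≠ 6) (hn10 : n ≠ 10) {k N m : ℕ}
    (hk : (ownProg off own n).Light k = true) {s : Store} (hs : s.Bdd V) (hV : N + m + 1 ≤ V)
    (hN : s.var n = N) (hm : s.arr off N = m) (h0 : s.arr off 0 = 0) :
    Runs k V (ownProg off own n) s ((m + N + 2) * 30)
      (fun s' => Same [6, 10] [own] s s' ∧ ∀ e < m, ∃ a < N, s'.arr own e = a ∧
        s.arr off a ≤ e ∧ e < s.arr off (a + 1)) := by
  have hV1 : 1 ≤ V := by omega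
  simp only [ownProg, Prog.Light, Bool.and_eq_true, decide_eq_true_eq] at hk
  have hL : (Prog.loop (.lt (var 10) (load off (var n))) <|
      .cond (.lt (var 10) (load off (succ (var 6))))
        (.seq (.store own (var 10) (var 6)) (.assign 10 (succ (var 10))))
        (.assign 6 (succ (var 6)))).Light k = true := by
    simpa only [Prog.Light, Bool.and_eq_true, decide_eq_true_eq] using hk.2.2
  refine Runs.mono (Runs.seq (Runs.of_wp (k := k)
    (Q := fun s' => s' = s.setVar 6 0) hV1
    (by simpa only [Prog.Light, decide_eq_true_eq] using hk.1) hs (by exact ⟨Nat.zero_le _, rfl⟩))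
    fun s₁ hs₁ h₁ => Runs.seq (Runs.of_wp (k := k) (Q := fun s' => s' = s₁.setVar 10 0) hV1
      (by simpa only [Prog.Light, decide_eq_true_eq] using hk.2.1) hs₁
      (by exact ⟨Nat.zero_le _, rfl⟩))
    fun s₂ hs₂ h₂ => Runs.mono (T' := (m + N + 1) * 30) (Q' := fun s' => Same [6, 10] [own] s s' ∧
      ∀ e < m, ∃ a < N, s'.arr own e = a ∧ s.arr off a ≤ e ∧ e < s.arr off (a + 1))
      (Runs.loop hV1 hL
      (fun t => Same [6, 10] [own] s t ∧ t.var 10 ≤ m ∧ t.var 6 ≤ N ∧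
        s.arr off (t.var 6) ≤ t.var 10 ∧ ∀ e < t.var 10, ∃ a < N, t.arr own e = a ∧
        s.arr off a ≤ e ∧ e < s.arr off (a + 1))
      -- Each iteration advances either the position or the vertex, so the time is linear in their
      -- total number even if lists are empty.
      (fun t => (m - t.var 10) + (N - t.var 6)) ?_ hs₂ ?_) ?_ ?_) ?_ fun _ _ h => h
  · rintro t ht ⟨hS, h1, h2, h3, h4⟩ h5
    have e1 : t.var n = N := (hS.1 n (by simp [hn6, hn10])).trans hN
    have e2 : t.arr off = s.arr off := hS.2 off (by simpa using hoo.symm)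
    simp only [ne_eq, eval_lt_eq_zero, eval_var, eval_load, e1, e2, hm, not_le] at h5
    have h6 : t.var 6 < N := by
      refine lt_of_le_of_ne h2 fun h => ?_
      rw [h, hm] at h3
      omega
    simp only [Prog.wp]
    refine ⟨fun h7 => ⟨?_, ?_, ⟨(hS.setArr (by simp)).setVar (by simp), ?_⟩, ?_⟩,
      fun h7 => ⟨?_, ⟨hS.setVar (by simp), ?_⟩, ?_⟩⟩
    all_goals simp [e2] at h7
    · exact ht.1 6
    · simp; omega
    · simp only [eval_succ, eval_var, Store.var_setVar, Store.var_setArr, Store.arr_setVar,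
        Store.arr_setArr, if_true]
      refine ⟨by omega, h2, by simp only [Nat.reduceEqDiff, if_false]; omega, fun e he => ?_⟩
      rw [Function.update_apply]
      split_ifs with hee
      · exact ⟨_, h6, rfl, by omega, by omega⟩
      · exact h4 e (by omega)
    · simp
      omega
    · simp; omega
    · simp
      refine ⟨h1, by omega, h7, fun e he => ?_⟩
      obtain ⟨a, ha, rfl, h8⟩ := h4 e he
      exact ⟨ha, h8⟩
    · simp
      omega
  · subst h₂ h₁
    exact ⟨((Same.refl _ _ s).setVar (by simp)).setVar (by simp), by simp, by simp, by simp [h0],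
      by simp⟩
  · subst h₂ h₁
    simp [Prog.flatCost, Expr.lt, Expr.succ, Expr.cost]
  · rintro s' - ⟨⟨hS, h1, h2, h3, h4⟩, h5⟩
    have e1 : s'.var n = N := (hS.1 n (by simp [hn6, hn10])).trans hN
    have e2 : s'.arr off = s.arr off := hS.2 off (by simpa using hoo.symm)
    simp only [eval_lt_eq_zero, eval_var, eval_load, e1, e2, hm] at h5
    exact ⟨hS, fun e he => h4 e (by omega)⟩
  · simp [Prog.flatCost, Expr.cost]
    omega

/-- Array 8: `a ↦ a * nB`; the stack and the cursors of the men. -/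
def menProg : Prog :=
  .seq (.forLoop 10 (var 0) <|
    -- The machine cannot multiply; the row bases `a * nB` arise by repeated addition.
    .seq (.store 8 (succ (var 10)) (add (load 8 (var 10)) (var 1))) <|
    .seq (.store 17 (var 10) (var 10)) <|
    .seq (.store 18 (var 10) (load 0 (var 10))) (.store 20 (var 10) (load 0 (var 10))))
  (.assign 5 (var 0))

theorem runs_men {k nA nB : ℕ} (hk : menProg.Light k = true) {s : Store} (hs : s.Bdd V)
    (hV : nA * nB + nA + nB + 1 ≤ V) (hA : s.var 0 = nA) (hB : s.var 1 = nB)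
    (h0 : s.arr 8 0 = 0) :
    Runs k V menProg s ((nA + 2) * 60)
      (fun s' => Same [5, 10] [8, 17, 18, 20] s s' ∧ s'.var 5 = nA ∧
        (∀ a ≤ nA, s'.arr 8 a = a * nB) ∧ (∀ a < nA, s'.arr 17 a = a) ∧
        (∀ a < nA, s'.arr 18 a = s.arr 0 a) ∧ (∀ a < nA, s'.arr 20 a = s.arr 0 a)) := by
  have hV1 : 1 ≤ V := by omega
  have hk' := hk
  simp only [menProg, Prog.Light, Bool.and_eq_true] at hk'
  refine (Runs.seq (Runs.forLoop hV1 (k := k) (by simpa only using hk'.1) nA (by omega)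
    (fun j t => Same [5, 10] [8, 17, 18, 20] s t ∧ (∀ a ≤ j, t.arr 8 a = a * nB) ∧
      (∀ a < j, t.arr 17 a = a) ∧ (∀ a < j, t.arr 18 a = s.arr 0 a) ∧
      (∀ a < j, t.arr 20 a = s.arr 0 a)) ?_ ?_ ?_ hs ?_)
    fun s₁ hs₁ h₁ => Runs.of_wp hV1 (by simpa only [Prog.Light] using hk'.2)
      (Q := fun s' => Same [5, 10] [8, 17, 18, 20] s s' ∧ s'.var 5 = nA ∧
        (∀ a ≤ nA, s'.arr 8 a = a * nB) ∧ (∀ a < nA, s'.arr 17 a = a) ∧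
        (∀ a < nA, s'.arr 18 a = s.arr 0 a) ∧ (∀ a < nA, s'.arr 20 a = s.arr 0 a)) hs₁ ?_).mono
    ?_ ?_
  · rintro j t - ⟨hS, -⟩ -
    exact (hS.1 0 (by decide)).trans hA
  · rintro j t v ⟨hS, h⟩
    exact ⟨hS.setVar (by decide), h⟩
  · rintro j t ht hj ⟨hS, h1, h2, h3, h4⟩ hx
    have eB : t.var 1 = nB := (hS.1 1 (by decide)).trans hB
    have e0 : t.arr 0 = s.arr 0 := hS.2 0 (by decide)
    have h5 := h1 j le_rfl
    have h6 : (j + 1) * nB ≤ nA * nB := Nat.mul_le_mul_right _ hj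
    have h7 : (j + 1) * nB = j * nB + nB := by ring
    simp only [Prog.wp]
    refine ⟨?_, ?_, ?_, ?_, ⟨hS.setArr (by decide) |>.setArr (by decide) |>.setArr (by decide)
      |>.setArr (by decide), ?_, ?_, ?_, ?_⟩, ?_⟩
    · simp [Expr.eval, hx, eB, h5]; omega
    · exact ht.1 10
    · exact ht.2 0 _
    · exact ht.2 0 _
    · intro a ha
      simp [Expr.eval, hx, eB, h5, Function.update_apply]
      split_ifs with haj
      · rw [haj, h7]
      · exact h1 a (by omega)
    · intro a ha
      simp [Expr.eval, hx, Function.update_apply]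
      split_ifs with haj
      · exact haj.symm
      · exact h2 a (by omega)
    · intro a ha
      simp [Expr.eval, hx, Function.update_apply, e0]
      split_ifs with haj
      · rw [haj]
      · exact h3 a (by omega)
    · intro a ha
      simp [Expr.eval, hx, Function.update_apply, e0]
      split_ifs with haj
      · rw [haj]
      · exact h4 a (by omega)
    · simp [hx]
  · exact ⟨Same.refl _ _ _, by simp [h0], by simp, by simp, by simp⟩
  · obtain ⟨hS, h⟩ := h₁
    have eA : s₁.var 0 = nA := (hS.1 0 (by decide)).trans hA
    refine ⟨hs₁.1 0, hS.setVar (by decide), ?_, h⟩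
    simp [eA]
  · simp [Prog.flatCost, Expr.succ, Expr.cost]
    omega
  · exact fun _ _ h => h

/-- The caps and prices of the women. -/
def womenProg : Prog :=
  .forLoop 10 (var 1) <|
    .seq (.store 14 (var 10) (succ (var 0))) (.store 15 (var 10) (const 1))

theorem runs_women {k nA nB : ℕ} (hk : womenProg.Light k = true) {s : Store} (hs : s.Bdd V)
    (hV : nA + nB + 1 ≤ V) (hA : s.var 0 = nA) (hB : s.var 1 = nB) :
    Runs k V womenProg s ((nB + 2) * 60)
      (fun s' => Same [10] [14, 15] s s' ∧ (∀ b < nB, s'.arr 14 b = nA + 1) ∧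
        (∀ b < nB, s'.arr 15 b = 1)) := by
  have hV1 : 1 ≤ V := by omega
  refine (Runs.forLoop hV1 hk nB (by omega)
    (fun j t => Same [10] [14, 15] s t ∧ (∀ b < j, t.arr 14 b = nA + 1) ∧
      (∀ b < j, t.arr 15 b = 1)) ?_ ?_ ?_ hs ?_).mono ?_ fun _ _ h => h
  · rintro j t - ⟨hS, -⟩ -
    exact (hS.1 1 (by decide)).trans hB
  · rintro j t v ⟨hS, h⟩
    exact ⟨hS.setVar (by decide), h⟩
  · rintro j t ht hj ⟨hS, h1, h2⟩ hx
    have eA : t.var 0 = nA := (hS.1 0 (by decide)).trans hA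
    simp only [Prog.wp]
    refine ⟨?_, hV1, ⟨hS.setArr (by decide) |>.setArr (by decide), ?_, ?_⟩, ?_⟩
    · simp [eA]; omega
    · intro b hb
      simp [hx, eA, Function.update_apply]
      intro hbj
      exact h1 b (by omega)
    · intro b hb
      simp [hx, Function.update_apply]
      intro hbj
      exact h2 b (by omega)
    · simp [hx]
  · exact ⟨Same.refl _ _ _, by simp, by simp⟩
  · simp [Prog.flatCost, Expr.succ, Expr.cost]
    omega

/-- The cell of the pair `(x, y)` in a matrix. -/
def cell (x y : Expr) : Expr := add (load 8 x) y

/-- The entries of array `z` are written into the matrix `dst`, at rows and columns given by the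
arrays `x` and `y`. -/
def matrixProg (x y z dst : ℕ) : Prog :=
  .forLoop 10 (load 0 (var 0)) <|
    .store dst (cell (load x (var 10)) (load y (var 10))) (load z (var 10))

theorem cell_inj {n a b a' b' : ℕ} (hb : b < n) (hb' : b' < n) (h : a * n + b = a' * n + b') :
    a = a' ∧ b = b' := by
  have hn : 0 < n := by omega
  have h1 : (a * n + b) / n = a := by
    rw [mul_comm, Nat.mul_add_div hn, Nat.div_eq_of_lt hb, Nat.add_zero]
  have h2 : (a' * n + b') / n = a' := by
    rw [mul_comm, Nat.mul_add_div hn, Nat.div_eq_of_lt hb', Nat.add_zero]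
  rw [h, h2] at h1
  subst h1
  omega

/-- Only the cells of edges are written. All other cells are zero because the memory was (`hdst`),
so the time is linear in the number of edges although the matrix has `nA * nB` cells. -/
theorem runs_matrix {x y z dst : ℕ} (h0 : dst ≠ 0) (h8 : dst ≠ 8) (hx : dst ≠ x) (hy : dst ≠ y)
    (hz : dst ≠ z) {k nA nB m : ℕ} (hk : (matrixProg x y z dst).Light k = true) {s : Store}
    (hs : s.Bdd V) (hV : m + 1 ≤ V) (hA : s.var 0 = nA) (hm : s.arr 0 nA = m)
    (hbase : ∀ a ≤ nA, s.arr 8 a = a * nB) (hX : ∀ e < m, s.arr x e < nA)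
    (hY : ∀ e < m, s.arr y e < nB) (hdst : ∀ i, s.arr dst i = 0)
    (hinj : ∀ e < m, ∀ f < m, s.arr x e = s.arr x f → s.arr y e = s.arr y f → e = f) :
    Runs k V (matrixProg x y z dst) s ((m + 2) * 60)
      (fun s' => Same [10] [dst] s s' ∧
        (∀ e < m, s'.arr dst (s.arr x e * nB + s.arr y e) = s.arr z e) ∧
        (∀ a < nA, ∀ b < nB, (∀ e < m, ¬ (s.arr x e = a ∧ s.arr y e = b)) →
          s'.arr dst (a * nB + b) = 0)) := by
  have hV1 : 1 ≤ V := by omega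
  refine (Runs.forLoop hV1 hk m (by omega)
    (fun j t => Same [10] [dst] s t ∧
        (∀ e < j, t.arr dst (s.arr x e * nB + s.arr y e) = s.arr z e) ∧
        (∀ a < nA, ∀ b < nB, (∀ e < j, ¬ (s.arr x e = a ∧ s.arr y e = b)) →
          t.arr dst (a * nB + b) = 0)) ?_ ?_ ?_ hs ?_).mono ?_ fun _ _ h => h
  · rintro j t - ⟨hS, -⟩ -
    simp [hS.1 0 (by decide), hS.2 0 (by simpa using h0.symm), hA, hm]
  · rintro j t v ⟨hS, h⟩
    exact ⟨hS.setVar (by decide), h⟩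
  · rintro j t ht hj ⟨hS, h1, h2⟩ hxj
    have e8 := hS.2 8 (by simpa using h8.symm)
    have ex := hS.2 x (by simpa using hx.symm)
    have ey := hS.2 y (by simpa using hy.symm)
    have ez := hS.2 z (by simpa using hz.symm)
    have ec : (cell (load x (var 10)) (load y (var 10))).eval t =
        s.arr x j * nB + s.arr y j := by
      simp [cell, Expr.eval, hxj, e8, ex, ey, hbase _ (hX j hj).le]
    simp only [Prog.wp, ec]
    refine ⟨ht.2 _ _, ⟨hS.setArr (by simp), ?_, ?_⟩, ?_⟩
    · intro e he
      simp only [Store.arr_setArr, if_true, Function.update_apply]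
      split_ifs with h
      · obtain ⟨h3, h4⟩ := cell_inj (hY e (by omega)) (hY j hj) h
        rw [hinj e (by omega) j hj h3 h4]
        simp [ez, hxj]
      · refine h1 e (lt_of_le_of_ne (by omega) ?_)
        rintro rfl
        exact h rfl
    · intro a ha b hb hno
      simp only [Store.arr_setArr, if_true, Function.update_apply]
      split_ifs with h
      · obtain ⟨h3, h4⟩ := cell_inj hb (hY j hj) h
        exact (hno j (by omega) ⟨h3.symm, h4.symm⟩).elim
      · exact h2 a ha b hb fun e he => hno e (by omega)
    · simp [hxj]
  · exact ⟨Same.refl _ _ _, by simp, by simp [hdst]⟩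
  · simp [Prog.flatCost, cell, Expr.cost]
    omega

end StrongStable

/-! ### The ranks in the pruned graph -/

namespace StrongStable

open StrongStable.Expr StrongStable.Prog

variable {V : ℕ}

/-- The edge `(x, y)` is deleted on behalf of `(m, w)`; `α` and `β` are the matrices of the ranks for
men and women, `0` for pairs that are no edge. -/
def Absent (α β : ℕ → ℕ → ℕ) (m w x y : ℕ) : Prop :=
  -- All edges at `m` or `w` go. For the others the cases of indifference and of strict preference
  -- merge into two weak comparisons, at least one of which is strict; `α x w ≠ 0` says that `(x,
  -- w)` is an edge.
  x = m ∨ y = w ∨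
  (α x w ≠ 0 ∧ β x w ≤ β m w ∧ α x w ≤ α x y ∧ (β x w < β m w ∨ α x w < α x y)) ∨
  (α m y ≠ 0 ∧ α m y ≤ α m w ∧ β m y ≤ β x y ∧ (α m y < α m w ∨ β m y < β x y))

/-- The matrix stored in array `r`. -/
def Store.matrix (s : Store) (n r : ℕ) (a b : ℕ) : ℕ := s.arr r (a * n + b)

/-- The cell of array `r` at `(x, y)`. -/
def entry (r : ℕ) (x y : Expr) : Expr := load r (cell x y)

theorem eval_entry {s : Store} {nA nB : ℕ} (hbase : ∀ a ≤ nA, s.arr 8 a = a * nB) (r : ℕ)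
    {x y : Expr} (hx : x.eval s ≤ nA) :
    (entry r x y).eval s = s.matrix nB r (x.eval s) (y.eval s) := by
  simp [entry, cell, Expr.eval, Store.matrix, hbase _ hx]

def absentExpr : Expr :=
  let x := var 6
  let y := var 8
  let m := var 2
  let w := var 3
  let A := entry 11
  let B := entry 12
  .add (.eq x m) <| .add (.eq y w) <| .add
    (.and (A x w) (.and (.le (B x w) (B m w)) (.and (.le (A x w) (A x y))
      (.add (.lt (B x w) (B m w)) (.lt (A x w) (A x y))))))
    (.and (A m y) (.and (.le (A m y) (A m w)) (.and (.le (B m y) (B x y))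
      (.add (.lt (A m y) (A m w)) (.lt (B m y) (B x y))))))

theorem eval_absentExpr {s : Store} {nA nB : ℕ} (hbase : ∀ a ≤ nA, s.arr 8 a = a * nB)
    (h2 : s.var 2 ≤ nA) (h6 : s.var 6 ≤ nA) :
    absentExpr.eval s ≠ 0 ↔ Absent (s.matrix nB 11) (s.matrix nB 12) (s.var 2) (s.var 3)
      (s.var 6) (s.var 8) := by
  have e6 := fun r y => eval_entry hbase r (x := var 6) (y := y) h6
  have e2 := fun r y => eval_entry hbase r (x := var 2) (y := y) h2
  simp only [eval_var] at e6 e2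
  simp only [absentExpr, Absent, ne_eq, eval_add_eq_zero, eval_eq_eq_zero, eval_and_eq_zero,
    eval_le_eq_zero, eval_lt_eq_zero, eval_var, e6, e2]
  simp only [not_and_or, not_or, not_not, not_le, not_lt]

/-- Array 13: the ranks for the women in the pruned graph. -/
def rankProg : Prog :=
  .forLoop 10 (load 0 (var 0)) <|
    .seq (.assign 6 (load 9 (var 10))) <| .seq (.assign 8 (load 1 (var 10))) <|
    .cond absentExpr (.store 13 (var 10) (add (var 0) (const 2)))
      (.store 13 (var 10) (entry 12 (var 6) (var 8)))

theorem runs_rank {k nA nB mm : ℕ} (hk : rankProg.Light k = true) {s : Store} (hs : s.Bdd V)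
    (hV : nA + mm + 2 ≤ V) (hA : s.var 0 = nA) (hm : s.arr 0 nA = mm) (h2 : s.var 2 < nA)
    (hbase : ∀ a ≤ nA, s.arr 8 a = a * nB) (hown : ∀ e < mm, s.arr 9 e < nA) :
    Runs k V rankProg s ((mm + 2) * (rankProg.flatCost + absentExpr.cost + 100))
      (fun s' => Same [6, 8, 10] [13] s s' ∧ ∀ e < mm,
        (Absent (s.matrix nB 11) (s.matrix nB 12) (s.var 2) (s.var 3) (s.arr 9 e) (s.arr 1 e) →
          s'.arr 13 e = nA + 2) ∧
        (¬ Absent (s.matrix nB 11) (s.matrix nB 12) (s.var 2) (s.var 3) (s.arr 9 e) (s.arr 1 e) →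
          s'.arr 13 e = s.matrix nB 12 (s.arr 9 e) (s.arr 1 e))) := by
  have hV1 : 1 ≤ V := by omega
  refine Runs.mono (Runs.forLoop hV1 hk mm (by omega)
    (fun j t => Same [6, 8, 10] [13] s t ∧ ∀ e < j,
        (Absent (s.matrix nB 11) (s.matrix nB 12) (s.var 2) (s.var 3) (s.arr 9 e) (s.arr 1 e) →
          t.arr 13 e = nA + 2) ∧
        (¬ Absent (s.matrix nB 11) (s.matrix nB 12) (s.var 2) (s.var 3) (s.arr 9 e) (s.arr 1 e) →
          t.arr 13 e = s.matrix nB 12 (s.arr 9 e) (s.arr 1 e))) ?_ ?_ ?_ hs ?_) ?_ fun _ _ h => h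
  · rintro j t - ⟨hS, -⟩ -
    simp [hS.1 0 (by decide), hS.2 0 (by decide), hA, hm]
  · rintro j t v ⟨hS, h⟩
    exact ⟨hS.setVar (by decide), h⟩
  · rintro j t ht hj ⟨hS, h1⟩ hxj
    have e9 : (load 9 (var 10)).eval t = s.arr 9 j := by simp [hxj, hS.2 9 (by decide)]
    have e1 : ∀ v, (load 1 (var 10)).eval (t.setVar 6 v) = s.arr 1 j := by
      intro v; simp [hxj, hS.2 1 (by decide)]
    simp only [Prog.wp, e9, e1]
    obtain ⟨u, hu⟩ : ∃ u, u = (t.setVar 6 (s.arr 9 j)).setVar 8 (s.arr 1 j) := ⟨_, rfl⟩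
    rw [← hu]
    have hSu : Same [6, 8, 10] [13] s u := by
      rw [hu]; exact (hS.setVar (by decide)).setVar (by decide)
    have u6 : u.var 6 = s.arr 9 j := by simp [hu]
    have u8 : u.var 8 = s.arr 1 j := by simp [hu]
    have u10 : u.var 10 = j := by simp [hu, hxj]
    have u13 : u.arr 13 = t.arr 13 := by simp [hu]
    have u0 : u.var 0 = nA := (hSu.1 0 (by decide)).trans hA
    have hb : ∀ a ≤ nA, u.arr 8 a = a * nB := by rw [hSu.2 8 (by decide)]; exact hbase
    have m11 : u.matrix nB 11 = s.matrix nB 11 := by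
      funext a b; simp only [Store.matrix, hSu.2 11 (by decide)]
    have m12 : u.matrix nB 12 = s.matrix nB 12 := by
      funext a b; simp only [Store.matrix, hSu.2 12 (by decide)]
    have hev := eval_absentExpr hb (by rw [hSu.1 2 (by decide)]; exact h2.le)
      (by rw [u6]; exact (hown j hj).le)
    rw [m11, m12, hSu.1 2 (by decide), hSu.1 3 (by decide), u6, u8] at hev
    have hen := eval_entry hb 12 (x := var 6) (y := var 8)
      (by rw [eval_var, u6]; exact (hown j hj).le)
    rw [m12, eval_var, eval_var, u6, u8] at hen
    refine ⟨?_, ?_, fun h => ⟨?_, ⟨hSu.setArr (by decide), ?_⟩, ?_⟩,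
      fun h => ⟨?_, ⟨hSu.setArr (by decide), ?_⟩, ?_⟩⟩
    · rw [← e9]; simp; exact ht.2 _ _
    · rw [← e1 0]; simp; exact ht.2 _ _
    · simp [Expr.eval, u0]; omega
    · rw [hev] at h
      intro e he
      simp only [Store.arr_setArr, if_true, Function.update_apply, eval_var, u10, u13]
      split_ifs with hej
      · rw [hej]
        simp [Expr.eval, u0, h]
      · exact h1 e (by omega)
    · simp [u10]
    · rw [hen, ← m12]
      have : u.arr 12 = t.arr 12 := by simp [hu]
      simp only [Store.matrix, this]
      exact ht.2 _ _
    · have h : ¬ _ := fun h' => (hev.2 h') h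
      intro e he
      simp only [Store.arr_setArr, if_true, Function.update_apply, eval_var, u10, u13]
      split_ifs with hej
      · rw [hej]
        simp [hen, h]
      · exact h1 e (by omega)
    · simp [u10]
  · exact ⟨Same.refl _ _ _, by simp⟩
  · simp only [rankProg, Prog.forLoop, Prog.flatCost, entry, cell, Expr.cost]
    generalize absentExpr.cost = c
    simp only [Nat.add_mul, Nat.mul_add]
    simp [Expr.lt, Expr.cost]
    ring_nf
    omega

end StrongStable

/-! ### Writing the matching and testing it for blocking edges -/

namespace StrongStable

open StrongStable.Expr StrongStable.Prog

variable {V : ℕ}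

/-- Arrays 6 and 7: the partners of the men and of the women, increased by one, the pair in the
registers 2 and 3 included. -/
def outProg : Prog :=
  .seq (.forLoop 10 (var 1) <|
    .cond (load 16 (var 10))
      (.seq (.store 6 (load 9 (pred (load 16 (var 10)))) (succ (var 10)))
        (.store 7 (var 10) (succ (load 9 (pred (load 16 (var 10)))))))
      .skip) <|
  .seq (.store 6 (var 2) (succ (var 3))) <| .seq (.store 7 (var 3) (succ (var 2))) <|
  .assign 4 (const 1)

/-- By `hinj` no man is entered twice, and by `hnm` and `hnw` the final pair `(m, w)` overwrites
nothing; so the two tables are inverse to each other. -/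
theorem runs_out {k nA nB m w : ℕ} (hk : outProg.Light k = true) {s : Store} (hs : s.Bdd V)
    (hV : nA + nB + 2 ≤ V) (hB : s.var 1 = nB) (hm : s.var 2 = m) (hw : s.var 3 = w)
    (hmA : m < nA) (hwB : w < nB) (h6 : ∀ a, s.arr 6 a = 0) (h7 : ∀ b, s.arr 7 b = 0)
    (hown : ∀ b < nB, s.arr 16 b ≠ 0 → s.arr 9 (s.arr 16 b - 1) < nA)
    (hinj : ∀ b < nB, ∀ b' < nB, s.arr 16 b ≠ 0 → s.arr 16 b' ≠ 0 →
      s.arr 9 (s.arr 16 b - 1) = s.arr 9 (s.arr 16 b' - 1) → b = b')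
    (hnm : ∀ b < nB, s.arr 16 b ≠ 0 → s.arr 9 (s.arr 16 b - 1) ≠ m) (hnw : s.arr 16 w = 0) :
    Runs k V outProg s ((nB + 2) * 80)
      (fun s' => Same [4, 10] [6, 7] s s' ∧ s'.var 4 = 1 ∧
        (∀ a b, s'.arr 6 a = b + 1 ↔ (a = m ∧ b = w) ∨
          (b < nB ∧ s.arr 16 b ≠ 0 ∧ s.arr 9 (s.arr 16 b - 1) = a)) ∧
        (∀ a b, s'.arr 7 b = a + 1 ↔ (a = m ∧ b = w) ∨
          (b < nB ∧ s.arr 16 b ≠ 0 ∧ s.arr 9 (s.arr 16 b - 1) = a))) := by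
  have hV1 : 1 ≤ V := by omega
  have hk' := hk
  simp only [outProg, Prog.Light, Bool.and_eq_true, decide_eq_true_eq] at hk'
  refine Runs.mono (Runs.seq (Runs.forLoop hV1 (k := k) (by simpa only using hk'.1) nB (by omega)
    (fun j t => Same [4, 10] [6, 7] s t ∧
        (∀ a b, t.arr 6 a = b + 1 ↔
          (b < j ∧ s.arr 16 b ≠ 0 ∧ s.arr 9 (s.arr 16 b - 1) = a)) ∧
        (∀ a b, t.arr 7 b = a + 1 ↔
          (b < j ∧ s.arr 16 b ≠ 0 ∧ s.arr 9 (s.arr 16 b - 1) = a))) ?_ ?_ ?_ hs ?_)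
    fun s₁ hs₁ h₁ => Runs.of_wp hV1
      (by simpa only [Prog.Light, Bool.and_eq_true, decide_eq_true_eq] using hk'.2)
      (Q := fun s' => Same [4, 10] [6, 7] s s' ∧ s'.var 4 = 1 ∧
        (∀ a b, s'.arr 6 a = b + 1 ↔ (a = m ∧ b = w) ∨
          (b < nB ∧ s.arr 16 b ≠ 0 ∧ s.arr 9 (s.arr 16 b - 1) = a)) ∧
        (∀ a b, s'.arr 7 b = a + 1 ↔ (a = m ∧ b = w) ∨
          (b < nB ∧ s.arr 16 b ≠ 0 ∧ s.arr 9 (s.arr 16 b - 1) = a))) hs₁ ?_)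
    ?_ fun _ _ h => h
  · rintro j t - ⟨hS, -⟩ -
    exact (hS.1 1 (by decide)).trans hB
  · rintro j t v ⟨hS, h⟩
    exact ⟨hS.setVar (by decide), h⟩
  · rintro j t ht hj ⟨hS, h1, h2⟩ hx
    have e16 := hS.2 16 (by decide)
    have e9 := hS.2 9 (by decide)
    simp only [Prog.wp]
    refine ⟨fun hN => ?_, fun hN => ?_⟩
    all_goals simp only [eval_load, eval_var, hx, e16, ne_eq] at hN
    · have ho := hown j hj hN
      refine ⟨?_, ?_, ⟨hS.setArr (by decide) |>.setArr (by decide), fun a b => ?_,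
        fun a b => ?_⟩, ?_⟩
      · simp [hx]; omega
      · simp [hx, e16, e9]; omega
      · simp [hx, e16, e9, Function.update_apply]
        have := h1 a b
        have := hinj j hj b
        grind
      · simp [hx, e16, e9, Function.update_apply]
        have := h2 a b
        grind
      · simp [hx]
    · refine ⟨⟨hS, fun a b => ?_, fun a b => ?_⟩, hx⟩
      · rw [h1 a b]
        grind
      · rw [h2 a b]
        grind
  · exact ⟨Same.refl _ _ _, by simp [h6], by simp [h7]⟩
  · obtain ⟨hS, h1, h2⟩ := h₁
    have e2 : s₁.var 2 = m := (hS.1 2 (by decide)).trans hm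
    have e3 : s₁.var 3 = w := (hS.1 3 (by decide)).trans hw
    simp only [Prog.wp]
    refine ⟨?_, ?_, hV1, hS.setArr (by decide) |>.setArr (by decide) |>.setVar (by decide), ?_,
      fun a b => ?_, fun a b => ?_⟩
    · simp [e3]; omega
    · simp [e2]; omega
    · simp
    · simp [e2, e3, Function.update_apply]
      have := h1 a b
      have := hnm b
      grind
    · simp [e2, e3, Function.update_apply]
      have := h2 a b
      grind
  · simp [Prog.flatCost, Expr.succ, Expr.pred, Expr.cost]
    omega

/-- The edge `(a, b)` blocks the matching given by the partner tables `μ` and `ν`. -/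
def TableBlocks (α β : ℕ → ℕ → ℕ) (μ ν : ℕ → ℕ) (a b : ℕ) : Prop :=
  -- Strict preference implies weak preference, so it is enough that both endpoints do not lose and
  -- one of them gains.
  μ a ≠ b + 1 ∧ (μ a = 0 ∨ α a b ≤ α a (μ a - 1)) ∧ (ν b = 0 ∨ β a b ≤ β (ν b - 1) b) ∧
    ((μ a = 0 ∨ α a b < α a (μ a - 1)) ∨ (ν b = 0 ∨ β a b < β (ν b - 1) b))

def blocksExpr : Expr :=
  let x := var 6
  let y := var 8
  let p := load 6 x
  let q := load 7 y
  let A := entry 11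
  let B := entry 12
  .and (.not (.eq p (.succ y))) <|
  .and (.add (.not p) (.le (A x y) (A x (.pred p)))) <|
  .and (.add (.not q) (.le (B x y) (B (.pred q) y))) <|
  .add (.add (.not p) (.lt (A x y) (A x (.pred p)))) (.add (.not q) (.lt (B x y) (B (.pred q) y)))

theorem eval_blocksExpr {s : Store} {nA nB : ℕ} (hbase : ∀ a ≤ nA, s.arr 8 a = a * nB)
    (h6 : s.var 6 ≤ nA) (h7 : s.arr 7 (s.var 8) - 1 ≤ nA) :
    blocksExpr.eval s ≠ 0 ↔ TableBlocks (s.matrix nB 11) (s.matrix nB 12) (s.arr 6) (s.arr 7)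
      (s.var 6) (s.var 8) := by
  have e6 := fun r y => eval_entry hbase r (x := var 6) (y := y) h6
  have eq := fun r y => eval_entry hbase r (x := .pred (load 7 (var 8))) (y := y) h7
  simp only [eval_var, eval_load, eval_pred] at e6 eq
  simp only [blocksExpr, TableBlocks, ne_eq, eval_add_eq_zero, eval_eq_eq_zero, eval_and_eq_zero,
    eval_le_eq_zero, eval_lt_eq_zero, eval_not_eq_zero, eval_var, eval_succ, eval_load, eval_pred,
    e6, eq]
  simp only [not_and_or, not_or, not_not, not_le, not_lt]

/-- Register 4 is cleared if an edge blocks. -/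
def checkProg : Prog :=
  .forLoop 10 (load 0 (var 0)) <|
    .seq (.assign 6 (load 9 (var 10))) <| .seq (.assign 8 (load 1 (var 10))) <|
    .cond blocksExpr (.assign 4 (const 0)) .skip

theorem runs_check {k nA nB mm : ℕ} (hk : checkProg.Light k = true) {s : Store} (hs : s.Bdd V)
    (hV : nA + mm + 2 ≤ V) (hA : s.var 0 = nA) (hm : s.arr 0 nA = mm)
    (hbase : ∀ a ≤ nA, s.arr 8 a = a * nB) (hown : ∀ e < mm, s.arr 9 e < nA)
    (h7 : ∀ b, s.arr 7 b ≤ nA) (h4 : s.var 4 = 1) :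
    Runs k V checkProg s ((mm + 2) * (checkProg.flatCost + blocksExpr.cost + 100))
      (fun s' => Same [4, 6, 8, 10] [] s s' ∧
        ((s'.var 4 = 0 ∧ ∃ e < mm, TableBlocks (s.matrix nB 11) (s.matrix nB 12) (s.arr 6)
          (s.arr 7) (s.arr 9 e) (s.arr 1 e)) ∨
        (s'.var 4 = 1 ∧ ∀ e < mm, ¬ TableBlocks (s.matrix nB 11) (s.matrix nB 12) (s.arr 6)
          (s.arr 7) (s.arr 9 e) (s.arr 1 e)))) := by
  have hV1 : 1 ≤ V := by omega
  refine Runs.mono (Runs.forLoop hV1 hk mm (by omega)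
    (fun j t => Same [4, 6, 8, 10] [] s t ∧
        ((t.var 4 = 0 ∧ ∃ e < j, TableBlocks (s.matrix nB 11) (s.matrix nB 12) (s.arr 6)
          (s.arr 7) (s.arr 9 e) (s.arr 1 e)) ∨
        (t.var 4 = 1 ∧ ∀ e < j, ¬ TableBlocks (s.matrix nB 11) (s.matrix nB 12) (s.arr 6)
          (s.arr 7) (s.arr 9 e) (s.arr 1 e)))) ?_ ?_ ?_ hs ?_) ?_ ?_
  · rintro j t - ⟨hS, -⟩ -
    simp [hS.1 0 (by decide), hS.2 0 (by decide), hA, hm]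
  · rintro j t v ⟨hS, h⟩
    exact ⟨hS.setVar (by decide), by simpa using h⟩
  · rintro j t ht hj ⟨hS, h1⟩ hxj
    have e9 : (load 9 (var 10)).eval t = s.arr 9 j := by simp [hxj, hS.2 9 (by decide)]
    have e1 : ∀ v, (load 1 (var 10)).eval (t.setVar 6 v) = s.arr 1 j := by
      intro v; simp [hxj, hS.2 1 (by decide)]
    simp only [Prog.wp, e9, e1]
    obtain ⟨u, hu⟩ : ∃ u, u = (t.setVar 6 (s.arr 9 j)).setVar 8 (s.arr 1 j) := ⟨_, rfl⟩
    rw [← hu]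
    have hSu : Same [4, 6, 8, 10] [] s u := by
      rw [hu]; exact (hS.setVar (by decide)).setVar (by decide)
    have u6 : u.var 6 = s.arr 9 j := by simp [hu]
    have u8 : u.var 8 = s.arr 1 j := by simp [hu]
    have u10 : u.var 10 = j := by simp [hu, hxj]
    have u4 : u.var 4 = t.var 4 := by simp [hu]
    have hb : ∀ a ≤ nA, u.arr 8 a = a * nB := by rw [hSu.2 8 (by decide)]; exact hbase
    have m11 : u.matrix nB 11 = s.matrix nB 11 := by
      funext a b; simp only [Store.matrix, hSu.2 11 (by decide)]
    have m12 : u.matrix nB 12 = s.matrix nB 12 := by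
      funext a b; simp only [Store.matrix, hSu.2 12 (by decide)]
    have hev := eval_blocksExpr hb (by rw [u6]; exact (hown j hj).le)
      (by rw [hSu.2 7 (by decide)]; exact (Nat.sub_le _ _).trans (h7 _))
    rw [m11, m12, hSu.2 6 (by decide), hSu.2 7 (by decide), u6, u8] at hev
    refine ⟨?_, ?_, fun h => ⟨Nat.zero_le _, ⟨hSu.setVar (by decide), ?_⟩, ?_⟩,
      fun h => ⟨⟨hSu, ?_⟩, u10⟩⟩
    · rw [← e9]; simp; exact ht.2 _ _
    · rw [← e1 0]; simp; exact ht.2 _ _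
    · rw [hev] at h
      exact Or.inl ⟨by simp, j, by omega, h⟩
    · simp [u10]
    · have h : ¬ _ := fun h' => (hev.2 h') h
      rw [u4]
      rcases h1 with ⟨h2, e, he, h3⟩ | ⟨h2, h3⟩
      · exact Or.inl ⟨h2, e, by omega, h3⟩
      · refine Or.inr ⟨h2, fun e he => ?_⟩
        by_cases hej : e = j
        · rw [hej]; exact h
        · exact h3 e (by omega)
  · exact ⟨Same.refl _ _ _, Or.inr ⟨h4, by simp⟩⟩
  · simp only [checkProg, Prog.forLoop, Prog.flatCost, Expr.cost]
    generalize blocksExpr.cost = c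
    simp only [Nat.add_mul, Nat.mul_add]
    simp [Expr.lt, Expr.cost]
    ring_nf
    omega
  · exact fun _ _ h => h

end StrongStable

namespace StrongStable

/-! ### Preference lists as arrays -/

section Lists

variable {α β : Type*}

/-- The tie numbers of the entries of a list of ties, the numbers beginning with `n + 1`. -/
def tieList (n : ℕ) (L : List (List α)) : List ℕ :=
  (L.zipIdx n).flatMap fun T => T.1.map fun _ => T.2 + 1

theorem tieList_cons (n : ℕ) (T : List α) (L : List (List α)) :
    tieList n (T :: L) = T.map (fun _ => n + 1) ++ tieList (n + 1) L := by
  simp [tieList, List.zipIdx_cons]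

theorem length_tieList (n : ℕ) (L : List (List α)) : (tieList n L).length = L.flatten.length := by
  induction L generalizing n with
  | nil => rfl
  | cons T L ih => simp [tieList_cons, ih]

theorem lt_of_mem_tieList {n t : ℕ} {L : List (List α)} (h : t ∈ tieList n L) : n < t := by
  induction L generalizing n with
  | nil => simp [tieList] at h
  | cons T L ih =>
    rw [tieList_cons, List.mem_append] at h
    rcases h with h | h
    · simp only [List.mem_map] at h
      obtain ⟨_, _, rfl⟩ := h
      omega
    · have := ih h; omega

theorem pairwise_tieList (n : ℕ) (L : List (List α)) : (tieList n L).Pairwise (· ≤ ·) := by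
  induction L generalizing n with
  | nil => exact List.Pairwise.nil
  | cons T L ih =>
    rw [tieList_cons, List.pairwise_append]
    refine ⟨?_, ih _, ?_⟩
    · rw [List.pairwise_map]
      exact List.pairwise_iff_getElem.2 fun _ _ _ _ _ => le_rfl
    · intro x hx y hy
      simp only [List.mem_map] at hx
      obtain ⟨_, _, rfl⟩ := hx
      exact (lt_of_mem_tieList hy).le

theorem getElem?_tieList [DecidableEq α] (n : ℕ) (L : List (List α)) (hL : L.flatten.Nodup) (j : ℕ)
    (hj : j < L.flatten.length) :
    (tieList n L)[j]? = some (n + L.findIdx (fun T => decide (L.flatten[j] ∈ T)) + 1) := by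
  induction L generalizing n j with
  | nil => simp at hj
  | cons T L ih =>
    rw [tieList_cons]
    simp only [List.flatten_cons, List.length_append] at hj
    rw [List.flatten_cons, List.nodup_append] at hL
    by_cases hjT : j < T.length
    · rw [List.getElem?_append_left (by simpa using hjT)]
      simp [hjT, List.findIdx_cons, List.getElem_append_left hjT]
    · rw [List.getElem?_append_right (by simpa using hjT), List.length_map,
        ih (n + 1) hL.2.1 _ (by omega)]
      have h1 : (T :: L).flatten[j]'(by rw [List.flatten_cons, List.length_append]; omega) =
          L.flatten[j - T.length]'(by omega) := by
        simp [List.getElem_append_right (not_lt.1 hjT)]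
      have h2 : L.flatten[j - T.length]'(by omega) ∉ T := fun h =>
        hL.2.2 _ h _ (List.getElem_mem _) rfl
      simp only [h1]
      rw [List.findIdx_cons]
      simp [h2]
      omega

theorem length_le_length_flatten {L : List (List α)} (hL : [] ∉ L) :
    L.length ≤ L.flatten.length := by
  induction L with
  | nil => simp
  | cons T L ih =>
    simp only [List.mem_cons, not_or] at hL
    have := ih hL.2
    have h1 : 0 < T.length := List.length_pos_of_ne_nil (Ne.symm hL.1)
    simp only [List.flatten_cons, List.length_append, List.length_cons]
    omega

theorem getElem?_flatMap_finRange {k : ℕ} (g : Fin k → List β) (a : Fin k) {j : ℕ}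
    (hj : j < (g a).length) :
    ((List.finRange k).flatMap g)[(((List.finRange k).take a).flatMap g).length + j]? =
      (g a)[j]? := by
  have h1 : List.finRange k = (List.finRange k).take a ++
      a :: (List.finRange k).drop (a + 1) := by
    conv_lhs => rw [← List.take_append_drop a (List.finRange k)]
    rw [List.drop_eq_getElem_cons (by simp)]
    simp
  conv_lhs => rw [h1]
  rw [List.flatMap_append, List.flatMap_cons]
  have h2 : ((List.finRange k).take a ++ a :: (List.finRange k).drop (a + 1)).take a =
      (List.finRange k).take a := by rw [← h1]
  rw [h2, List.getElem?_append_right (by omega), Nat.add_sub_cancel_left,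
    List.getElem?_append_left hj]

theorem length_flatMap_congr {γ : Type*} (l : List γ) (g : γ → List α) (g' : γ → List β)
    (h : ∀ v, (g v).length = (g' v).length) : (l.flatMap g).length = (l.flatMap g').length := by
  simp only [List.length_flatMap, h]

end Lists

section Offsets

variable {k l : ℕ} (L : Fin k → List (List (Fin l)))

theorem offset_zero : offset L 0 = 0 := by simp [offset]

theorem offset_succ (a : Fin k) : offset L (a + 1) = offset L a + (L a).flatten.length := by
  unfold offset
  rw [List.take_succ_eq_append_getElem (by simp)]
  simp

theorem offset_le_succ {a : ℕ} (ha : a < k) : offset L a ≤ offset L (a + 1) := by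
  have := offset_succ L ⟨a, ha⟩
  simp only at this
  omega

theorem offset_mono {a b : ℕ} (hab : a ≤ b) (hb : b ≤ k) : offset L a ≤ offset L b := by
  induction b, hab using Nat.le_induction with
  | base => exact le_rfl
  | succ b _ ih => exact (ih (by omega)).trans (offset_le_succ L hb)

theorem offset_le_last (i : ℕ) : offset L i ≤ offset L k := by
  rcases le_total i k with h | h
  · exact offset_mono L h le_rfl
  · unfold offset
    rw [List.take_of_length_le (by simpa using h), List.take_of_length_le (by simp)]

/-- The owner of a position is determined. -/
theorem owner_unique {a b e : ℕ} (ha : a < k) (hb : b < k) (h1 : offset L a ≤ e)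
    (h2 : e < offset L (a + 1)) (h3 : offset L b ≤ e) (h4 : e < offset L (b + 1)) : a = b := by
  rcases lt_trichotomy a b with h | h | h
  · have := offset_mono L (show a + 1 ≤ b from h) hb.le
    omega
  · exact h
  · have := offset_mono L (show b + 1 ≤ a from h) ha.le
    omega

theorem neighbours_getD (a : Fin k) {j : ℕ} (hj : j < (L a).flatten.length) :
    (neighbours L).getD (offset L a + j) 0 = ((L a).flatten[j]).val := by
  have h1 := getElem?_flatMap_finRange (fun v => (L v).flatten.map Fin.val) a (j := j)
    (by rw [List.length_map]; exact hj)
  rw [length_flatMap_congr _ _ (fun v => (L v).flatten) fun v => List.length_map _] at h1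
  rw [neighbours, List.getD_eq_getElem?_getD, offset, h1, List.getElem?_map,
    List.getElem?_eq_getElem hj]
  rfl

theorem tieNumbers_getElem? (a : Fin k) {j : ℕ} (hj : j < (L a).flatten.length) :
    (tieNumbers L)[offset L a + j]? = (tieList 0 (L a))[j]? := by
  have h1 := getElem?_flatMap_finRange (fun v => tieList 0 (L v)) a (j := j)
    (by simpa [length_tieList] using hj)
  rw [length_flatMap_congr _ _ (fun v => (L v).flatten) (fun v => length_tieList 0 (L v))] at h1
  exact h1

theorem tieNumbers_getD (a : Fin k) (ha : (L a).flatten.Nodup) {j : ℕ}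
    (hj : j < (L a).flatten.length) :
    (tieNumbers L).getD (offset L a + j) 0 =
      (L a).findIdx (fun T => decide ((L a).flatten[j] ∈ T)) + 1 := by
  rw [List.getD_eq_getElem?_getD, tieNumbers_getElem? L a hj, getElem?_tieList 0 _ ha j hj]
  simp

theorem tieNumbers_mono (a : Fin k) {i j : ℕ} (hij : i ≤ j) (hj : j < (L a).flatten.length) :
    (tieNumbers L).getD (offset L a + i) 0 ≤ (tieNumbers L).getD (offset L a + j) 0 := by
  have hl := length_tieList 0 (L a)
  rw [List.getD_eq_getElem?_getD, List.getD_eq_getElem?_getD, tieNumbers_getElem? L a hj,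
    tieNumbers_getElem? L a (by omega), List.getElem?_eq_getElem (by omega),
    List.getElem?_eq_getElem (by omega)]
  simp only [Option.getD_some]
  rcases hij.lt_or_eq with h | h
  · exact List.pairwise_iff_getElem.1 (pairwise_tieList 0 (L a)) i j (by omega) (by omega) h
  · subst h; exact le_rfl

/-- Nonempty disjoint ties are at most as many as there are vertices on the other side. This keeps
the ranks of present edges below the special values `nA + 1` and `nA + 2`. -/
theorem rank_lt (a : Fin k) (ha : (L a).flatten.Nodup) (h0 : [] ∉ L a) {b : Fin l}
    (hb : b ∈ (L a).flatten) : (L a).findIdx (fun T => decide (b ∈ T)) < l := by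
  have h1 : (L a).findIdx (fun T => decide (b ∈ T)) < (L a).length := by
    rw [List.findIdx_lt_length]
    obtain ⟨T, hT, hbT⟩ := List.mem_flatten.1 hb
    exact ⟨T, hT, by simpa using hbT⟩
  have h2 := length_le_length_flatten h0
  have h3 := ha.length_le_card
  rw [Fintype.card_fin] at h3
  omega

/-- The entry at a position, with all its data. -/
theorem position_spec (hnd : ∀ a, (L a).flatten.Nodup) {a e : ℕ} (ha : a < k)
    (h1 : offset L a ≤ e) (h2 : e < offset L (a + 1)) :
    ∃ b : Fin l, (neighbours L).getD e 0 = b ∧ b ∈ (L ⟨a, ha⟩).flatten ∧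
      (tieNumbers L).getD e 0 = (L ⟨a, ha⟩).findIdx (fun T => decide (b ∈ T)) + 1 := by
  have h3 := offset_succ L ⟨a, ha⟩
  simp only at h3
  have h4 : e - offset L a < (L ⟨a, ha⟩).flatten.length := by omega
  have h5 := neighbours_getD L ⟨a, ha⟩ h4
  have h6 := tieNumbers_getD L ⟨a, ha⟩ (hnd _) h4
  simp only [Nat.add_sub_cancel' h1] at h5 h6
  exact ⟨_, h5, List.getElem_mem _, h6⟩

theorem exists_position {a : Fin k} {b : Fin l} (hb : b ∈ (L a).flatten) :
    ∃ e, offset L a ≤ e ∧ e < offset L (a + 1) ∧ (neighbours L).getD e 0 = b := by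
  obtain ⟨j, hj, hjb⟩ := List.getElem_of_mem hb
  refine ⟨offset L a + j, Nat.le_add_right _ _, ?_, ?_⟩
  · rw [offset_succ]; omega
  · rw [neighbours_getD L a hj, hjb]

theorem position_unique (hnd : ∀ a, (L a).flatten.Nodup) {a e f : ℕ} (ha : a < k)
    (h1 : offset L a ≤ e) (h2 : e < offset L (a + 1)) (h3 : offset L a ≤ f)
    (h4 : f < offset L (a + 1))
    (h : (neighbours L).getD e 0 = (neighbours L).getD f 0) : e = f := by
  have h5 := offset_succ L ⟨a, ha⟩
  simp only at h5
  have h6 := neighbours_getD L ⟨a, ha⟩ (j := e - offset L a) (by omega)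
  have h7 := neighbours_getD L ⟨a, ha⟩ (j := f - offset L a) (by omega)
  simp only [Nat.add_sub_cancel' h1] at h6
  simp only [Nat.add_sub_cancel' h3] at h7
  rw [h6, h7, Fin.val_inj, (hnd _).getElem_inj_iff] at h
  omega

theorem tie_mono {a e f : ℕ} (ha : a < k) (h1 : offset L a ≤ e) (hef : e ≤ f)
    (h4 : f < offset L (a + 1)) : (tieNumbers L).getD e 0 ≤ (tieNumbers L).getD f 0 := by
  have h5 := offset_succ L ⟨a, ha⟩
  simp only at h5
  have h6 := tieNumbers_mono L ⟨a, ha⟩ (i := e - offset L a) (j := f - offset L a) (by omega)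
    (by omega)
  simp only [Nat.add_sub_cancel' h1, Nat.add_sub_cancel' (h1.trans hef)] at h6
  exact h6

/-- The total length of the lists is the number of pairs. -/
theorem offset_last (hnd : ∀ a, (L a).flatten.Nodup) :
    offset L k = {e : Fin k × Fin l | e.2 ∈ (L e.1).flatten}.ncard := by
  have h1 : {e : Fin k × Fin l | e.2 ∈ (L e.1).flatten} =
      ((Finset.univ.sigma fun a => (L a).flatten.toFinset).map
        ⟨fun x : (_ : Fin k) × Fin l => (x.1, x.2), by
          rintro ⟨a, b⟩ ⟨c, d⟩ h; simpa using h⟩ : Finset (Fin k × Fin l)) := by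
    ext ⟨a, b⟩
    simp only [Set.mem_ofPred_eq, Finset.coe_map, Set.mem_image, Finset.mem_coe, Finset.mem_sigma,
      Finset.mem_univ, true_and, List.mem_toFinset]
    exact ⟨fun h => ⟨⟨a, b⟩, h, rfl⟩, by rintro ⟨⟨c, d⟩, h, h'⟩; cases h'; exact h⟩
  rw [h1, Set.ncard_coe_finset, Finset.card_map, Finset.card_sigma]
  have h2 : ∀ n (hn : n ≤ k), offset L n =
      ∑ i : Fin n, (L ⟨i, i.2.trans_le hn⟩).flatten.toFinset.card := by
    intro n
    induction n with
    | zero => simp [offset_zero]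
    | succ n ih =>
      intro hn
      rw [offset_succ L ⟨n, hn⟩, ih (by omega), Fin.sum_univ_castSucc,
        List.toFinset_card_of_nodup (hnd _)]
      rfl
  exact h2 k le_rfl

end Offsets

end StrongStable

namespace StrongStable

/-! ### Positions and edges -/

namespace EdgeList

/-- The initial cap `nA + 1` promises nothing, so `valid_c` is vacuous, and no edge has been
inspected. -/
theorem inv_initial (I : EdgeList) {σ : State} (hc : ∀ b < I.nB, σ.c b = I.nA + 1)
    (hq : ∀ b < I.nB, σ.q b = 1) (hN : ∀ b, σ.N b = 0) (hst : ∀ a < I.nA, σ.st a = a)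
    (hs : ∀ a < I.nA, σ.s a = I.off a) (hl : ∀ a, σ.l a = 0) (hi : ∀ a < I.nA, σ.i a = I.off a)
    (hsp : σ.sp = I.nA) : I.Inv σ where
  s_rng a ha := by
    rw [hs a ha]
    exact ⟨le_rfl, I.off_le a ha⟩
  i_rng a ha h := by
    rw [hs a ha] at h ⊢
    rw [hi a ha, hl a]
    exact ⟨le_rfl, (I.te_gt _ (I.own_eq a ha _ le_rfl h).1).1.le, Nat.zero_le _⟩
  exhausted a ha _ := ⟨hl a, by rw [hi a ha, hs a ha]⟩
  c_le b hb := (hc b hb).le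
  q_rng b hb := by rw [hq b hb]; omega
  dead e he h := by
    rw [hs _ (I.own_lt e he)] at h
    have := I.own_seg e he
    omega
  passed e he _ h := by
    rw [hl, hi _ (I.own_lt e he)] at h
    have := I.own_seg e he
    omega
  price e he _ _ := by
    rw [hl, hi _ (I.own_lt e he), hq _ (I.nb_lt e he)]
    omega
  mate b _ e h := by rw [hN] at h; omega
  priced b hb h := by rw [hq b hb] at h; omega
  st_lt k hk := by rw [hsp] at hk; rwa [hst k hk]
  st_inj j hj k hk h := by
    rw [hsp] at hj hk
    rwa [hst j hj, hst k hk] at h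
  st_free k _ b _ e h := by rw [hN] at h; omega
  cover a ha := Or.inl ⟨a, by rwa [hsp], hst a ha⟩
  valid_s M hM e he := by
    rw [hs _ (I.own_lt e (hM.lt e he))]
    exact (I.own_seg e (hM.lt e he)).1
  valid_c M _ b hb h := by rw [hc b hb] at h; omega

theorem sum_off_le (I : EdgeList) {k : ℕ} (hk : k ≤ I.nA) :
    ∑ a ∈ Finset.range k, (I.off (a + 1) - I.off a) ≤ I.off k := by
  induction k with
  | zero => simp
  | succ k ih =>
    rw [Finset.sum_range_succ]
    have := I.off_le k hk
    have := ih (by omega)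
    omega

theorem measure_initial_le (I : EdgeList) {σ : State} (hs : ∀ a < I.nA, σ.s a = I.off a) :
    I.measure σ ≤ 4 * ((I.nB + 2) * I.mm) + σ.sp := by
  have h1 : ∑ a ∈ Finset.range I.nA, I.work σ a ≤
      2 * (I.nB + 2) * ∑ a ∈ Finset.range I.nA, (I.off (a + 1) - I.off a) := by
    rw [Finset.mul_sum]
    refine Finset.sum_le_sum fun a ha => ?_
    rw [work, hs a (Finset.mem_range.1 ha)]
    exact Nat.sub_le _ _
  have h2 := Nat.mul_le_mul_left (2 * (I.nB + 2)) (I.sum_off_le le_rfl)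
  rw [I.off_last] at h2
  rw [measure]
  have h3 : 2 * (I.nB + 2) * I.mm = 2 * ((I.nB + 2) * I.mm) := by ring
  omega

variable {nA nB : ℕ}

/-- The positions of the pairs in `M`. -/
def positions (I : EdgeList) (M : Set (Fin nA × Fin nB)) : Set ℕ :=
  {e | e < I.mm ∧ I.R e ≤ I.nA ∧ ∃ p ∈ M, I.own e = p.1 ∧ I.nb e = p.2}

/-- The pairs at the positions in `S`. -/
def pairs (I : EdgeList) (nA nB : ℕ) (S : Set ℕ) : Set (Fin nA × Fin nB) :=
  {p | ∃ e ∈ S, I.own e = p.1 ∧ I.nb e = p.2}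

/-- The positions that are not absent are those of the edges of `H`. -/
structure Represents (I : EdgeList) (H : Market (Fin nA) (Fin nB)) : Prop where
  edge : ∀ e < I.mm, I.R e ≤ I.nA → ∃ a b, (a, b) ∈ H.E ∧ I.own e = a ∧ I.nb e = b ∧
    I.tn e = H.rankA a b + 1 ∧ I.R e = H.rankB b a + 1
  pos : ∀ a b, (a, b) ∈ H.E → ∃ e < I.mm, I.R e ≤ I.nA ∧ I.own e = a ∧ I.nb e = b ∧
    I.tn e = H.rankA a b + 1 ∧ I.R e = H.rankB b a + 1
  inj : ∀ e < I.mm, ∀ f < I.mm, I.own e = I.own f → I.nb e = I.nb f → e = f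

variable {I : EdgeList} {H : Market (Fin nA) (Fin nB)}

/-- Together with `Represents.stable_pairs` this carries strongly stable matchings to sets of
positions and back; absent positions belong to no edge. -/
theorem Represents.stable_positions (h : I.Represents H) {M : Set (Fin nA × Fin nB)}
    (hM : M ∈ H.stableSet) : I.Stable (I.positions M) := by
  obtain ⟨⟨hE, hinj⟩, hbl⟩ := hM
  have hmem : ∀ {a b}, (a, b) ∈ M → ∃ f ∈ I.positions M, I.own f = a ∧ I.nb f = b ∧
      I.tn f = H.rankA a b + 1 ∧ I.R f = H.rankB b a + 1 := by
    intro a b hab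
    obtain ⟨f, hf, hR, h1, h2, h3⟩ := h.pos a b (hE hab)
    exact ⟨f, ⟨hf, hR, _, hab, h1, h2⟩, h1, h2, h3⟩
  have hblock : ∀ e < I.mm, I.R e ≤ I.nA → e ∉ I.positions M → ∃ a b, (a, b) ∈ H.E ∧
      I.own e = a ∧ I.nb e = b ∧ I.tn e = H.rankA a b + 1 ∧ I.R e = H.rankB b a + 1 ∧
      ¬ (H.ManStrict M a b ∧ H.WomanWeak M b a) ∧ ¬ (H.WomanStrict M b a ∧ H.ManWeak M a b) := by
    intro e he hR hnot
    obtain ⟨a, b, hab, h1, h2, h3, h4⟩ := h.edge e he hR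
    have h5 := hbl a b
    have h6 : (a, b) ∉ M := fun h6 => hnot ⟨he, hR, _, h6, h1, h2⟩
    refine ⟨a, b, hab, h1, h2, h3, h4, fun h7 => h5 ⟨hab, h6, Or.inl h7⟩,
      fun h7 => h5 ⟨hab, h6, Or.inr h7⟩⟩
  refine ⟨fun e he => he.1, fun e he => he.2.1, ?_, ?_, ?_, ?_⟩
  · rintro e ⟨he, -, p, hp, h1, h2⟩ f ⟨hf, -, q, hq, h3, h4⟩ hef
    have hpq := hinj p hp q hq (Or.inl (Fin.ext (by omega)))
    subst hpq
    exact h.inj e he f hf hef (by omega)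
  · rintro e ⟨he, -, p, hp, h1, h2⟩ f ⟨hf, -, q, hq, h3, h4⟩ hef
    have hpq := hinj p hp q hq (Or.inr (Fin.ext (by omega)))
    subst hpq
    exact h.inj e he f hf (by omega) hef
  · intro e he hR hnot hf
    obtain ⟨a, b, hab, h1, h2, h3, h4, h5, -⟩ := hblock e he hR hnot
    by_contra hcon
    push Not at hcon
    refine h5 ⟨fun b' hb' => ?_, fun a' ha' => ?_⟩
    · obtain ⟨f, hfM, h6, -, h7, -⟩ := hmem hb'
      have := hf f hfM (by omega)
      omega
    · obtain ⟨f, hfM, -, h6, -, h7⟩ := hmem ha'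
      have := hcon f hfM (by omega)
      omega
  · intro e he hR hnot hf
    obtain ⟨a, b, hab, h1, h2, h3, h4, -, h5⟩ := hblock e he hR hnot
    by_contra hcon
    push Not at hcon
    refine h5 ⟨fun a' ha' => ?_, fun b' hb' => ?_⟩
    · obtain ⟨f, hfM, -, h6, -, h7⟩ := hmem ha'
      have := hf f hfM (by omega)
      omega
    · obtain ⟨f, hfM, h6, -, h7, -⟩ := hmem hb'
      have := hcon f hfM (by omega)
      omega

theorem Represents.stable_pairs (h : I.Represents H) {S : Set ℕ} (hS : I.Stable S) :
    I.pairs nA nB S ∈ H.stableSet := by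
  have hmem : ∀ e ∈ S, ∃ a b, (a, b) ∈ I.pairs nA nB S ∧ (a, b) ∈ H.E ∧ I.own e = a ∧
      I.nb e = b ∧ I.tn e = H.rankA a b + 1 ∧ I.R e = H.rankB b a + 1 := by
    intro e he
    obtain ⟨a, b, hab, h1, h2, h3⟩ := h.edge e (hS.lt e he) (hS.present e he)
    exact ⟨a, b, ⟨e, he, h1, h2⟩, hab, h1, h2, h3⟩
  refine ⟨⟨?_, ?_⟩, ?_⟩
  · rintro ⟨x, y⟩ ⟨e, he, h1, h2⟩
    obtain ⟨a, b, -, hab, h3, h4, -⟩ := hmem e he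
    obtain rfl : x = a := Fin.ext (by simp only at h1; omega)
    obtain rfl : y = b := Fin.ext (by simp only at h2; omega)
    exact hab
  · rintro p ⟨e, he, h1, h2⟩ q ⟨f, hf, h3, h4⟩ hpq
    have hef : e = f := by
      rcases hpq with hpq | hpq
      · exact hS.own_inj e he f hf (by rw [h1, h3, hpq])
      · exact hS.nb_inj e he f hf (by rw [h2, h4, hpq])
    subst hef
    exact Prod.ext (Fin.ext (by omega)) (Fin.ext (by omega))
  · rintro a b ⟨hab, hnot, hb⟩
    obtain ⟨e, he, hR, h1, h2, h3, h4⟩ := h.pos a b hab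
    have heS : e ∉ S := fun heS => hnot ⟨e, heS, h1, h2⟩
    rcases hb with ⟨hm, hw⟩ | ⟨hw, hm⟩
    · obtain ⟨f, hf, h5, h6⟩ := hS.man e he hR heS fun f hf hfe => by
        obtain ⟨a', b', hfM, -, h5, h6, h7, h8⟩ := hmem f hf
        obtain rfl : a' = a := Fin.ext (by omega)
        have := hm b' hfM
        omega
      obtain ⟨a', b', hfM, -, h7, h8, h9, h10⟩ := hmem f hf
      obtain rfl : b' = b := Fin.ext (by omega)
      have := hw a' hfM
      omega
    · obtain ⟨f, hf, h5, h6⟩ := hS.woman e he hR heS fun f hf hfe => by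
        obtain ⟨a', b', hfM, -, h5, h6, h7, h8⟩ := hmem f hf
        obtain rfl : b' = b := Fin.ext (by omega)
        have := hw a' hfM
        omega
      obtain ⟨a', b', hfM, -, h7, h8, h9, h10⟩ := hmem f hf
      obtain rfl : a' = a := Fin.ext (by omega)
      have := hm b' hfM
      omega

variable {G : Market (Fin nA) (Fin nB)} {m : Fin nA} {w : Fin nB} {σ : State}

/-- The computed matching, together with the given edge. -/
def result (I : EdgeList) (σ : State) (m : Fin nA) (w : Fin nB) : Set (Fin nA × Fin nB) :=
  I.pairs nA nB (I.engaged σ) ∪ {(m, w)}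

theorem pairs_engaged_subset (h : I.Inv σ) (hr : I.Represents H) :
    I.pairs nA nB (I.engaged σ) ⊆ H.E := by
  rintro ⟨x, y⟩ ⟨e, he, h1, h2⟩
  obtain ⟨h3, -, -, -, h4, -⟩ := engaged_spec h he
  obtain ⟨a, b, hab, h5, h6, -⟩ := hr.edge e h3 h4
  obtain rfl : x = a := Fin.ext (by simp only at h1; omega)
  obtain rfl : y = b := Fin.ext (by simp only at h2; omega)
  exact hab

theorem isMatching_result (h : I.Inv σ) (hr : I.Represents (G.pruned m w)) (hmw : (m, w) ∈ G.E) :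
    G.IsMatching (I.result σ m w) := by
  have hsub := pairs_engaged_subset h hr
  refine ⟨?_, ?_⟩
  · rintro p (hp | rfl)
    · exact (hsub hp).1
    · exact hmw
  · rintro p (hp | rfl) q (hq | rfl) hpq
    · obtain ⟨e, he, h1, h2⟩ := hp
      obtain ⟨f, hf, h3, h4⟩ := hq
      have hef : e = f := by
        rcases hpq with hpq | hpq
        · obtain ⟨b, hb, hN⟩ := he
          obtain ⟨b', hb', hN'⟩ := hf
          have := mate_own_inj h hb hb' hN hN' (by rw [h1, h3, hpq])
          subst this
          omega
        · have h5 := (engaged_spec h he).2.1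
          have h6 := (engaged_spec h hf).2.1
          rw [h2, hpq, ← h4] at h5
          omega
      subst hef
      exact Prod.ext (Fin.ext (by omega)) (Fin.ext (by omega))
    · have := Market.pruned_ne (hsub hp)
      exact absurd hpq (by simpa using this)
    · have := Market.pruned_ne (hsub hq)
      exact absurd hpq (by simpa [eq_comm] using this)
    · rfl

/-- Strong stability in `G` is what the program tests. It yields strong stability of the engagements
in the pruned graph by `diff_mem_pruned`; optimality there is `engaged_dominates`. -/
theorem isManOptimal_result (h : I.Inv σ) (hsp : σ.sp = 0) (hr : I.Represents (G.pruned m w))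
    (hM : I.result σ m w ∈ G.stableSet) :
    G.IsManOptimal (G.stableSetWith m w) (I.result σ m w) := by
  refine Market.isManOptimal_union ⟨?_, ?_⟩ hM
  · have h1 := Market.diff_mem_pruned (G := G) (m := m) (w := w) ⟨hM, Or.inr rfl⟩
    rwa [result, Set.union_sdiff_right, Set.sdiff_singleton_eq_self] at h1
    intro h2
    exact (Market.pruned_ne (pairs_engaged_subset h hr h2)).1 rfl
  · intro N hN a b hab
    have hS := hr.stable_positions hN
    obtain ⟨e, he, hR, h1, h2, h3, -⟩ := hr.pos a b (hN.1.1 hab)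
    obtain ⟨g, hg, h4, h5⟩ := engaged_dominates h hsp hS (e := e) ⟨he, hR, _, hab, h1, h2⟩
    obtain ⟨h6, -, -, -, h7, -⟩ := engaged_spec h hg
    obtain ⟨a', b', -, h8, h9, h10, -⟩ := hr.edge g h6 h7
    obtain rfl : a' = a := Fin.ext (by omega)
    exact ⟨b', ⟨g, hg, h8, h9⟩, by omega⟩

/-- A strongly stable matching through `(m, w)` would give one of the pruned graph; then the
engagements would be strongly stable there, and adding `(m, w)` would keep this in `G`. -/
theorem stableSetWith_eq_empty (h : I.Inv σ) (hsp : σ.sp = 0) (hr : I.Represents (G.pruned m w))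
    (hM : I.result σ m w ∉ G.stableSet) : G.stableSetWith m w = ∅ := by
  rw [Set.eq_empty_iff_forall_notMem]
  intro M hMem
  have h1 := hr.stable_positions (Market.diff_mem_pruned hMem)
  exact hM (Market.union_mem_stableSet hMem (hr.stable_pairs (engaged_stable h hsp ⟨_, h1⟩)))

end EdgeList

/-! ### The tables -/

section Tables

variable {nA nB : ℕ} {G : Market (Fin nA) (Fin nB)} {α β : ℕ → ℕ → ℕ}

/-- The matrices `α` and `β` hold the ranks, counted from `1`, and `0` for pairs that are no edge. -/
structure Tabulates (G : Market (Fin nA) (Fin nB)) (α β : ℕ → ℕ → ℕ) : Prop where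
  edge : ∀ a b, (a, b) ∈ G.E → α a b = G.rankA a b + 1 ∧ β a b = G.rankB b a + 1
  other : ∀ a b, (a, b) ∉ G.E → α a b = 0 ∧ β a b = 0

theorem Tabulates.absent_iff (h : Tabulates G α β) {m x : Fin nA} {w y : Fin nB}
    (hmw : (m, w) ∈ G.E) (hxy : (x, y) ∈ G.E) : Absent α β m w x y ↔ G.Deleted m w x y := by
  obtain ⟨a1, b1⟩ := h.edge _ _ hmw
  obtain ⟨a2, b2⟩ := h.edge _ _ hxy
  have h3 : ∀ (a : Fin nA) (b : Fin nB), (α a b ≠ 0 ↔ (a, b) ∈ G.E) := by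
    intro a b
    by_cases hab : (a, b) ∈ G.E
    · simp [hab, (h.edge a b hab).1]
    · simp [hab, (h.other a b hab).1]
  simp only [Absent, h3, Market.Deleted, Fin.val_inj]
  constructor
  · rintro (rfl | rfl | ⟨h4, h5⟩ | ⟨h4, h5⟩)
    · rcases lt_trichotomy (G.rankA x w) (G.rankA x y) with h6 | h6 | h6 <;> simp [h6, hxy]
    · rcases lt_trichotomy (G.rankB y m) (G.rankB y x) with h6 | h6 | h6 <;> simp [h6, hxy]
    · obtain ⟨a3, b3⟩ := h.edge _ _ h4
      rw [a3, a2, b3, b1] at h5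
      rcases eq_or_ne (G.rankB w m) (G.rankB w x) with h6 | h6
      · exact Or.inr (Or.inr (Or.inl ⟨h4, h6, Or.inr (by omega)⟩))
      · exact Or.inr (Or.inr (Or.inr (Or.inl ⟨h4, by omega, Or.inr (by omega)⟩)))
    · obtain ⟨a3, b3⟩ := h.edge _ _ h4
      rw [a3, a1, b3, b2] at h5
      rcases eq_or_ne (G.rankA m w) (G.rankA m y) with h6 | h6
      · exact Or.inr (Or.inr (Or.inr (Or.inr (Or.inr (Or.inl ⟨h4, h6, Or.inr (by omega)⟩)))))
      · exact Or.inr (Or.inr (Or.inr (Or.inr (Or.inr (Or.inr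
          ⟨h4, by omega, Or.inr (by omega)⟩)))))
  · rintro (⟨h4, -⟩ | ⟨-, h4⟩ | ⟨h4, h5, h6 | h6⟩ | ⟨h4, h5, h6 | h6⟩ | ⟨-, h4⟩ | ⟨h4, h5, h6 | h6⟩ |
      ⟨h4, h5, h6 | h6⟩)
    · exact Or.inl h4
    · exact Or.inr (Or.inl h4)
    · exact Or.inr (Or.inl h6)
    · obtain ⟨a3, b3⟩ := h.edge _ _ h4
      rw [a3, a2, b3, b1]
      exact Or.inr (Or.inr (Or.inl ⟨h4, by omega, by omega, by omega⟩))
    · exact Or.inr (Or.inl h6)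
    · obtain ⟨a3, b3⟩ := h.edge _ _ h4
      rw [a3, a2, b3, b1]
      exact Or.inr (Or.inr (Or.inl ⟨h4, by omega, by omega, by omega⟩))
    · exact Or.inl h4
    · exact Or.inl h6
    · obtain ⟨a3, b3⟩ := h.edge _ _ h4
      rw [a3, a1, b3, b2]
      exact Or.inr (Or.inr (Or.inr ⟨h4, by omega, by omega, by omega⟩))
    · exact Or.inl h6
    · obtain ⟨a3, b3⟩ := h.edge _ _ h4
      rw [a3, a1, b3, b2]
      exact Or.inr (Or.inr (Or.inr ⟨h4, by omega, by omega, by omega⟩))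

theorem Tabulates.blocks_iff (h : Tabulates G α β) {M : Set (Fin nA × Fin nB)} (hM : G.IsMatching M)
    {μ ν : ℕ → ℕ} (hμ : ∀ (a : Fin nA) k, μ a = k + 1 ↔ ∃ b : Fin nB, k = b ∧ (a, b) ∈ M)
    (hν : ∀ (b : Fin nB) k, ν b = k + 1 ↔ ∃ a : Fin nA, k = a ∧ (a, b) ∈ M) {a : Fin nA} {b : Fin nB}
    (hab : (a, b) ∈ G.E) : TableBlocks α β μ ν a b ↔ G.Blocks M a b := by
  obtain ⟨h1, h2⟩ := h.edge _ _ hab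
  have h3 : μ a ≠ b + 1 ↔ (a, b) ∉ M := by
    rw [ne_eq, hμ]
    refine not_congr ⟨?_, fun h => ⟨b, rfl, h⟩⟩
    rintro ⟨b', hb, h⟩
    rwa [Fin.ext hb]
  have hman : (G.ManStrict M a b ↔ μ a = 0 ∨ α a b < α a (μ a - 1)) ∧
      (G.ManWeak M a b ↔ μ a = 0 ∨ α a b ≤ α a (μ a - 1)) := by
    rcases hk : μ a with _ | k
    · have : ∀ b', (a, b') ∉ M := fun b' hb' => by
        have := (hμ a b').2 ⟨b', rfl, hb'⟩
        omega
      simp [Market.ManStrict, Market.ManWeak, this]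
    · obtain ⟨b', rfl, hb'⟩ := (hμ a k).1 hk
      have hu : ∀ c, (a, c) ∈ M → c = b' := fun c hc =>
        congrArg Prod.snd (hM.2 _ hc _ hb' (Or.inl rfl))
      have h4 := (h.edge _ _ (hM.1 hb')).1
      simp only [Nat.add_sub_cancel, h1, h4, Market.ManStrict, Market.ManWeak]
      refine ⟨⟨fun h5 => ?_, fun h5 c hc => ?_⟩, ⟨fun h5 => ?_, fun h5 c hc => ?_⟩⟩
      · have := h5 b' hb'; omega
      · rw [hu c hc]; omega
      · have := h5 b' hb'; omega
      · rw [hu c hc]; omega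
  have hwoman : (G.WomanStrict M b a ↔ ν b = 0 ∨ β a b < β (ν b - 1) b) ∧
      (G.WomanWeak M b a ↔ ν b = 0 ∨ β a b ≤ β (ν b - 1) b) := by
    rcases hk : ν b with _ | k
    · have : ∀ a', (a', b) ∉ M := fun a' ha' => by
        have := (hν b a').2 ⟨a', rfl, ha'⟩
        omega
      simp [Market.WomanStrict, Market.WomanWeak, this]
    · obtain ⟨a', rfl, ha'⟩ := (hν b k).1 hk
      have hu : ∀ c, (c, b) ∈ M → c = a' := fun c hc =>
        congrArg Prod.fst (hM.2 _ hc _ ha' (Or.inr rfl))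
      have h4 := (h.edge _ _ (hM.1 ha')).2
      simp only [Nat.add_sub_cancel, h2, h4, Market.WomanStrict, Market.WomanWeak]
      refine ⟨⟨fun h5 => ?_, fun h5 c hc => ?_⟩, ⟨fun h5 => ?_, fun h5 c hc => ?_⟩⟩
      · have := h5 a' ha'; omega
      · rw [hu c hc]; omega
      · have := h5 a' ha'; omega
      · rw [hu c hc]; omega
  rw [TableBlocks, Market.Blocks, h3, hman.1, hman.2, hwoman.1, hwoman.2]
  constructor
  · rintro ⟨h4, h5, h6, h7 | h7⟩
    · exact ⟨hab, h4, Or.inl ⟨h7, h6⟩⟩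
    · exact ⟨hab, h4, Or.inr ⟨h7, h5⟩⟩
  · rintro ⟨-, h4, ⟨h5, h6⟩ | ⟨h5, h6⟩⟩
    · exact ⟨h4, h5.imp_right le_of_lt, h6, Or.inl h5⟩
    · exact ⟨h4, h6, h5.imp_right le_of_lt, Or.inr h5⟩

end Tables

end StrongStable

namespace StrongStable

open StrongStable.Expr StrongStable.Prog

/-! ### The positions of the given instance -/

section Layout

variable {k l : ℕ} {L : Fin k → List (List (Fin l))} {own : ℕ → ℕ}

/-- The function `own` gives the owner of every position. -/
def Layout (L : Fin k → List (List (Fin l))) (own : ℕ → ℕ) : Prop :=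
  ∀ e < offset L k, ∃ a < k, own e = a ∧ offset L a ≤ e ∧ e < offset L (a + 1)

theorem Layout.entry (h : Layout L own) (hnd : ∀ a, (L a).flatten.Nodup) {e : ℕ}
    (he : e < offset L k) : ∃ a b, own e = a.val ∧ (neighbours L).getD e 0 = b.val ∧
      b ∈ (L a).flatten ∧
      (tieNumbers L).getD e 0 = (L a).findIdx (fun T => decide (b ∈ T)) + 1 := by
  obtain ⟨a, ha, h1, h2, h3⟩ := h e he
  obtain ⟨b, h4, h5⟩ := position_spec L hnd ha h2 h3
  exact ⟨⟨a, ha⟩, b, h1, h4, h5⟩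

theorem Layout.inj (h : Layout L own) (hnd : ∀ a, (L a).flatten.Nodup) {e f : ℕ}
    (he : e < offset L k) (hf : f < offset L k) (hown : own e = own f)
    (hnb : (neighbours L).getD e 0 = (neighbours L).getD f 0) : e = f := by
  obtain ⟨a, ha, h1, h2, h3⟩ := h e he
  obtain ⟨b, hb, h4, h5, h6⟩ := h f hf
  obtain rfl : a = b := by omega
  exact position_unique L hnd ha h2 h3 h5 h6 hnb

theorem Layout.eq (h : Layout L own) {a e : ℕ} (ha : a < k) (h1 : offset L a ≤ e)
    (h2 : e < offset L (a + 1)) : e < offset L k ∧ own e = a := by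
  have h3 : e < offset L k := h2.trans_le (offset_mono L ha le_rfl)
  obtain ⟨b, hb, h4, h5, h6⟩ := h e h3
  exact ⟨h3, by rw [h4, owner_unique L hb ha h5 h6 h1 h2]⟩

theorem Layout.exists (h : Layout L own) (hnd : ∀ a, (L a).flatten.Nodup) {a : Fin k} {b : Fin l}
    (hb : b ∈ (L a).flatten) : ∃ e < offset L k, own e = a ∧ (neighbours L).getD e 0 = b ∧
      (tieNumbers L).getD e 0 = (L a).findIdx (fun T => decide (b ∈ T)) + 1 := by
  obtain ⟨e, h1, h2, h3⟩ := exists_position L hb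
  obtain ⟨h4, h5⟩ := h.eq a.2 h1 h2
  obtain ⟨b', h6, -, h7⟩ := position_spec L hnd a.2 h1 h2
  obtain rfl : b' = b := Fin.ext (h6.symm.trans h3)
  exact ⟨e, h4, h5, h3, h7⟩

end Layout

namespace PrefLists

variable {nA nB : ℕ} (P : PrefLists nA nB)

theorem length_men_eq : offset P.men nA = P.toMarket.E.ncard := offset_last P.men P.men_nodup

theorem length_women_eq : offset P.women nB = P.toMarket.E.ncard := by
  rw [offset_last P.women P.women_nodup, ← Set.ncard_image_of_injective _ Prod.swap_injective]
  congr 1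
  ext ⟨a, b⟩
  simp [toMarket, P.symm]

theorem ncard_le : P.toMarket.E.ncard ≤ nA * nB := by
  have h := Set.ncard_le_card P.toMarket.E
  simpa using h

theorem rankB_lt {a : Fin nA} {b : Fin nB} (h : (a, b) ∈ P.toMarket.E) :
    P.toMarket.rankB b a < nA :=
  rank_lt P.women b (P.women_nodup b) (P.women_nonempty b) ((P.symm a b).1 h)

/-- The positions in the lists of the men, with given owners and ranks for the women. -/
noncomputable def edgeList (own R : ℕ → ℕ) (hown : Layout P.men own)
    (hR : ∀ e < offset P.men nA, (1 ≤ R e ∧ R e ≤ nA) ∨ R e = nA + 2) : EdgeList where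
  nA := nA
  nB := nB
  mm := offset P.men nA
  off := offset P.men
  nb e := (neighbours P.men).getD e 0
  tn e := (tieNumbers P.men).getD e 0
  own := own
  R := R
  -- The end of the list belongs to this set, so the infimum is attained at the first position
  -- behind the tie.
  te e := sInf {j | e < j ∧ (j = offset P.men (own e + 1) ∨
    (tieNumbers P.men).getD j 0 ≠ (tieNumbers P.men).getD e 0)}
  off_last := rfl
  off_le _ ha := offset_le_succ P.men ha
  own_lt e he := by
    obtain ⟨a, ha, h1, -⟩ := hown e he
    rwa [h1]
  own_eq _ ha _ h1 h2 := hown.eq ha h1 h2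
  own_seg e he := by
    obtain ⟨a, -, rfl, h⟩ := hown e he
    exact h
  nb_lt e he := by
    obtain ⟨a, b, -, h, -⟩ := hown.entry P.men_nodup he
    rw [h]
    exact b.2
  R_spec := hR
  te_gt e he := by
    obtain ⟨a, -, rfl, h1, h2⟩ := hown e he
    exact ⟨(Nat.sInf_mem (s := {j | e < j ∧ (j = offset P.men (own e + 1) ∨
      (tieNumbers P.men).getD j 0 ≠ (tieNumbers P.men).getD e 0)}) ⟨_, h2, Or.inl rfl⟩).1,
      Nat.sInf_le ⟨h2, Or.inl rfl⟩⟩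
  te_spec e he f hef hf := by
    obtain ⟨a, ha, rfl, h1, h2⟩ := hown e he
    set j := sInf {j | e < j ∧ (j = offset P.men (own e + 1) ∨
      (tieNumbers P.men).getD j 0 ≠ (tieNumbers P.men).getD e 0)} with hj
    have hmem : j ∈ {j | e < j ∧ (j = offset P.men (own e + 1) ∨
      (tieNumbers P.men).getD j 0 ≠ (tieNumbers P.men).getD e 0)} :=
      Nat.sInf_mem ⟨_, h2, Or.inl rfl⟩
    obtain ⟨h3, h4⟩ := hmem
    constructor
    · intro h5
      by_contra h6
      have h7 : j ≠ offset P.men (own e + 1) := by omega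
      have h8 := h4.resolve_left h7
      have h9 := tie_mono P.men ha h1 h3.le (show j < _ by omega)
      have h10 := tie_mono P.men ha (show offset P.men (own e) ≤ j by omega) (not_lt.1 h6) hf
      omega
    · intro h5
      by_contra h6
      rcases hef.lt_or_eq with h7 | rfl
      · have := Nat.sInf_le (s := {j | e < j ∧ (j = offset P.men (own e + 1) ∨
          (tieNumbers P.men).getD j 0 ≠ (tieNumbers P.men).getD e 0)}) (m := f) ⟨h7, Or.inr h6⟩
        omega
      · exact h6 rfl
  tn_mono e f hef hf he := by
    obtain ⟨a, ha, h1, h2, h3⟩ := hown f hf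
    obtain ⟨a', ha', h4, h5, h6⟩ := hown e (by omega)
    obtain rfl : a = a' := by omega
    exact tie_mono P.men ha h5 hef h3

variable {P} {α β : ℕ → ℕ → ℕ} {own R : ℕ → ℕ} {m : Fin nA} {w : Fin nB}

/-- The array `R` of the ranks for the women in the pruned graph. -/
def PrunedRank (P : PrefLists nA nB) (α β : ℕ → ℕ → ℕ) (m w : ℕ) (own R : ℕ → ℕ) : Prop :=
  ∀ e < offset P.men nA,
    (Absent α β m w (own e) ((neighbours P.men).getD e 0) → R e = nA + 2) ∧
    (¬ Absent α β m w (own e) ((neighbours P.men).getD e 0) →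
      R e = β (own e) ((neighbours P.men).getD e 0))

theorem PrunedRank.spec (h : PrunedRank P α β m w own R) (ht : Tabulates P.toMarket α β)
    (hown : Layout P.men own) : ∀ e < offset P.men nA, (1 ≤ R e ∧ R e ≤ nA) ∨ R e = nA + 2 := by
  intro e he
  obtain ⟨a, b, h1, h2, h3, -⟩ := hown.entry P.men_nodup he
  obtain ⟨h4, h5⟩ := h e he
  rw [h1, h2] at h4 h5
  by_cases h6 : Absent α β m w a b
  · exact Or.inr (h4 h6)
  · have h7 : (a, b) ∈ P.toMarket.E := h3
    rw [h5 h6, (ht.edge a b h7).2]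
    have := P.rankB_lt h7
    omega

theorem PrunedRank.represents (h : PrunedRank P α β m w own R) (ht : Tabulates P.toMarket α β)
    (hown : Layout P.men own) (hmw : (m, w) ∈ P.toMarket.E) :
    (P.edgeList own R hown (h.spec ht hown)).Represents (P.toMarket.pruned m w) where
  edge e he hR := by
    obtain ⟨a, b, h1, h2, h3, h4⟩ := hown.entry P.men_nodup he
    have h7 : (a, b) ∈ P.toMarket.E := h3
    obtain ⟨h5, h6⟩ := h e he
    rw [h1, h2, ht.absent_iff hmw h7] at h5 h6
    have h8 : ¬ P.toMarket.Deleted m w a b := fun h8 => by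
      have : R e ≤ nA := hR
      have := h5 h8
      omega
    exact ⟨a, b, ⟨h7, h8⟩, h1, h2, h4, (h6 h8).trans (ht.edge a b h7).2⟩
  pos a b hab := by
    obtain ⟨h7, h8⟩ := hab
    obtain ⟨e, he, h1, h2, h4⟩ := hown.exists P.men_nodup (a := a) (b := b) h7
    obtain ⟨-, h6⟩ := h e he
    rw [h1, h2, ht.absent_iff hmw h7] at h6
    have h9 := (h6 h8).trans (ht.edge a b h7).2
    have h10 := P.rankB_lt h7
    exact ⟨e, he, show R e ≤ nA by omega, h1, h2, h4, h9⟩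
  inj e he f hf := hown.inj P.men_nodup he hf

/-- Matrices filled in from the lists of the men and of the women hold the ranks. -/
theorem tabulates {ownW : ℕ → ℕ} (hown : Layout P.men own) (hownW : Layout P.women ownW)
    (h1 : ∀ e < offset P.men nA, α (own e) ((neighbours P.men).getD e 0) =
      (tieNumbers P.men).getD e 0)
    (h2 : ∀ a < nA, ∀ b < nB, (∀ e < offset P.men nA,
      ¬ (own e = a ∧ (neighbours P.men).getD e 0 = b)) → α a b = 0)
    (h3 : ∀ e < offset P.women nB, β ((neighbours P.women).getD e 0) (ownW e) =
      (tieNumbers P.women).getD e 0)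
    (h4 : ∀ a < nA, ∀ b < nB, (∀ e < offset P.women nB,
      ¬ ((neighbours P.women).getD e 0 = a ∧ ownW e = b)) → β a b = 0) :
    Tabulates P.toMarket α β where
  edge a b hab := by
    obtain ⟨e, he, h5, h6, h7⟩ := hown.exists P.men_nodup (a := a) (b := b) hab
    obtain ⟨f, hf, h8, h9, h10⟩ := hownW.exists P.women_nodup ((P.symm a b).1 hab)
    rw [← h5, ← h6, h1 e he, h7]
    refine ⟨rfl, ?_⟩
    rw [h5, h6, ← h8, ← h9, h3 f hf, h10]
    rfl
  other a b hab := by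
    refine ⟨h2 a a.2 b b.2 fun e he hc => hab ?_, h4 a a.2 b b.2 fun e he hc => hab ?_⟩
    · obtain ⟨a', b', h5, h6, h7, -⟩ := hown.entry P.men_nodup he
      obtain rfl : a' = a := Fin.ext (by omega)
      obtain rfl : b' = b := Fin.ext (by omega)
      exact h7
    · obtain ⟨b', a', h5, h6, h7, -⟩ := hownW.entry P.women_nodup he
      obtain rfl : a' = a := Fin.ext (by omega)
      obtain rfl : b' = b := Fin.ext (by omega)
      exact (P.symm _ _).2 h7

theorem tieNumbers_le_length {k l : ℕ} (L : Fin k → List (List (Fin l)))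
    (hnd : ∀ a, (L a).flatten.Nodup) (h0 : ∀ a, [] ∉ L a) (i : ℕ) :
    (tieNumbers L).getD i 0 ≤ l := by
  rw [List.getD_eq_getElem?_getD]
  rcases h : (tieNumbers L)[i]? with _ | t
  · simp
  · have h1 := List.mem_of_getElem? h
    obtain ⟨v, -, h2⟩ := List.mem_flatMap.1 h1
    have h3 : t ∈ tieList 0 (L v) := h2
    obtain ⟨j, hj, hjt⟩ := List.getElem_of_mem h3
    rw [length_tieList] at hj
    have h4 := getElem?_tieList 0 (L v) (hnd v) j hj
    rw [List.getElem?_eq_getElem (by rwa [length_tieList]), hjt] at h4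
    have h5 := rank_lt L v (hnd v) (h0 v) (List.getElem_mem hj)
    simp only [Option.some.injEq] at h4
    simp only [Option.getD_some]
    omega

theorem neighbours_le {k l : ℕ} (L : Fin k → List (List (Fin l))) (i : ℕ) :
    (neighbours L).getD i 0 ≤ l := by
  rw [List.getD_eq_getElem?_getD]
  rcases h : (neighbours L)[i]? with _ | t
  · simp
  · obtain ⟨v, -, h2⟩ := List.mem_flatMap.1 (List.mem_of_getElem? h)
    obtain ⟨b, -, rfl⟩ := List.mem_map.1 h2
    exact b.2.le

theorem initial_bdd (P : PrefLists nA nB) (m : Fin nA) (w : Fin nB) {V : ℕ} (hA : nA ≤ V)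
    (hB : nB ≤ V) (hE : P.toMarket.E.ncard ≤ V) : (initial P m w).Bdd V := by
  constructor
  · intro x
    unfold initial
    dsimp only
    split <;> omega
  · intro r i
    unfold initial
    dsimp only
    split
    · exact (offset_le_last P.men i).trans (P.length_men_eq.trans_le hE)
    · exact (neighbours_le P.men i).trans hB
    · exact (tieNumbers_le_length P.men P.men_nodup P.men_nonempty i).trans hB
    · exact (offset_le_last P.women i).trans (P.length_women_eq.trans_le hE)
    · exact (neighbours_le P.women i).trans hA
    · exact (tieNumbers_le_length P.women P.women_nodup P.women_nonempty i).trans hA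
    · exact Nat.zero_le _

end PrefLists

end StrongStable

namespace StrongStable

open StrongStable.Expr StrongStable.Prog

/-! ### The program -/

/-- The owners, the cursors, the caps, the matrices and the ranks in the pruned graph. -/
def prepareProg : Prog :=
  .seq (ownProg 0 9 0) <| .seq (ownProg 3 10 1) <| .seq menProg <| .seq womenProg <|
  .seq (matrixProg 9 1 2 11) <| .seq (matrixProg 4 10 5 12) rankProg

def mainProg : Prog := .loop (var 5) stepProg

def queryProg : Prog :=
  .seq prepareProg <| .seq mainProg <| .seq outProg checkProg

variable {nA nB V : ℕ} {P : PrefLists nA nB} {m : Fin nA} {w : Fin nB}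

/-- The memory after the preparation. -/
structure Ready (P : PrefLists nA nB) (m : Fin nA) (w : Fin nB) (s : Store) : Prop where
  same : Same [5, 6, 8, 10] [8, 9, 10, 11, 12, 13, 14, 15, 17, 18, 20] (initial P m w) s
  own : Layout P.men (s.arr 9)
  base : ∀ a ≤ nA, s.arr 8 a = a * nB
  table : Tabulates P.toMarket (s.matrix nB 11) (s.matrix nB 12)
  rank : P.PrunedRank (s.matrix nB 11) (s.matrix nB 12) m w (s.arr 9) (s.arr 13)
  cap : ∀ b < nB, s.arr 14 b = nA + 1
  price : ∀ b < nB, s.arr 15 b = 1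
  stack : ∀ a < nA, s.arr 17 a = a
  first : ∀ a < nA, s.arr 18 a = offset P.men a
  cursor : ∀ a < nA, s.arr 20 a = offset P.men a
  top : s.var 5 = nA

theorem runs_prepare {k : ℕ} (hk : prepareProg.Light k = true)
    (hs : (initial P m w).Bdd V) (hV : nA * nB + nA + nB + P.toMarket.E.ncard + 3 ≤ V) :
    Runs k V prepareProg (initial P m w)
      ((nA + nB + P.toMarket.E.ncard + 2) * (rankProg.flatCost + absentExpr.cost + 500))
      (Ready P m w) := by
  have hmm := P.length_men_eq
  have hmw := P.length_women_eq
  generalize hE : P.toMarket.E.ncard = mm at *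
  simp only [prepareProg, Prog.Light, Bool.and_eq_true] at hk
  obtain ⟨k1, k2, k3, k4, k5, k6, k7⟩ := hk
  have hA : (initial P m w).var 0 = nA := rfl
  have hB : (initial P m w).var 1 = nB := rfl
  obtain ⟨t₁, s₁, x₁, u₁, b₁, S₁, o₁⟩ := runs_own (N := nA) (m := mm) (by decide) (by decide)
    (by decide) k1 hs (by omega) hA hmm (offset_zero P.men)
  obtain ⟨t₂, s₂, x₂, u₂, b₂, S₂, o₂⟩ := runs_own (N := nB) (m := mm) (by decide) (by decide)
    (by decide) k2 b₁ (by omega) ((S₁.1 1 (by decide)).trans hB)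
    ((congrFun (S₁.2 3 (by decide)) _).trans hmw)
    ((congrFun (S₁.2 3 (by decide)) _).trans (offset_zero P.women))
  have T₂ := S₁.trans S₂
  obtain ⟨t₃, s₃, x₃, u₃, b₃, S₃, m₁, m₂, m₃, m₄, m₅⟩ := runs_men k3 b₂ (by omega)
    ((T₂.1 0 (by decide)).trans hA) ((T₂.1 1 (by decide)).trans hB)
    (congrFun (T₂.2 8 (by decide)) 0)
  have T₃ := T₂.trans S₃
  obtain ⟨t₄, s₄, x₄, u₄, b₄, S₄, w₁, w₂⟩ := runs_women k4 b₃ (by omega)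
    ((T₃.1 0 (by decide)).trans hA) ((T₃.1 1 (by decide)).trans hB)
  have T₄ := T₃.trans S₄
  have R₄ := S₃.trans S₄
  have own₄ : Layout P.men (s₄.arr 9) := by
    rw [R₄.2 9 (by decide), S₂.2 9 (by decide), Layout, hmm]
    exact o₁
  have ownW₄ : Layout P.women (s₄.arr 10) := by
    rw [R₄.2 10 (by decide), Layout, hmw]
    intro e he
    obtain ⟨a, ha, h⟩ := o₂ e he
    rw [S₁.2 3 (by decide)] at h
    exact ⟨a, ha, h⟩
  have base₄ : ∀ a ≤ nA, s₄.arr 8 a = a * nB := by rwa [S₄.2 8 (by decide)]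
  have hnb : s₄.arr 1 = fun p => (neighbours P.men).getD p 0 := T₄.2 1 (by decide)
  have htn : s₄.arr 2 = fun p => (tieNumbers P.men).getD p 0 := T₄.2 2 (by decide)
  have hnbW : s₄.arr 4 = fun p => (neighbours P.women).getD p 0 := T₄.2 4 (by decide)
  have htnW : s₄.arr 5 = fun p => (tieNumbers P.women).getD p 0 := T₄.2 5 (by decide)
  have h0₄ : s₄.arr 0 nA = mm := (congrFun (T₄.2 0 (by decide)) _).trans hmm
  have hent := fun e (he : e < mm) => own₄.entry P.men_nodup (he.trans_eq hmm.symm)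
  have hentW := fun e (he : e < mm) => ownW₄.entry P.women_nodup (he.trans_eq hmw.symm)
  obtain ⟨t₅, s₅, x₅, u₅, b₅, S₅, v₁, v₂⟩ := runs_matrix (nA := nA) (nB := nB) (m := mm) (by decide)
    (by decide) (by decide) (by decide) (by decide) k5 b₄ (by omega) ((T₄.1 0 (by decide)).trans hA)
    h0₄ base₄
    (by intro e he; obtain ⟨a, b, h, -⟩ := hent e he; rw [h]; exact a.2)
    (by intro e he; obtain ⟨a, b, -, h, -⟩ := hent e he; rw [hnb]; simp only [h]; exact b.2)
    (congrFun (T₄.2 11 (by decide)))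
    (by
      intro e he f hf h h'
      rw [hnb] at h'
      exact own₄.inj P.men_nodup (he.trans_eq hmm.symm) (hf.trans_eq hmm.symm) h h')
  have T₅ := T₄.trans S₅
  have own₅ : s₅.arr 9 = s₄.arr 9 := S₅.2 9 (by decide)
  have ownW₅ : s₅.arr 10 = s₄.arr 10 := S₅.2 10 (by decide)
  have nbW₅ : s₅.arr 4 = s₄.arr 4 := S₅.2 4 (by decide)
  have tnW₅ : s₅.arr 5 = s₄.arr 5 := S₅.2 5 (by decide)
  have base₅ : s₅.arr 8 = s₄.arr 8 := S₅.2 8 (by decide)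
  obtain ⟨t₆, s₆, x₆, u₆, b₆, S₆, v₃, v₄⟩ := runs_matrix (nA := nA) (nB := nB) (m := mm) (by decide)
    (by decide) (by decide) (by decide) (by decide) k6 b₅ (by omega) ((T₅.1 0 (by decide)).trans hA)
    ((congrFun (S₅.2 0 (by decide)) _).trans h0₄) (by rwa [base₅])
    (by
      intro e he
      obtain ⟨b, a, -, h, -⟩ := hentW e he
      rw [nbW₅, hnbW]
      simp only [h]
      exact a.2)
    (by intro e he; obtain ⟨b, a, h, -⟩ := hentW e he; rw [ownW₅, h]; exact b.2)
    (congrFun (T₅.2 12 (by decide)))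
    (by
      intro e he f hf h h'
      rw [nbW₅, hnbW] at h
      rw [ownW₅] at h'
      exact ownW₄.inj P.women_nodup (he.trans_eq hmw.symm) (hf.trans_eq hmw.symm) h' h)
  have T₆ := T₅.trans S₆
  have base₆ : s₆.arr 8 = s₄.arr 8 := (S₆.2 8 (by decide)).trans base₅
  have own₆ : s₆.arr 9 = s₄.arr 9 := (S₆.2 9 (by decide)).trans own₅
  have tab : Tabulates P.toMarket (s₆.matrix nB 11) (s₆.matrix nB 12) := by
    refine PrefLists.tabulates own₄ ownW₄ ?_ ?_ ?_ ?_ <;> rw [‹offset _ _ = mm›]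
    all_goals simp only [Store.matrix, S₆.2 11 (by decide)]
    · intro e he
      have := v₁ e he
      rwa [hnb, htn] at this
    · intro a ha b hb h
      refine v₂ a ha b hb fun e he => ?_
      rw [hnb]
      exact h e he
    · intro e he
      have := v₃ e he
      rwa [nbW₅, hnbW, ownW₅, tnW₅, htnW] at this
    · intro a ha b hb h
      refine v₄ a ha b hb fun e he => ?_
      rw [nbW₅, hnbW, ownW₅]
      exact h e he
  have m₆ : s₆.var 2 = m := T₆.1 2 (by decide)
  have w₆ : s₆.var 3 = w := T₆.1 3 (by decide)
  obtain ⟨t₇, s₇, x₇, u₇, b₇, S₇, v₅⟩ := runs_rank (nA := nA) (nB := nB) (mm := mm) k7 b₆ (by omega)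
    ((T₆.1 0 (by decide)).trans hA) ((congrFun (T₆.2 0 (by decide)) _).trans hmm)
    (by rw [m₆]; exact m.2) (by rwa [base₆])
    (by rw [own₆]; intro e he; obtain ⟨a, b, h, -⟩ := hent e he; rw [h]; exact a.2)
  have R₇ := (S₅.trans S₆).trans S₇
  have Q₇ := S₄.trans R₇
  refine ⟨_, s₇, x₁.seq (x₂.seq (x₃.seq (x₄.seq (x₅.seq (x₆.seq x₇))))), ?_, b₇, ?_⟩
  · generalize rankProg.flatCost = c₁ at *
    generalize absentExpr.cost = c₂ at *
    have e1 : (nA + nB + mm + 2) * (c₁ + c₂ + 500) = (mm + 2) * (c₁ + c₂ + 100) +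
        (nA + nB) * (c₁ + c₂ + 100) + (nA + nB + mm + 2) * 400 := by ring
    have e2 := Nat.zero_le ((nA + nB) * (c₁ + c₂ + 100))
    omega
  · have tab₇ : s₇.matrix nB 11 = s₆.matrix nB 11 ∧ s₇.matrix nB 12 = s₆.matrix nB 12 := by
      constructor <;> funext a b <;> simp only [Store.matrix]
      · rw [S₇.2 11 (by decide)]
      · rw [S₇.2 12 (by decide)]
    have own₇ : s₇.arr 9 = s₄.arr 9 := (S₇.2 9 (by decide)).trans own₆
    refine ⟨⟨fun x hx => (T₆.trans S₇).1 x ?_, fun r hr => (T₆.trans S₇).2 r ?_⟩, ?_, ?_, ?_, ?_, ?_,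
      ?_, ?_, ?_, ?_, ?_⟩
    · simp at hx ⊢; omega
    · simp at hr ⊢; omega
    · rw [own₇]; exact own₄
    · rw [S₇.2 8 (by decide), base₆]; exact base₄
    · rw [tab₇.1, tab₇.2]; exact tab
    · rw [tab₇.1, tab₇.2, own₇, PrefLists.PrunedRank, hmm, ← m₆, ← w₆, ← own₆]
      have h1 : s₆.arr 1 = fun p => (neighbours P.men).getD p 0 := T₆.2 1 (by decide)
      rwa [h1] at v₅
    · rw [R₇.2 14 (by decide)]; exact w₁
    · rw [R₇.2 15 (by decide)]; exact w₂
    · rw [Q₇.2 17 (by decide)]; exact m₃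
    · rw [Q₇.2 18 (by decide)]
      intro a ha
      rw [m₄ a ha, T₂.2 0 (by decide)]; rfl
    · rw [Q₇.2 20 (by decide)]
      intro a ha
      rw [m₅ a ha, T₂.2 0 (by decide)]; rfl
    · rw [Q₇.1 5 (by decide)]; exact m₁

/-- The instance on which the main loop works. -/
noncomputable def Ready.edgeList {s : Store} (h : Ready P m w s) : EdgeList :=
  P.edgeList (s.arr 9) (s.arr 13) h.own (h.rank.spec h.table h.own)

theorem Ready.holds {s : Store} (h : Ready P m w s) : Holds h.edgeList s where
  nA := h.same.1 0 (by decide)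
  nB := h.same.1 1 (by decide)
  off := h.same.2 0 (by decide)
  nb := h.same.2 1 (by decide)
  tn := h.same.2 2 (by decide)
  own := rfl
  R := rfl

theorem Ready.inv {s : Store} (h : Ready P m w s) : h.edgeList.Inv (stateOf s) :=
  EdgeList.inv_initial _ h.cap h.price (congrFun (h.same.2 16 (by decide))) h.stack h.first
    (congrFun (h.same.2 19 (by decide))) h.cursor h.top

theorem runs_main {k : ℕ} (hk : mainProg.Light k = true) {s : Store} (hs : s.Bdd V)
    (h : Ready P m w s) (hV : nA + nB + P.toMarket.E.ncard + 3 ≤ V) :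
    Runs k V mainProg s
      ((4 * ((nB + 2) * P.toMarket.E.ncard) + nA + 1) * (stepProg.flatCost + 2))
      (fun s' => SameInput s s' ∧ h.edgeList.Inv (stateOf s') ∧ s'.var 5 = 0) := by
  have hV' : h.edgeList.nA + h.edgeList.nB + h.edgeList.mm + 3 ≤ V := by
    rwa [← P.length_men_eq] at hV
  refine (Runs.loop (by omega) hk (MainInv h.edgeList s)
    (fun t => h.edgeList.measure (stateOf t)) (fun t ht hI he => wp_step hV' ht hI he) hs
    ⟨h.holds, SameInput.refl s, h.inv⟩).mono ?_ fun s' _ ⟨⟨_, h1, h2⟩, h3⟩ => ⟨h1, h2, h3⟩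
  refine Nat.mul_le_mul_right _ (Nat.succ_le_succ ?_)
  have h1 := EdgeList.measure_initial_le h.edgeList (σ := stateOf s) h.first
  rw [← P.length_men_eq]
  exact h1.trans_eq (congrArg _ h.top)

end StrongStable

/-! ### Correctness and cost of a whole query -/

namespace StrongStable

open StrongStable.Expr StrongStable.Prog

variable {nA nB V : ℕ} {P : PrefLists nA nB} {m : Fin nA} {w : Fin nB}

theorem runs_finish {k : ℕ} (hk : (Prog.seq outProg checkProg).Light k = true) {s₀ s : Store}
    (hs : s.Bdd V) (h : Ready P m w s₀) (hmw : (m, w) ∈ P.toMarket.E) (hin : SameInput s₀ s)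
    (hI : h.edgeList.Inv (stateOf s)) (hsp : s.var 5 = 0)
    (hV : nA + nB + P.toMarket.E.ncard + 2 ≤ V) :
    Runs k V (Prog.seq outProg checkProg) s ((nB + 2) * 80 +
      (P.toMarket.E.ncard + 2) * (checkProg.flatCost + blocksExpr.cost + 100))
      (CorrectOutput P.toMarket m w) := by
  simp only [Prog.Light, Bool.and_eq_true] at hk
  have hr : h.edgeList.Represents (P.toMarket.pruned m w) := h.rank.represents h.table h.own hmw
  have hown : s.arr 9 = h.edgeList.own := hin.2 9 (by decide)
  have hmm := P.length_men_eq
  -- Engagements are edges of the pruned graph, so they avoid `m` and `w`, and the pair can be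
  -- added.
  have hpair : ∀ b < nB, ∀ e, s.arr 16 b = e + 1 → ∃ (a : Fin nA) (b' : Fin nB),
      b = b' ∧ s.arr 9 e = a ∧ a ≠ m ∧ b' ≠ w ∧
      (a, b') ∈ h.edgeList.pairs nA nB (h.edgeList.engaged (stateOf s)) := by
    intro b hb e he
    obtain ⟨h1, h2, -⟩ := hI.mate b hb e he
    have h3 := h.edgeList.own_lt e h1
    have h4 : ((⟨h.edgeList.own e, h3⟩, ⟨b, hb⟩) : Fin nA × Fin nB) ∈
        h.edgeList.pairs nA nB (h.edgeList.engaged (stateOf s)) := ⟨e, ⟨b, hb, he⟩, rfl, h2⟩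
    have h5 := Market.pruned_ne (EdgeList.pairs_engaged_subset hI hr h4)
    exact ⟨_, _, rfl, by rw [hown], h5.1, h5.2, h4⟩
  have hspec : ∀ (a : Fin nA) (b : Fin nB), ((a : ℕ) = m ∧ (b : ℕ) = w) ∨ ((b : ℕ) < nB ∧
      s.arr 16 b ≠ 0 ∧ s.arr 9 (s.arr 16 b - 1) = a) ↔
      (a, b) ∈ h.edgeList.result (stateOf s) m w := by
    intro a b
    constructor
    · rintro (⟨h1, h2⟩ | ⟨h1, h2, h3⟩)
      · rw [Fin.ext h1, Fin.ext h2]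
        exact Or.inr rfl
      · obtain ⟨e, he⟩ := Nat.exists_eq_succ_of_ne_zero h2
        obtain ⟨a', b', h4, h5, -, -, h6⟩ := hpair b h1 e he
        rw [he, Nat.succ_sub_one, h5] at h3
        rw [← Fin.ext h3, Fin.ext h4]
        exact Or.inl h6
    · rintro (⟨e, ⟨b', hb', he⟩, h1, h2⟩ | h1)
      · obtain ⟨-, h3, -⟩ := hI.mate b' hb' e he
        obtain rfl : b' = b := h3.symm.trans h2
        have he : s.arr 16 b = e + 1 := he
        refine Or.inr ⟨hb', by omega, ?_⟩
        rw [he, Nat.add_sub_cancel, hown]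
        exact h1
      · obtain ⟨rfl, rfl⟩ := Prod.mk.inj h1
        exact Or.inl ⟨rfl, rfl⟩
  have e0 : s.var 0 = nA := (hin.1 0 (by decide)).trans (h.same.1 0 (by decide))
  obtain ⟨t₁, s₁, x₁, u₁, b₁, S₁, o₄, o₆, o₇⟩ := runs_out (nA := nA) (nB := nB) hk.1 hs (by omega)
    ((hin.1 1 (by decide)).trans (h.same.1 1 (by decide)))
    ((hin.1 2 (by decide)).trans (h.same.1 2 (by decide)))
    ((hin.1 3 (by decide)).trans (h.same.1 3 (by decide))) m.2 w.2
    (congrFun ((hin.2 6 (by decide)).trans (h.same.2 6 (by decide))))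
    (congrFun ((hin.2 7 (by decide)).trans (h.same.2 7 (by decide))))
    (by
      intro b hb hN
      obtain ⟨e, he⟩ := Nat.exists_eq_succ_of_ne_zero hN
      obtain ⟨a, -, -, h1, -⟩ := hpair b hb e he
      rw [he, Nat.succ_sub_one, h1]
      exact a.2)
    (by
      intro b hb b' hb' hN hN' hbb
      obtain ⟨e, he⟩ := Nat.exists_eq_succ_of_ne_zero hN
      obtain ⟨e', he'⟩ := Nat.exists_eq_succ_of_ne_zero hN'
      rw [he, he', hown] at hbb
      exact EdgeList.mate_own_inj hI hb hb' he he' hbb)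
    (by
      intro b hb hN
      obtain ⟨e, he⟩ := Nat.exists_eq_succ_of_ne_zero hN
      obtain ⟨a, -, -, h1, h2, -⟩ := hpair b hb e he
      rw [he, Nat.succ_sub_one, h1]
      exact fun h3 => h2 (Fin.ext h3))
    (by
      by_contra hN
      obtain ⟨e, he⟩ := Nat.exists_eq_succ_of_ne_zero hN
      obtain ⟨-, b', h1, -, -, h2, -⟩ := hpair w w.2 e he
      exact h2 (Fin.ext h1.symm))
  have hlt : ∀ a b, s₁.arr 7 b = a + 1 → a < nA ∧ b < nB := by
    intro a b h1
    rcases (o₇ a b).1 h1 with ⟨rfl, rfl⟩ | ⟨h2, h3, h4⟩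
    · exact ⟨m.2, w.2⟩
    · obtain ⟨e, he⟩ := Nat.exists_eq_succ_of_ne_zero h3
      obtain ⟨a', -, -, h5, -⟩ := hpair b h2 e he
      rw [he, Nat.succ_sub_one, h5] at h4
      exact ⟨h4 ▸ a'.2, h2⟩
  have r0 : s₁.arr 0 = offset P.men :=
    (S₁.2 0 (by decide)).trans ((hin.2 0 (by decide)).trans (h.same.2 0 (by decide)))
  have r1 : s₁.arr 1 = fun p => (neighbours P.men).getD p 0 :=
    (S₁.2 1 (by decide)).trans ((hin.2 1 (by decide)).trans (h.same.2 1 (by decide)))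
  have r8 : s₁.arr 8 = s₀.arr 8 := (S₁.2 8 (by decide)).trans (hin.2 8 (by decide))
  have r9 : s₁.arr 9 = s₀.arr 9 := (S₁.2 9 (by decide)).trans (hin.2 9 (by decide))
  have r11 : s₁.matrix nB 11 = s₀.matrix nB 11 := by
    funext a b
    simp only [Store.matrix, S₁.2 11 (by decide), hin.2 11 (by decide)]
  have r12 : s₁.matrix nB 12 = s₀.matrix nB 12 := by
    funext a b
    simp only [Store.matrix, S₁.2 12 (by decide), hin.2 12 (by decide)]
  obtain ⟨t₂, s₂, x₂, u₂, b₂, S₂, o⟩ := runs_check (nA := nA) (nB := nB)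
    (mm := P.toMarket.E.ncard) hk.2 b₁ (by omega) ((S₁.1 0 (by decide)).trans e0) (by rw [r0, hmm])
    (by rw [r8]; exact h.base)
    (by
      intro e he
      obtain ⟨a, b, h1, -⟩ := h.own.entry P.men_nodup (he.trans_eq hmm.symm)
      rw [r9, h1]
      exact a.2)
    (by
      intro b
      rcases h1 : s₁.arr 7 b with _ | a
      · exact Nat.zero_le _
      · exact (hlt a b h1).1)
    o₄
  refine ⟨_, s₂, x₁.seq x₂, Nat.add_le_add u₁ u₂, b₂, ?_⟩
  rw [r11, r12, r9, r1] at o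
  beta_reduce at o
  have hM := EdgeList.isMatching_result hI hr hmw
  have hμ : ∀ (a : Fin nA) k, s₁.arr 6 a = k + 1 ↔
      ∃ b : Fin nB, k = b ∧ (a, b) ∈ h.edgeList.result (stateOf s) m w := by
    intro a k
    rw [o₆]
    constructor
    · intro h1
      have hkB : k < nB := by
        rcases h1 with ⟨-, rfl⟩ | ⟨h1, -⟩
        · exact w.2
        · exact h1
      exact ⟨⟨k, hkB⟩, rfl, (hspec a ⟨k, hkB⟩).1 h1⟩
    · rintro ⟨b, rfl, h1⟩
      exact (hspec a b).2 h1
  have hν : ∀ (b : Fin nB) k, s₁.arr 7 b = k + 1 ↔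
      ∃ a : Fin nA, k = a ∧ (a, b) ∈ h.edgeList.result (stateOf s) m w := by
    intro b k
    constructor
    · intro h1
      have hkA := (hlt k b h1).1
      exact ⟨⟨k, hkA⟩, rfl, (hspec ⟨k, hkA⟩ b).1 ((o₇ k b).1 h1)⟩
    · rintro ⟨a, rfl, h1⟩
      exact (o₇ a b).2 ((hspec a b).2 h1)
  -- The test ran over all edges of `G`, not only of the pruned graph, so its outcome decides strong
  -- stability of the result.
  rcases o with ⟨h4, e, he, hb⟩ | ⟨h4, hnb⟩
  · refine Or.inl ⟨EdgeList.stableSetWith_eq_empty hI hsp hr fun hst => ?_, h4⟩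
    obtain ⟨a, b, h1, h2, h3, -⟩ := h.own.entry P.men_nodup (he.trans_eq hmm.symm)
    rw [h1, h2, h.table.blocks_iff hM hμ hν h3] at hb
    exact hst.2 _ _ hb
  · have hst : h.edgeList.result (stateOf s) m w ∈ P.toMarket.stableSet := by
      refine ⟨hM, fun a b hb => ?_⟩
      obtain ⟨e, he, h1, h2, -⟩ := h.own.exists P.men_nodup (a := a) (b := b) hb.1
      have h3 := hnb e (he.trans_eq hmm)
      rw [h1, h2, h.table.blocks_iff hM hμ hν hb.1] at h3
      exact h3 hb
    have hopt := EdgeList.isManOptimal_result hI hsp hr hst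
    refine Or.inr ⟨Set.nonempty_iff_ne_empty.1 ⟨_, hopt.1⟩, h4, _, hopt, fun a => ?_⟩
    rw [S₂.2 6 (by decide)]
    refine ⟨fun b => ?_, fun hno => ?_⟩
    · rw [hμ]
      refine ⟨fun h1 => ⟨b, rfl, h1⟩, ?_⟩
      rintro ⟨b', h1, h2⟩
      rwa [Fin.ext h1]
    · by_contra h1
      obtain ⟨k, hk⟩ := Nat.exists_eq_succ_of_ne_zero h1
      obtain ⟨b, -, h2⟩ := (hμ a k).1 hk
      exact hno b h2

/-- The program answers every query in time `O(n m)` on words of `O(log n)` bits. -/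
theorem exec_query (nA nB : ℕ) (P : PrefLists nA nB) (m : Fin nA) (w : Fin nB)
    (hmw : (m, w) ∈ P.toMarket.E) :
    ∃ t s, Exec (40000 * (nA + nB) ^ 2) queryProg (initial P m w) t s ∧
      t ≤ 40000 * ((nA + nB) * P.toMarket.E.ncard) ∧ CorrectOutput P.toMarket m w s := by
  have hA : 0 < nA := m.pos
  have hB : 0 < nB := w.pos
  have hE : 0 < P.toMarket.E.ncard := (Set.ncard_pos (Set.toFinite _)).2 ⟨_, hmw⟩
  have hEle := P.ncard_le
  -- A generous bound on the weights of all expressions of the program, checked by computation.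
  have hL : queryProg.Light 10000 = true := by decide
  simp only [queryProg, Prog.Light, Bool.and_eq_true] at hL
  obtain ⟨l₁, l₂, l₃⟩ := hL
  have hl₃ : (Prog.seq outProg checkProg).Light 10000 = true := by
    simp only [Prog.Light, Bool.and_eq_true]; exact l₃
  set mm := P.toMarket.E.ncard with hmm
  have hsq : (nA + nB) ^ 2 = nA * nA + 2 * (nA * nB) + nB * nB := by ring
  have h1 : nA ≤ nA * nB := Nat.le_mul_of_pos_right _ hB
  have h2 : nB ≤ nA * nB := Nat.le_mul_of_pos_left _ hA
  -- Large enough for the indices of the matrices, the positions and the special ranks; with the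
  -- weight bound it gives the word bound `10000 * V`.
  obtain ⟨V, hVdef⟩ : ∃ V, V = 4 * (nA + nB) ^ 2 := ⟨_, rfl⟩
  have hV : nA * nB + nA + nB + mm + 3 ≤ V := by omega
  obtain ⟨t₁, s₁, x₁, u₁, b₁, h⟩ := runs_prepare (V := V) (P := P) (m := m) (w := w) l₁
    (P.initial_bdd m w (by omega) (by omega) (by omega)) hV
  obtain ⟨t₂, s₂, x₂, u₂, b₂, hin, hI, hsp⟩ := runs_main (V := V) l₂ b₁ h (by omega)
  obtain ⟨t₃, s₃, x₃, u₃, b₃, hout⟩ := runs_finish (V := V) hl₃ b₂ h hmw hin hI hsp (by omega)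
  refine ⟨t₁ + (t₂ + t₃), s₃, ?_, ?_, hout⟩
  · have hW : 40000 * (nA + nB) ^ 2 = 10000 * V := by omega
    rw [hW]
    exact x₁.seq (x₂.seq x₃)
  -- The cost per iteration of the three phases; all lower-order terms are absorbed since `nA`, `nB`
  -- and the number of edges are positive.
  · have c₁ : rankProg.flatCost + absentExpr.cost + 500 = 678 := by decide
    have c₂ : stepProg.flatCost + 2 = 126 := by decide
    have c₃ : checkProg.flatCost + blocksExpr.cost + 100 = 226 := by decide
    rw [c₁] at u₁
    rw [c₂] at u₂
    rw [c₃] at u₃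
    have h3 : (nB + 2) * mm = nB * mm + 2 * mm := by ring
    have h4 : (nA + nB) * mm = nA * mm + nB * mm := by ring
    have h5 : nA ≤ nA * mm := Nat.le_mul_of_pos_right _ hE
    have h6 : nB ≤ nB * mm := Nat.le_mul_of_pos_right _ hE
    have h7 : mm ≤ nA * mm := Nat.le_mul_of_pos_left _ hA
    rw [← hmm] at u₁ u₂ u₃
    omega

end StrongStable

theorem mainTheorem2 :
    -- the pruned subgraph of an edge `(m, w)`
    (∀ (A B : Type*) [Finite A] [Finite B] (G : StrongStable.Market A B) (m : A) (w : B),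
      (m, w) ∈ G.E →
        (∀ M ∈ G.stableSetWith m w, M \ {(m, w)} ∈ (G.pruned m w).stableSet) ∧
        ((∀ N ∈ (G.pruned m w).stableSet, N ∪ {(m, w)} ∈ G.stableSet) ∨
          G.stableSetWith m w = ∅) ∧
        (∀ N, (G.pruned m w).IsManOptimal (G.pruned m w).stableSet N →
          N ∪ {(m, w)} ∈ G.stableSet →
          G.IsManOptimal (G.stableSetWith m w) (N ∪ {(m, w)}))) ∧
    -- one program that answers every query in time `O(n m)`, on words of `O(log n)` bits
    (∃ (prog : StrongStable.Prog) (C k : ℕ),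
      ∀ (nA nB : ℕ) (P : StrongStable.PrefLists nA nB) (m : Fin nA) (w : Fin nB),
        (m, w) ∈ P.toMarket.E →
          ∃ (t : ℕ) (s : StrongStable.Store),
            StrongStable.Exec (C * (nA + nB) ^ k) prog (StrongStable.initial P m w) t s ∧
            t ≤ C * ((nA + nB) * P.toMarket.E.ncard) ∧
            StrongStable.CorrectOutput P.toMarket m w s) := by
  refine ⟨fun A B _ _ G m w _ => ⟨fun M hM => StrongStable.Market.diff_mem_pruned hM, ?_,
    fun N hN hU => StrongStable.Market.isManOptimal_union hN hU⟩,
    StrongStable.queryProg, 40000, 2, StrongStable.exec_query⟩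
  rcases (G.stableSetWith m w).eq_empty_or_nonempty with h | ⟨M, hM⟩
  · exact Or.inr h
  · exact Or.inl fun N hN => StrongStable.Market.union_mem_stableSet hM hN
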